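/- Let $\mathcal N\subset B(H)$ be a von Neumann algebra on a complex Hilbert space $H$ with a faithful normal semifinite trace $\tau$. For $A\in\mathcal N$ put $\mu(t,A)=\inf\{\|Ap\|: p\in\mathcal N \text{ a projection},\ \tau(1-p)\le t\}$, and let $$\mathcal M_{1,\infty}=\Big\{A\in\mathcal N:\ \sup_{t>0}\frac1{\log(1+t)}\int_0^t\mu(s,A)\,ds<\infty\Big\}.$$ Let $L_\infty(0,\infty)$ be the space of bounded Lebesgue measurable real functions on $(0,\infty)$. A generalised limit is a positive linear functional $\omega:L_\infty(0,\infty)\to\mathbb R$ with $\omega(1)=1$ and $\omega(z)=0$ whenever $z(t)\to0$ as $t\to\infty$; it is dilation invariant if $\omega(t\mapsto z(t/s))=\omega(z)$ for all $z\in L_\infty(0,\infty)$ and $s>0$; it is extended complex-linearly to complex-valued functions. Let $(Mz)(t)=\frac1{\log t}\int_1^t z(s)\frac{ds}{s}$, and write $(\omega\circ M)(z)=\omega(Mz)$ for every locally integrable $z$ on $(0,\infty)$ with $Mz$ bounded. For $B\in\mathcal N$, a function $f$ on $[0,\infty)$ and a positive $A\in\mathcal M_{1,\infty}$ put $$\xi_{\omega,B,f}(A)=(\omega\circ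 M)\Big(t\mapsto\frac1t\,\tau(f(tA)B)\Big),$$ and for arbitrary $A\in\mathcal M_{1,\infty}$ put $$\xi_{\omega,B,f}(A)=\xi_{\omega,B,f}((\Re A)_+)-\xi_{\omega,B,f}((\Re A)_-)+i\big(\xi_{\omega,B,f}((\Im A)_+)-\xi_{\omega,B,f}((\Im A)_-)\big).$$ Fix $q>0$ and let $\xi_\omega=\xi_{\omega,1,g}$ with $g(x)=\exp(-x^{-q})$ for $x>0$ and $g(0)=0$; thus $\xi_\omega(A)=(\omega\circ M)\big(t\mapsto\frac1t\tau(\exp(-(tA)^{-q}))\big)$ for positive $A\in\mathcal M_{1,\infty}$. Theorem. Let $f\in C^2[0,\infty)$ be a bounded real function with $f(0)=f'(0)=0$, let $A\in\mathcal M_{1,\infty}$ and $B\in\mathcal N$, and let $\omega$ be any dilation invariant generalised limit. Then $AB\in\mathcal M_{1,\infty}$, the integral $\int_0^\infty f(s)s^{-2}\,ds$ converges absolutely, $\xi_{\omega,B,f}(A)$ and $\xi_\omega(AB)$ are well defined (on each of the positive operators that occur, the operators under $\tau$ are trace class, and the function to which $M$ is applied is locally integrable with bounded image under $M$), and $$\xi_{\omega,B,f}(A)=\frac1{\Gamma(1+1/q)}\Big(\int_0^\infty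 f(s)\frac{ds}{s^2}\Big)\,\xi_\omega(AB).$$ -/

import Mathlib

open Set Filter Topology MeasureTheory
open scoped ENNReal ComplexStarModule

noncomputable section

namespace NCHeat

/-! ### Bounded functions on the half-line and generalised limits -/

/-- The half-line `(0,∞)`. -/
abbrev HalfLine : Type := Ioi (0 : ℝ)

/-- Lebesgue measure on `(0,∞)`. -/
def lebesgue : Measure HalfLine := Measure.comap (fun t : HalfLine => (t : ℝ)) volume

/-- `L_∞(0,∞)`: the real vector space of all bounded Lebesgue measurable real functions on `(0,∞)`
(`AEMeasurable` with respect to Lebesgue measure is Lebesgue measurability). -/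
def LInfty : Submodule ℝ (HalfLine → ℝ) where
  carrier := {x | AEMeasurable x lebesgue ∧ ∃ C : ℝ, ∀ t, |x t| ≤ C}
  add_mem' := by
    rintro x y ⟨hx, C, hC⟩ ⟨hy, D, hD⟩
    exact ⟨hx.add hy, C + D, fun t => (abs_add_le _ _).trans (add_le_add (hC t) (hD t))⟩
  zero_mem' := ⟨aemeasurable_const, 0, fun t => by simp⟩
  smul_mem' := by
    rintro c x ⟨hx, C, hC⟩
    refine ⟨hx.const_smul c, |c| * C, fun t => ?_⟩
    simpa [abs_mul] using mul_le_mul_of_nonneg_left (hC t) (abs_nonneg c)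

/-- The constant function `1`. -/
def LInfty.one : LInfty := ⟨fun _ => 1, aemeasurable_const, 1, fun _ => by simp⟩

/-- The map `t ↦ t / s` of the half-line, for `s > 0`. -/
def scale (s t : HalfLine) : HalfLine := ⟨(t : ℝ) / s, mem_Ioi.2 (div_pos (mem_Ioi.1 t.2) (mem_Ioi.1 s.2))⟩

theorem quasiMeasurePreserving_scale (s : HalfLine) :
    Measure.QuasiMeasurePreserving (scale s) lebesgue lebesgue := by
  have hm : Measurable (scale s) := (measurable_subtype_coe.div_const _).subtype_mk
  refine ⟨hm, Measure.AbsolutelyContinuous.mk fun S hS h0 => ?_⟩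
  have hemb := MeasurableEmbedding.subtype_coe (measurableSet_Ioi (a := (0 : ℝ)))
  rw [Measure.map_apply hm hS]
  have key : ∀ T : Set HalfLine, lebesgue T = volume ((↑) '' T : Set ℝ) := fun T =>
    (hemb.comap_apply volume T)
  rw [key] at h0 ⊢
  have hsub : ((↑) '' (scale s ⁻¹' S) : Set ℝ) ⊆ (fun r : ℝ => r / (s : ℝ)) ⁻¹' ((↑) '' S) := by
    rintro _ ⟨t, ht, rfl⟩
    exact ⟨scale s t, ht, rfl⟩
  refine measure_mono_null hsub ?_
  have hs : ((s : ℝ)⁻¹) ≠ 0 := inv_ne_zero (ne_of_gt (mem_Ioi.1 s.2))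
  have := Real.volume_preimage_mul_right hs ((↑) '' S : Set ℝ)
  simp only [div_eq_mul_inv]
  rw [this, h0, mul_zero]

/-- The dilation `(σ_s x)(t) = x(t / s)` on `L_∞(0,∞)`, for `s > 0`. -/
def dilation (s : HalfLine) (x : LInfty) : LInfty :=
  ⟨fun t => x.1 (scale s t), x.2.1.comp_quasiMeasurePreserving (quasiMeasurePreserving_scale s),
    x.2.2.imp fun _ h t => h (scale s t)⟩

/-- A generalised limit: a positive normalised linear functional on `L_∞(0,∞)` that vanishes on
every function tending to `0` at `∞`. -/
structure IsGeneralisedLimit (ω : LInfty →ₗ[ℝ] ℝ) : Prop where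
  nonneg : ∀ x : LInfty, (∀ t, 0 ≤ x.1 t) → 0 ≤ ω x
  one : ω LInfty.one = 1
  vanish : ∀ x : LInfty, Tendsto x.1 atTop (𝓝 0) → ω x = 0

/-- Dilation invariance of a linear functional on `L_∞(0,∞)`. -/
def IsDilationInvariant (ω : LInfty →ₗ[ℝ] ℝ) : Prop :=
  ∀ (s : HalfLine) (x : LInfty), ω (dilation s x) = ω x

/-- The function on `(0,∞)` given by `u` belongs to `L_∞(0,∞)`. -/
def MemLInfty (u : ℝ → ℝ) : Prop := (fun t : HalfLine => u t) ∈ LInfty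

open Classical in
/-- The value of `ω` at the function `u|_(0,∞)`; the value `0` is used outside `L_∞(0,∞)`. -/
def evalAt (ω : LInfty →ₗ[ℝ] ℝ) (u : ℝ → ℝ) : ℝ :=
  if h : MemLInfty u then ω ⟨fun t : HalfLine => u t, h⟩ else 0

/-- The complex-linear extension of `ω` to complex-valued functions. -/
def evalComplex (ω : LInfty →ₗ[ℝ] ℝ) (z : ℝ → ℂ) : ℂ :=
  (evalAt ω fun t => (z t).re : ℂ) + Complex.I * (evalAt ω fun t => (z t).im : ℂ)

/-- The Cesàro operator `(Mz)(t) = (1 / log t) ∫_1^t z(s) ds/s`. -/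
def cesaro (z : ℝ → ℂ) (t : ℝ) : ℂ :=
  ((Real.log t)⁻¹ : ℂ) * ∫ s in (1 : ℝ)..t, z s / (s : ℂ)

/-- `z` is locally integrable on `(0,∞)` and `Mz` is a bounded measurable function, so that
`(ω ∘ M)(z)` is meaningful. -/
structure CesaroBounded (z : ℝ → ℂ) : Prop where
  locallyIntegrable : LocallyIntegrableOn z (Ioi 0) volume
  re_mem : MemLInfty fun t => (cesaro z t).re
  im_mem : MemLInfty fun t => (cesaro z t).im

/-- `(ω ∘ M)(z)`. -/
def evalCesaro (ω : LInfty →ₗ[ℝ] ℝ) (z : ℝ → ℂ) : ℂ := evalComplex ω (cesaro z)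

/-! ### Operators, traces and the ideal `𝓜_{1,∞}` -/

variable {H : Type*} [NormedAddCommGroup H] [InnerProductSpace ℂ H] [CompleteSpace H]

/-- The four positive operators `(Re A)₊, (Re A)₋, (Im A)₊, (Im A)₋` of the Jordan
decomposition of `A`. -/
def jordanParts (A : H →L[ℂ] H) : Set (H →L[ℂ] H) :=
  {(ℜ A : H →L[ℂ] H)⁺, (ℜ A : H →L[ℂ] H)⁻, (ℑ A : H →L[ℂ] H)⁺, (ℑ A : H →L[ℂ] H)⁻}

/-- The extension of a functional `φ`, given on positive operators, by the formula
`φ(A) = φ((Re A)₊) - φ((Re A)₋) + i (φ((Im A)₊) - φ((Im A)₋))`. -/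
def jordanExtend (φ : (H →L[ℂ] H) → ℂ) (A : H →L[ℂ] H) : ℂ :=
  (φ ((ℜ A : H →L[ℂ] H)⁺) - φ ((ℜ A : H →L[ℂ] H)⁻)) +
    Complex.I * (φ ((ℑ A : H →L[ℂ] H)⁺) - φ ((ℑ A : H →L[ℂ] H)⁻))

/-- A faithful normal semifinite trace on the von Neumann algebra `N`. Only the values of `toFun`
on the positive elements of `N` carry meaning. -/
structure FNSTrace (N : VonNeumannAlgebra H) where
  toFun : (H →L[ℂ] H) → ℝ≥0∞
  map_add : ∀ S ∈ N, ∀ T ∈ N, 0 ≤ S → 0 ≤ T → toFun (S + T) = toFun S + toFun T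
  map_smul : ∀ c : ℝ, 0 ≤ c → ∀ T ∈ N, 0 ≤ T → toFun (c • T) = ENNReal.ofReal c * toFun T
  tracial : ∀ T ∈ N, toFun (star T * T) = toFun (T * star T)
  faithful : ∀ T ∈ N, 0 ≤ T → toFun T = 0 → T = 0
  normal : ∀ D : Set (H →L[ℂ] H), D.Nonempty → DirectedOn (· ≤ ·) D →
    (∀ S ∈ D, S ∈ N ∧ 0 ≤ S) → ∀ T ∈ N, IsLUB D T → toFun T = ⨆ S ∈ D, toFun S
  semifinite : ∀ T ∈ N, 0 ≤ T → T ≠ 0 → ∃ S ∈ N, 0 ≤ S ∧ S ≤ T ∧ S ≠ 0 ∧ toFun S < ∞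

variable {N : VonNeumannAlgebra H}

namespace FNSTrace

/-- `T ∈ N` with `τ(|T|) < ∞`. -/
def IsTraceClass (τ : FNSTrace N) (T : H →L[ℂ] H) : Prop := T ∈ N ∧ τ.toFun (CFC.abs T) < ∞

/-- The linear extension of `τ` to the trace class operators of `N`. -/
def tr (τ : FNSTrace N) (T : H →L[ℂ] H) : ℂ :=
  jordanExtend (fun P => ((τ.toFun P).toReal : ℂ)) T

/-- The generalised singular value function
`μ(t, A) = inf {‖Ap‖ : p a projection of N, τ(1 - p) ≤ t}`. -/
def singularValue (τ : FNSTrace N) (t : ℝ) (A : H →L[ℂ] H) : ℝ :=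
  sInf {r | ∃ p ∈ N, IsStarProjection p ∧ τ.toFun (1 - p) ≤ ENNReal.ofReal t ∧ r = ‖A * p‖}

/-- The Marcinkiewicz (Dixmier) ideal `𝓜_{1,∞}`: all `A ∈ N` with
`sup_{t>0} (1 / log(1+t)) ∫_0^t μ(s, A) ds < ∞`. -/
def dixmierIdeal (τ : FNSTrace N) : Set (H →L[ℂ] H) :=
  {A | A ∈ N ∧ ∃ C : ℝ, ∀ t : ℝ, 0 < t →
    (Real.log (1 + t))⁻¹ * (∫ s in (0 : ℝ)..t, τ.singularValue s A) ≤ C}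

/-- The function `t ↦ (1/t) τ(f(tA)B)`, for `A ≥ 0`, with `f(tA)` given by functional calculus. -/
def heat (τ : FNSTrace N) (f : ℝ → ℝ) (B A : H →L[ℂ] H) (t : ℝ) : ℂ :=
  (t : ℂ)⁻¹ * τ.tr (cfc f (t • A) * B)

/-- For the positive operator `A`, all the `f(tA)B` are trace class and the function
`M(t ↦ (1/t) τ(f(tA)B))` is bounded. -/
structure HeatAdmissible (τ : FNSTrace N) (f : ℝ → ℝ) (B A : H →L[ℂ] H) : Prop where
  mem : A ∈ τ.dixmierIdeal
  traceClass : ∀ t : ℝ, 0 < t → τ.IsTraceClass (cfc f (t • A) * B)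
  bounded : CesaroBounded (τ.heat f B A)

/-- `ξ_{ω,B,f}`: on positive operators it is `(ω ∘ M)(t ↦ (1/t) τ(f(tA)B))`, and it is extended
through the Jordan decomposition. -/
def xiGen (τ : FNSTrace N) (ω : LInfty →ₗ[ℝ] ℝ) (B : H →L[ℂ] H) (f : ℝ → ℝ)
    (A : H →L[ℂ] H) : ℂ :=
  jordanExtend (fun P => evalCesaro ω (τ.heat f B P)) A

end FNSTrace

/-- The function `x ↦ exp(-x^{-q})` on `[0,∞)`, equal to `0` at `0`. -/
def expInv (q : ℝ) (x : ℝ) : ℝ := if x ≤ 0 then 0 else Real.exp (-(x ^ (-q)))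

/-- `ξ_ω`: on positive operators it is `(ω ∘ M)(t ↦ (1/t) τ(exp(-(tA)^{-q})))`, and it is extended
through the Jordan decomposition. -/
def FNSTrace.xi (τ : FNSTrace N) (q : ℝ) (ω : LInfty →ₗ[ℝ] ℝ) (A : H →L[ℂ] H) : ℂ :=
  τ.xiGen ω 1 (expInv q) A

end NCHeat

end

open NCHeat

/-!
A positive operator `P` lies in `𝓜_{1,∞}` exactly when `τ((P - 1/T)₊) = O(log (2 + T))`, and the
generalised limit of `τ(C* (P - 1/T)₊ C) / log (2 + T)` is the Dixmier trace of `C* P C`. Its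
additivity and its trace property come from trace inequalities between soft thresholds at levels
that differ by a constant factor, which dilation invariance does not see.

Write `f(x) = x² k(x)`. The functional `k ↦ τ(C* P k(P) P C)` is integration against a finite
measure `m`, so `t⁻¹ τ(C* f(tP) C) = ∫ t k(t x) dm(x)`. The Cesàro operator `M` replaces `k` by the
mean `∫₀¹ k(u y) du`, which differs from `(∫ k) (y - 1)₊ / y²` by `O(y⁻²)`, a term that
dilation invariance kills. What remains is `∫ f(s) s⁻² ds` times the Dixmier trace of `C* P C`.

By polarisation in `B` and the Jordan decomposition of `A`, the heat functional of `f` and `B` is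
`∫ f(s) s⁻² ds` times the Dixmier trace of `A B`. The theorem compares `f` with `exp(-x^{-q})`, for
which the integral is `Γ(1 + 1/q)`.
-/

noncomputable section

namespace NCHeat

variable {H : Type*} [NormedAddCommGroup H] [InnerProductSpace ℂ H] [CompleteSpace H]

section VonNeumann

variable {N : VonNeumannAlgebra H} {P R : H →L[ℂ] H}

theorem mem_of_commute (hP : P ∈ N) (h : ∀ y, Commute P y → Commute R y) : R ∈ N := by
  rw [← N.commutant_commutant, VonNeumannAlgebra.mem_commutant_iff]
  exact fun y hy => (h y (VonNeumannAlgebra.mem_commutant_iff.1 hy P hP)).symm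

theorem cfc_mem (hP : P ∈ N) (f : ℝ → ℝ) : cfc f P ∈ N :=
  mem_of_commute hP fun _ hy => hy.cfc_real f

theorem posPart_mem (hP : P ∈ N) : P⁺ ∈ N :=
  mem_of_commute hP fun _ hy => by rw [CFC.posPart_def]; exact hy.cfcₙ_real _

theorem sqrt_mem (hP : P ∈ N) : CFC.sqrt P ∈ N :=
  mem_of_commute hP fun _ hy => by rw [CFC.sqrt]; exact hy.cfcₙ_nnreal _

theorem abs_mem (hP : P ∈ N) : CFC.abs P ∈ N := sqrt_mem (mul_mem (star_mem hP) hP)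

theorem complex_smul_mem (c : ℂ) (hP : P ∈ N) : c • P ∈ N :=
  N.toStarSubalgebra.smul_mem hP c

theorem real_smul_mem (c : ℝ) (hP : P ∈ N) : c • P ∈ N :=
  Complex.coe_smul c P ▸ complex_smul_mem (c : ℂ) hP

theorem realPart_mem (hP : P ∈ N) : (ℜ P : H →L[ℂ] H) ∈ N := by
  rw [realPart_apply_coe]
  exact real_smul_mem _ (add_mem hP (star_mem hP))

/-- The orthogonal projection onto the kernel of `R`. It is the source of the spectral projections
that compete in the infimum defining the singular values. -/
def kerProj (R : H →L[ℂ] H) : H →L[ℂ] H := R.ker.starProjection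

theorem isStarProjection_kerProj (R : H →L[ℂ] H) : IsStarProjection (kerProj R) :=
  isStarProjection_starProjection

theorem mul_kerProj (R : H →L[ℂ] H) : R * kerProj R = 0 :=
  ContinuousLinearMap.ext fun x => LinearMap.mem_ker.1 (Submodule.starProjection_apply_mem R.ker x)

theorem kerProj_mul {Y : H →L[ℂ] H} (h : R * Y = 0) : kerProj R * Y = Y := by
  ext x
  have hx : Y x ∈ R.ker := by simpa using DFunLike.congr_fun h x
  simpa [kerProj] using Submodule.starProjection_eq_self_iff.2 hx

theorem kerProj_mem (hR : R ∈ N) : kerProj R ∈ N := by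
  rw [VonNeumannAlgebra.IsStarProjection.mem_iff (isStarProjection_kerProj R)]
  intro y hy
  have hcomm : R * y = y * R := VonNeumannAlgebra.mem_commutant_iff.1 hy R hR
  have hrange : (kerProj R).range = R.ker := by simp [kerProj]
  rw [Module.End.mem_invtSubmodule, hrange]
  intro x hx
  have hx0 : R x = 0 := by simpa using hx
  simpa [hx0] using DFunLike.congr_fun hcomm x

end VonNeumann

section CStarAlgebra

variable {𝒜 : Type*} [CStarAlgebra 𝒜]

theorem posPart_eq_cfc (a : 𝒜) : a⁺ = cfc (fun x : ℝ => max x 0) a := by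
  rw [CFC.posPart_def, cfcₙ_eq_cfc]
  rfl

theorem cfc_sub_const {a : 𝒜} (ha : IsSelfAdjoint a) (r : ℝ) :
    cfc (fun x : ℝ => x - r) a = a - r • (1 : 𝒜) := by
  rw [cfc_sub (fun x : ℝ => x) (fun _ => r) a, cfc_id' ℝ a, cfc_const r a,
    Algebra.algebraMap_eq_smul_one]

theorem isSelfAdjoint_sub_smul_one {a : 𝒜} (ha : IsSelfAdjoint a) (r : ℝ) :
    IsSelfAdjoint (a - r • (1 : 𝒜)) :=
  cfc_sub_const ha r ▸ IsSelfAdjoint.cfc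

theorem le_norm_of_mem_spectrum {a : 𝒜} {x : ℝ} (hx : x ∈ spectrum ℝ a) : x ≤ ‖a‖ := by
  rcases subsingleton_or_nontrivial 𝒜 with _ | _
  · simp at hx
  · exact (le_abs_self x).trans (spectrum.norm_le_norm_of_mem hx)

/-- The soft threshold `(a - ε)₊`. The growth of `τ((a - 1/T)₊)` in `T` replaces the integrated
singular values throughout. -/
def softThreshold (a : 𝒜) (ε : ℝ) : 𝒜 := (a - ε • (1 : 𝒜))⁺

theorem softThreshold_eq_cfc {a : 𝒜} (ha : IsSelfAdjoint a) (ε : ℝ) :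
    softThreshold a ε = cfc (fun x : ℝ => max (x - ε) 0) a := by
  rw [softThreshold, posPart_eq_cfc, ← cfc_sub_const ha,
    ← cfc_comp' (fun x : ℝ => max x 0) (fun x => x - ε) a]

theorem softThreshold_smul (a : 𝒜) {c : ℝ} (hc : 0 ≤ c) (ε : ℝ) :
    softThreshold (c • a) (c * ε) = c • softThreshold a ε := by
  rw [softThreshold, softThreshold, ← CFC.posPart_smul_of_nonneg hc, smul_sub, smul_smul]

theorem softThreshold_mem {N : VonNeumannAlgebra H} {P : H →L[ℂ] H} (hP : P ∈ N) (ε : ℝ) :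
    softThreshold P ε ∈ N :=
  posPart_mem (sub_mem hP (real_smul_mem _ (one_mem N)))

variable [PartialOrder 𝒜] [StarOrderedRing 𝒜]

theorem star_mul_self_le_one {k : 𝒜} (h : ‖k‖ ≤ 1) : star k * k ≤ 1 := by
  refine CStarAlgebra.star_mul_le_algebraMap_norm_sq.trans ?_
  rw [← map_one (algebraMap ℝ 𝒜)]
  exact algebraMap_mono _ (pow_le_one₀ (norm_nonneg _) h)

theorem mul_star_self_le_one {k : 𝒜} (h : ‖k‖ ≤ 1) : k * star k ≤ 1 := by
  simpa using star_mul_self_le_one (k := star k) (by simpa using h)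

theorem norm_le_one_of_star_mul_self_le_one {k : 𝒜} (h : star k * k ≤ 1) : ‖k‖ ≤ 1 := by
  have hsq : ‖star k * k‖ ≤ 1 :=
    (CStarAlgebra.norm_le_one_iff_of_nonneg _ (star_mul_self_nonneg k)).2 h
  rw [CStarRing.norm_star_mul_self] at hsq
  nlinarith [norm_nonneg k]

theorem softThreshold_nonneg (a : 𝒜) (ε : ℝ) : 0 ≤ softThreshold a ε := CFC.posPart_nonneg _

theorem sub_smul_one_le_softThreshold {a : 𝒜} (ha : IsSelfAdjoint a) (ε : ℝ) :
    a - ε • (1 : 𝒜) ≤ softThreshold a ε :=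
  CFC.le_posPart (isSelfAdjoint_sub_smul_one ha ε)

theorem softThreshold_anti {a : 𝒜} (ha : IsSelfAdjoint a) {δ ε : ℝ} (h : δ ≤ ε) :
    softThreshold a ε ≤ softThreshold a δ := by
  rw [softThreshold_eq_cfc ha, softThreshold_eq_cfc ha]
  exact cfc_mono fun x _ => max_le_max (by linarith) le_rfl

theorem softThreshold_zero {a : 𝒜} (ha : 0 ≤ a) : softThreshold a 0 = a := by
  rw [softThreshold, zero_smul, sub_zero, (CFC.posPart_eq_self a).2 ha]

theorem softThreshold_le_self {a : 𝒜} (ha : 0 ≤ a) {ε : ℝ} (h : 0 ≤ ε) : softThreshold a ε ≤ a := by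
  simpa only [softThreshold_zero ha] using softThreshold_anti (.of_nonneg ha) h

theorem softThreshold_posPart {a : 𝒜} (ha : IsSelfAdjoint a) {ε : ℝ} (h : 0 ≤ ε) :
    softThreshold a⁺ ε = softThreshold a ε := by
  rw [softThreshold_eq_cfc (.of_nonneg (CFC.posPart_nonneg a)), softThreshold_eq_cfc ha,
    posPart_eq_cfc, ← cfc_comp' (fun x : ℝ => max (x - ε) 0) (fun x => max x 0) a]
  refine cfc_congr fun x _ => ?_
  rcases le_total x 0 with hx | hx
  · rw [max_eq_right hx, max_eq_right (by linarith), max_eq_right (by linarith)]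
  · rw [max_eq_left hx]

/-- The contraction `z (|z| + δ)⁻¹`. It approximates the partial isometry of the polar decomposition
of `z` without leaving the C*-algebra. -/
def approxPhase (z : 𝒜) (δ : ℝ) : 𝒜 := z * cfc (fun x : ℝ => (x + δ)⁻¹) (CFC.abs z)

variable {z : 𝒜} {δ : ℝ}

theorem continuousOn_inv_add_spectrum_abs (z : 𝒜) (hδ : 0 < δ) :
    ContinuousOn (fun x : ℝ => (x + δ)⁻¹) (spectrum ℝ (CFC.abs z)) :=
  ContinuousOn.inv₀ (by fun_prop) fun _ hx =>
    (add_pos_of_nonneg_of_pos (spectrum_nonneg_of_nonneg (CFC.abs_nonneg z) hx) hδ).ne'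

theorem star_approxPhase_mul_self (z : 𝒜) (hδ : 0 < δ) :
    star (approxPhase z δ) * z = cfc (fun x : ℝ => (x + δ)⁻¹ * x ^ 2) (CFC.abs z) := by
  rw [approxPhase, star_mul, (IsSelfAdjoint.cfc (f := fun x : ℝ => (x + δ)⁻¹)).star_eq, mul_assoc,
    ← CFC.abs_sq, cfc_mul _ _ _ (continuousOn_inv_add_spectrum_abs z hδ) (by fun_prop),
    cfc_pow_id (R := ℝ) _ 2]

theorem isSelfAdjoint_star_approxPhase_mul (z : 𝒜) (hδ : 0 < δ) :
    IsSelfAdjoint (star (approxPhase z δ) * z) :=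
  star_approxPhase_mul_self z hδ ▸ IsSelfAdjoint.cfc

theorem abs_sub_le_star_approxPhase_mul (z : 𝒜) (hδ : 0 < δ) :
    CFC.abs z - δ • (1 : 𝒜) ≤ star (approxPhase z δ) * z := by
  rw [star_approxPhase_mul_self z hδ, ← cfc_sub_const (.of_nonneg (CFC.abs_nonneg z))]
  refine cfc_mono (fun x hx => ?_) (by fun_prop)
    ((continuousOn_inv_add_spectrum_abs z hδ).mul (by fun_prop))
  have hx0 : 0 ≤ x := spectrum_nonneg_of_nonneg (CFC.abs_nonneg z) hx
  rw [← div_eq_inv_mul, le_div_iff₀ (by linarith)]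
  nlinarith

theorem norm_approxPhase_le_one (z : 𝒜) (hδ : 0 < δ) : ‖approxPhase z δ‖ ≤ 1 := by
  have hinv := continuousOn_inv_add_spectrum_abs z hδ
  have hquot : ContinuousOn (fun x : ℝ => (x + δ)⁻¹ * x ^ 2) (spectrum ℝ (CFC.abs z)) :=
    hinv.mul (by fun_prop)
  apply norm_le_one_of_star_mul_self_le_one
  nth_rw 2 [approxPhase]
  rw [← mul_assoc, star_approxPhase_mul_self z hδ, ← cfc_mul _ _ _ hquot hinv,
    ← cfc_one ℝ (CFC.abs z)]
  refine cfc_mono (fun x hx => ?_) (hquot.mul hinv) continuousOn_const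
  have hx0 : 0 ≤ x := spectrum_nonneg_of_nonneg (CFC.abs_nonneg z) hx
  calc (x + δ)⁻¹ * x ^ 2 * (x + δ)⁻¹ = (x / (x + δ)) ^ 2 := by field_simp
    _ ≤ 1 := pow_le_one₀ (by positivity) (div_le_one_of_le₀ (by linarith) (by linarith))

theorem approxPhase_mul_abs_add (z : 𝒜) (hδ : 0 < δ) :
    approxPhase z δ * CFC.abs z + δ • approxPhase z δ = z := by
  have habs : IsSelfAdjoint (CFC.abs z) := .of_nonneg (CFC.abs_nonneg z)
  have hsum : CFC.abs z + δ • (1 : 𝒜) = cfc (fun x : ℝ => x + δ) (CFC.abs z) := by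
    simpa using (cfc_sub_const habs (-δ)).symm
  have hinv : cfc (fun x : ℝ => (x + δ)⁻¹) (CFC.abs z) * (CFC.abs z + δ • (1 : 𝒜)) = 1 := by
    rw [hsum, ← cfc_mul _ _ _ (continuousOn_inv_add_spectrum_abs z hδ) (by fun_prop),
      ← cfc_one ℝ (CFC.abs z)]
    refine cfc_congr fun x hx => ?_
    have hx0 : 0 ≤ x := spectrum_nonneg_of_nonneg (CFC.abs_nonneg z) hx
    exact inv_mul_cancel₀ (by positivity)
  calc approxPhase z δ * CFC.abs z + δ • approxPhase z δ
      = approxPhase z δ * (CFC.abs z + δ • (1 : 𝒜)) := by rw [mul_add, mul_smul_comm, mul_one]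
    _ = z := by rw [approxPhase, mul_assoc, hinv, mul_one]

theorem star_mul_self_sub_le_conjugate_approxPhase (z : 𝒜) (hδ : 0 < δ) :
    star z * z - (2 * δ * ‖z‖) • (1 : 𝒜) ≤
      star (approxPhase z δ) * (z * star z) * approxPhase z δ := by
  have habs : IsSelfAdjoint (CFC.abs z) := .of_nonneg (CFC.abs_nonneg z)
  have hquot : ContinuousOn (fun x : ℝ => (x + δ)⁻¹ * x ^ 2) (spectrum ℝ (CFC.abs z)) :=
    (continuousOn_inv_add_spectrum_abs z hδ).mul (by fun_prop)
  have hleft : star z * z - (2 * δ * ‖z‖) • (1 : 𝒜)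
      = cfc (fun x : ℝ => x ^ 2 - 2 * δ * ‖z‖) (CFC.abs z) := by
    rw [cfc_sub (fun x : ℝ => x ^ 2) (fun _ => 2 * δ * ‖z‖), cfc_pow_id (R := ℝ) _ 2, CFC.abs_sq,
      cfc_const _ _, Algebra.algebraMap_eq_smul_one]
  have hright : star (approxPhase z δ) * (z * star z) * approxPhase z δ
      = cfc (fun x : ℝ => ((x + δ)⁻¹ * x ^ 2) ^ 2) (CFC.abs z) := by
    rw [cfc_pow _ 2 _ hquot, ← star_approxPhase_mul_self z hδ, sq]
    nth_rw 2 [← (isSelfAdjoint_star_approxPhase_mul z hδ).star_eq]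
    simp only [star_mul, star_star, mul_assoc]
  rw [hleft, hright]
  refine cfc_mono (fun x hx => ?_) (by fun_prop) (hquot.pow 2)
  have hx0 : 0 ≤ x := spectrum_nonneg_of_nonneg (CFC.abs_nonneg z) hx
  have hxz : x ≤ ‖z‖ := by simpa using le_norm_of_mem_spectrum hx
  have hsub : x - δ ≤ (x + δ)⁻¹ * x ^ 2 := by
    rw [← div_eq_inv_mul, le_div_iff₀ (by linarith)]
    nlinarith
  have hquot0 : 0 ≤ (x + δ)⁻¹ * x ^ 2 := by positivity
  rcases le_total x δ with h | h <;> nlinarith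

end CStarAlgebra

theorem approxPhase_mem {N : VonNeumannAlgebra H} {Z : H →L[ℂ] H} (hZ : Z ∈ N) (δ : ℝ) :
    approxPhase Z δ ∈ N :=
  mul_mem hZ (cfc_mem (abs_mem hZ) _)

section CStarAlgebra

variable {𝒜 : Type*} [CStarAlgebra 𝒜] [PartialOrder 𝒜] [StarOrderedRing 𝒜]

theorem conjugate_sub_smul_one_le {a k : 𝒜} (ha : IsSelfAdjoint a) (hk : ‖k‖ ≤ 1) {ε : ℝ}
    (hε : 0 ≤ ε) : star k * a * k - ε • (1 : 𝒜) ≤ star k * softThreshold a ε * k := by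
  refine le_trans ?_ (star_left_conjugate_le_conjugate (sub_smul_one_le_softThreshold ha ε) k)
  rw [mul_sub, sub_mul, mul_smul_comm, mul_one, smul_mul_assoc]
  exact sub_le_sub_left (smul_le_smul_of_nonneg_left (star_mul_self_le_one hk) hε) _

theorem realPart_mul_mul_le {a : 𝒜} (ha : 0 ≤ a) (u w : 𝒜) :
    (ℜ (u * a * w) : 𝒜) ≤ (2⁻¹ : ℝ) • (u * a * star u + star w * a * w) := by
  have hsq : 0 ≤ star (star u - w) * a * (star u - w) := star_left_conjugate_nonneg ha _
  rw [realPart_apply_coe]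
  refine smul_le_smul_of_nonneg_left (sub_nonneg.1 (hsq.trans_eq ?_)) (by norm_num)
  simp only [star_sub, star_star, star_mul, (IsSelfAdjoint.of_nonneg ha).star_eq, sub_mul, mul_sub,
    mul_assoc]
  abel

theorem realPart_le_one {z : 𝒜} (hz : ‖z‖ ≤ 1) : (ℜ z : 𝒜) ≤ 1 := by
  refine (IsSelfAdjoint.le_algebraMap_norm_self (ℜ z).2).trans ?_
  rw [← map_one (algebraMap ℝ 𝒜)]
  exact algebraMap_mono _ ((realPart.norm_le z).trans hz)

theorem realPart_mul_mul_sub_le {a u w : 𝒜} (ha : 0 ≤ a) (hu : ‖u‖ ≤ 1) (hw : ‖w‖ ≤ 1) {ε : ℝ}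
    (hε : 0 ≤ ε) :
    (ℜ (u * a * w) : 𝒜) - ε • (1 : 𝒜) ≤
      (2⁻¹ : ℝ) • (u * softThreshold a ε * star u + star w * softThreshold a ε * w) := by
  have hleft : u * a * star u - ε • (1 : 𝒜) ≤ u * softThreshold a ε * star u := by
    simpa using conjugate_sub_smul_one_le (.of_nonneg ha) (k := star u) (by simpa using hu) hε
  have hright : star w * a * w - ε • (1 : 𝒜) ≤ star w * softThreshold a ε * w :=
    conjugate_sub_smul_one_le (.of_nonneg ha) hw hε
  calc (ℜ (u * a * w) : 𝒜) - ε • (1 : 𝒜)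
      ≤ (2⁻¹ : ℝ) • (u * a * star u + star w * a * w) - ε • (1 : 𝒜) :=
        sub_le_sub_right (realPart_mul_mul_le ha u w) _
    _ = (2⁻¹ : ℝ) • ((u * a * star u - ε • (1 : 𝒜)) + (star w * a * w - ε • (1 : 𝒜))) := by
        module
    _ ≤ _ := smul_le_smul_of_nonneg_left (add_le_add hleft hright) (by norm_num)

end CStarAlgebra

namespace FNSTrace

variable {N : VonNeumannAlgebra H} (τ : FNSTrace N) {A B C D K P S T X Y : H →L[ℂ] H}

theorem toFun_zero : τ.toFun 0 = 0 := by
  simpa using τ.map_smul 0 le_rfl 0 (zero_mem N) le_rfl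

theorem toFun_mono (hS : S ∈ N) (hT : T ∈ N) (hS0 : 0 ≤ S) (h : S ≤ T) :
    τ.toFun S ≤ τ.toFun T := by
  have hadd := τ.map_add S hS (T - S) (sub_mem hT hS) hS0 (sub_nonneg.2 h)
  rw [add_sub_cancel] at hadd
  exact hadd ▸ le_self_add

theorem toFun_conjugate_eq (hY : Y ∈ N) (hY0 : 0 ≤ Y) (hK : K ∈ N) :
    τ.toFun (star K * Y * K) = τ.toFun (CFC.sqrt Y * (K * star K) * CFC.sqrt Y) := by
  have hsqrt : star (CFC.sqrt Y) = CFC.sqrt Y :=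
    (IsSelfAdjoint.of_nonneg (CFC.sqrt_nonneg Y)).star_eq
  calc τ.toFun (star K * Y * K) = τ.toFun (star (CFC.sqrt Y * K) * (CFC.sqrt Y * K)) := by
        nth_rw 1 [← CFC.sqrt_mul_sqrt_self Y hY0]
        simp only [star_mul, hsqrt, mul_assoc]
    _ = τ.toFun (CFC.sqrt Y * (K * star K) * CFC.sqrt Y) := by
        rw [τ.tracial _ (mul_mem (sqrt_mem hY) hK), star_mul, hsqrt]
        simp only [mul_assoc]

theorem toFun_sqrt_conjugate_le (hY : Y ∈ N) (hY0 : 0 ≤ Y) (hK : K ∈ N) (hK0 : 0 ≤ K) {c : ℝ}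
    (hc : 0 ≤ c) (h : K ≤ c • 1) :
    τ.toFun (CFC.sqrt Y * K * CFC.sqrt Y) ≤ ENNReal.ofReal c * τ.toFun Y := by
  rw [← τ.map_smul c hc Y hY hY0]
  refine τ.toFun_mono (mul_mem (mul_mem (sqrt_mem hY) hK) (sqrt_mem hY)) (real_smul_mem _ hY)
    (conjugate_nonneg_of_nonneg hK0 (CFC.sqrt_nonneg Y)) ?_
  refine (conjugate_le_conjugate_of_nonneg h (CFC.sqrt_nonneg Y)).trans_eq ?_
  rw [mul_smul_comm, mul_one, smul_mul_assoc, CFC.sqrt_mul_sqrt_self Y hY0]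

theorem toFun_conjugate_le_norm_sq_mul (hY : Y ∈ N) (hY0 : 0 ≤ Y) (hK : K ∈ N) :
    τ.toFun (star K * Y * K) ≤ ENNReal.ofReal (‖K‖ ^ 2) * τ.toFun Y := by
  rw [τ.toFun_conjugate_eq hY hY0 hK]
  refine τ.toFun_sqrt_conjugate_le hY hY0 (mul_mem hK (star_mem hK)) (mul_star_self_nonneg K)
    (by positivity) ?_
  rw [← Algebra.algebraMap_eq_smul_one]
  exact CStarAlgebra.mul_star_le_algebraMap_norm_sq

theorem toFun_conjugate_le (hY : Y ∈ N) (hY0 : 0 ≤ Y) (hK : K ∈ N) (hK1 : ‖K‖ ≤ 1) :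
    τ.toFun (star K * Y * K) ≤ τ.toFun Y :=
  (τ.toFun_conjugate_le_norm_sq_mul hY hY0 hK).trans <|
    mul_le_of_le_one_left' (ENNReal.ofReal_le_one.2 (pow_le_one₀ (norm_nonneg _) hK1))

theorem toFun_posPart_le (hX : X ∈ N) (hXs : IsSelfAdjoint X) (hY : Y ∈ N) (hY0 : 0 ≤ Y)
    (h : X ≤ Y) : τ.toFun X⁺ ≤ τ.toFun Y := by
  set e := 1 - kerProj X⁺
  have he : IsStarProjection e := (isStarProjection_kerProj X⁺).one_sub
  have hes : star e = e := he.isSelfAdjoint.star_eq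
  have heN : e ∈ N := sub_mem (one_mem N) (kerProj_mem (posPart_mem hX))
  have hpos_mul : X⁺ * e = X⁺ := by rw [mul_sub, mul_kerProj, mul_one, sub_zero]
  have hmul_pos : e * X⁺ = X⁺ := by
    simpa [hes, (IsSelfAdjoint.of_nonneg (CFC.posPart_nonneg X)).star_eq]
      using congrArg star hpos_mul
  have hmul_neg : e * X⁻ = 0 := by
    rw [sub_mul, kerProj_mul (CFC.posPart_mul_negPart X), one_mul, sub_self]
  have hcompress : star e * X * e = X⁺ := by
    nth_rw 1 [← CFC.posPart_sub_negPart X hXs]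
    rw [hes, mul_sub e, hmul_neg, sub_zero, hmul_pos, hpos_mul]
  calc τ.toFun X⁺ ≤ τ.toFun (star e * Y * e) :=
        τ.toFun_mono (posPart_mem hX) (mul_mem (mul_mem (star_mem heN) hY) heN)
          (CFC.posPart_nonneg X) (hcompress ▸ star_left_conjugate_le_conjugate h e)
    _ ≤ τ.toFun Y := τ.toFun_conjugate_le hY hY0 heN he.norm_le

theorem toFun_softThreshold_le_of_sub_le (hX : X ∈ N) (hXs : IsSelfAdjoint X) {ε : ℝ} (hY : Y ∈ N)
    (hY0 : 0 ≤ Y) (h : X - ε • (1 : H →L[ℂ] H) ≤ Y) : τ.toFun (softThreshold X ε) ≤ τ.toFun Y :=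
  τ.toFun_posPart_le (sub_mem hX (real_smul_mem _ (one_mem N))) (isSelfAdjoint_sub_smul_one hXs ε)
    hY hY0 h

theorem isLUB_softThreshold (hP0 : 0 ≤ P) : IsLUB (softThreshold P '' Ioi 0) P := by
  refine ⟨?_, fun U hU => ?_⟩
  · rintro _ ⟨ε, hε, rfl⟩
    exact softThreshold_le_self hP0 (le_of_lt hε)
  · have hlim : Tendsto (fun ε : ℝ => P - ε • (1 : H →L[ℂ] H)) (𝓝[>] 0) (𝓝 P) := by
      have hcont : Continuous fun ε : ℝ => P - ε • (1 : H →L[ℂ] H) := by fun_prop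
      simpa using (hcont.tendsto 0).mono_left nhdsWithin_le_nhds
    exact le_of_tendsto hlim (eventually_nhdsWithin_of_forall fun ε hε =>
      (sub_smul_one_le_softThreshold (.of_nonneg hP0) ε).trans (hU ⟨ε, hε, rfl⟩))

theorem toFun_le_of_forall_softThreshold_le (hP : P ∈ N) (hP0 : 0 ≤ P) {c : ℝ≥0∞}
    (h : ∀ ε : ℝ, 0 < ε → τ.toFun (softThreshold P ε) ≤ c) : τ.toFun P ≤ c := by
  have hanti : Antitone (softThreshold P) := fun _ _ => softThreshold_anti (.of_nonneg hP0)
  rw [τ.normal (softThreshold P '' Ioi 0) ⟨_, 1, mem_Ioi.2 one_pos, rfl⟩ ?_ ?_ P hP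
    (isLUB_softThreshold hP0)]
  · simpa using h
  · rintro _ ⟨a, ha, rfl⟩ _ ⟨b, hb, rfl⟩
    exact ⟨_, ⟨min a b, mem_Ioi.2 (lt_min ha hb), rfl⟩, hanti (min_le_left _ _),
      hanti (min_le_right _ _)⟩
  · rintro _ ⟨ε, _, rfl⟩
    exact ⟨softThreshold_mem hP ε, softThreshold_nonneg P ε⟩

theorem toFun_softThreshold_mono (hX : X ∈ N) (hXs : IsSelfAdjoint X) (hY : Y ∈ N)
    (hYs : IsSelfAdjoint Y) (h : X ≤ Y) (ε : ℝ) :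
    τ.toFun (softThreshold X ε) ≤ τ.toFun (softThreshold Y ε) :=
  τ.toFun_softThreshold_le_of_sub_le hX hXs (softThreshold_mem hY ε) (softThreshold_nonneg _ _)
    ((sub_le_sub_right h _).trans (sub_smul_one_le_softThreshold hYs ε))

theorem toFun_softThreshold_add_le (hA : A ∈ N) (hAs : IsSelfAdjoint A) (hC : C ∈ N)
    (hCs : IsSelfAdjoint C) (a b : ℝ) :
    τ.toFun (softThreshold (A + C) (a + b)) ≤
      τ.toFun (softThreshold A a) + τ.toFun (softThreshold C b) := by
  have hAa := softThreshold_nonneg A a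
  have hCb := softThreshold_nonneg C b
  rw [← τ.map_add _ (softThreshold_mem hA a) _ (softThreshold_mem hC b) hAa hCb]
  refine τ.toFun_softThreshold_le_of_sub_le (add_mem hA hC) (hAs.add hCs)
    (add_mem (softThreshold_mem hA a) (softThreshold_mem hC b)) (add_nonneg hAa hCb) ?_
  rw [add_smul, add_sub_add_comm]
  exact add_le_add (sub_smul_one_le_softThreshold hAs a) (sub_smul_one_le_softThreshold hCs b)

theorem toFun_softThreshold_conjugate_le (hP : P ∈ N) (hPs : IsSelfAdjoint P) (hK : K ∈ N)
    (hK1 : ‖K‖ ≤ 1) {ε : ℝ} (hε : 0 ≤ ε) :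
    τ.toFun (softThreshold (star K * P * K) ε) ≤ τ.toFun (star K * softThreshold P ε * K) :=
  τ.toFun_softThreshold_le_of_sub_le (mul_mem (mul_mem (star_mem hK) hP) hK) (hPs.conjugate' K)
    (mul_mem (mul_mem (star_mem hK) (softThreshold_mem hP ε)) hK)
    (star_left_conjugate_nonneg (softThreshold_nonneg _ _) K) (conjugate_sub_smul_one_le hPs hK1 hε)

-- With `K = D^(-1/2)` and `u = K √B` one has `B = u* D u` and `u u* = K B K ≤ 1`.
theorem toFun_softThreshold_le_toFun_sqrt_conjugate (hB : B ∈ N) (hB0 : 0 ≤ B) (hD : D ∈ N)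
    (hDs : IsSelfAdjoint D) (hBD : B ≤ D) (hK : K ∈ N) (hKs : IsSelfAdjoint K)
    (hKD : K * D * K = 1) {ε : ℝ} (hε : 0 ≤ ε) :
    τ.toFun (softThreshold B ε) ≤
      τ.toFun (CFC.sqrt (softThreshold D ε) * (K * B * K) * CFC.sqrt (softThreshold D ε)) := by
  have hsqrt := CFC.sqrt_mul_sqrt_self B hB0
  set u := K * CFC.sqrt B with hu
  have hu_star : star u = CFC.sqrt B * K := by
    rw [hu, star_mul, hKs.star_eq, (IsSelfAdjoint.of_nonneg (CFC.sqrt_nonneg B)).star_eq]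
  have hu_mul_star : u * star u = K * B * K := by
    rw [hu_star, hu, mul_assoc, ← mul_assoc (CFC.sqrt B), hsqrt, mul_assoc]
  have hu_norm : ‖u‖ ≤ 1 := by
    rw [← norm_star]
    apply norm_le_one_of_star_mul_self_le_one
    rw [star_star, hu_mul_star, ← hKD]
    exact hKs.conjugate_le_conjugate hBD
  have hBu : star u * D * u = B := by
    calc star u * D * u = CFC.sqrt B * (K * D * K) * CFC.sqrt B := by
          rw [hu_star, hu]
          simp only [mul_assoc]
      _ = B := by rw [hKD, mul_one, hsqrt]
  have huN : u ∈ N := mul_mem hK (sqrt_mem hB)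
  rw [← hu_mul_star, ← τ.toFun_conjugate_eq (softThreshold_mem hD ε) (softThreshold_nonneg D ε) huN]
  simpa only [hBu] using τ.toFun_softThreshold_conjugate_le hD hDs huN hu_norm hε

theorem toFun_softThreshold_add_toFun_softThreshold_le (hA : A ∈ N) (hA0 : 0 ≤ A) (hC : C ∈ N)
    (hC0 : 0 ≤ C) (hD : D ∈ N) (hD0 : IsStrictlyPositive D) (hACD : A + C ≤ D) {ε : ℝ}
    (hε : 0 ≤ ε) :
    τ.toFun (softThreshold A ε) + τ.toFun (softThreshold C ε) ≤ τ.toFun (softThreshold D ε) := by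
  set K := D ^ (-(1 / 2) : ℝ)
  have hKN : K ∈ N := mem_of_commute hD fun _ hy => hy.cfc_nnreal _
  have hKs : IsSelfAdjoint K := .of_nonneg CFC.rpow_nonneg
  have hKD : K * D * K = 1 := CFC.conjugate_rpow_neg_one_half D
  set R := softThreshold D ε
  have hRN : R ∈ N := softThreshold_mem hD ε
  have hmem {B : H →L[ℂ] H} (hB : B ∈ N) : K * B * K ∈ N := mul_mem (mul_mem hKN hB) hKN
  have hmemR {B : H →L[ℂ] H} (hB : B ∈ N) : CFC.sqrt R * (K * B * K) * CFC.sqrt R ∈ N :=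
    mul_mem (mul_mem (sqrt_mem hRN) (hmem hB)) (sqrt_mem hRN)
  have hposR {B : H →L[ℂ] H} (hB : 0 ≤ B) : 0 ≤ CFC.sqrt R * (K * B * K) * CFC.sqrt R :=
    conjugate_nonneg_of_nonneg (hKs.conjugate_nonneg hB) (CFC.sqrt_nonneg R)
  have hsum : K * (A + C) * K ≤ (1 : ℝ) • 1 := by
    rw [one_smul, ← hKD]
    exact hKs.conjugate_le_conjugate hACD
  calc τ.toFun (softThreshold A ε) + τ.toFun (softThreshold C ε)
      ≤ τ.toFun (CFC.sqrt R * (K * A * K) * CFC.sqrt R) +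
          τ.toFun (CFC.sqrt R * (K * C * K) * CFC.sqrt R) :=
        add_le_add
          (τ.toFun_softThreshold_le_toFun_sqrt_conjugate hA hA0 hD hD0.isSelfAdjoint
            ((le_add_of_nonneg_right hC0).trans hACD) hKN hKs hKD hε)
          (τ.toFun_softThreshold_le_toFun_sqrt_conjugate hC hC0 hD hD0.isSelfAdjoint
            ((le_add_of_nonneg_left hA0).trans hACD) hKN hKs hKD hε)
    _ = τ.toFun (CFC.sqrt R * (K * (A + C) * K) * CFC.sqrt R) := by
        rw [← τ.map_add _ (hmemR hA) _ (hmemR hC) (hposR hA0) (hposR hC0)]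
        simp only [mul_add, add_mul]
    _ ≤ ENNReal.ofReal 1 * τ.toFun R :=
        τ.toFun_sqrt_conjugate_le hRN (softThreshold_nonneg D ε) (hmem (add_mem hA hC))
          (hKs.conjugate_nonneg (add_nonneg hA0 hC0)) zero_le_one hsum
    _ = τ.toFun R := by rw [ENNReal.ofReal_one, one_mul]

theorem toFun_softThreshold_add_toFun_softThreshold_le_add (hA : A ∈ N) (hA0 : 0 ≤ A) (hC : C ∈ N)
    (hC0 : 0 ≤ C) {δ ε : ℝ} (hδ : 0 < δ) (hε : 0 ≤ ε) :
    τ.toFun (softThreshold A ε) + τ.toFun (softThreshold C ε) ≤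
      τ.toFun (softThreshold (A + C) (ε - δ)) := by
  have hδ1 : IsStrictlyPositive (δ • (1 : H →L[ℂ] H)) := .smul hδ isStrictlyPositive_one
  have hshift : softThreshold (A + C + δ • 1) ε = softThreshold (A + C) (ε - δ) := by
    rw [softThreshold, softThreshold, sub_smul, sub_sub_eq_add_sub]
  rw [← hshift]
  exact τ.toFun_softThreshold_add_toFun_softThreshold_le hA hA0 hC hC0
    (add_mem (add_mem hA hC) (real_smul_mem δ (one_mem N))) (hδ1.nonneg_add (add_nonneg hA0 hC0))
    (le_add_of_nonneg_right hδ1.nonneg) hε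

theorem toFun_softThreshold_star_mul_self_le (hX : X ∈ N) {ε : ℝ} (hε : 0 < ε) :
    τ.toFun (softThreshold (star X * X) (2 * ε)) ≤ τ.toFun (softThreshold (X * star X) ε) := by
  set δ := ε / (2 * (‖X‖ + 1))
  have hδ : 0 < δ := by positivity
  have hδε : 2 * δ * ‖X‖ ≤ ε := by
    calc 2 * δ * ‖X‖ = ε * (‖X‖ / (‖X‖ + 1)) := by simp only [δ]; field_simp
      _ ≤ ε := mul_le_of_le_one_right hε.le (div_le_one_of_le₀ (by linarith) (by positivity))
  set K := approxPhase X δ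
  have hKN : K ∈ N := approxPhase_mem hX δ
  have hK1 : ‖K‖ ≤ 1 := norm_approxPhase_le_one X hδ
  have hXX : X * star X ∈ N := mul_mem hX (star_mem hX)
  refine le_trans ?_
    (τ.toFun_conjugate_le (softThreshold_mem hXX ε) (softThreshold_nonneg _ _) hKN hK1)
  refine τ.toFun_softThreshold_le_of_sub_le (mul_mem (star_mem hX) hX) (.star_mul_self X)
    (mul_mem (mul_mem (star_mem hKN) (softThreshold_mem hXX ε)) hKN)
    (star_left_conjugate_nonneg (softThreshold_nonneg _ _) K) ?_
  calc star X * X - (2 * ε) • (1 : H →L[ℂ] H)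
      = star X * X - ε • (1 : H →L[ℂ] H) - ε • 1 := by module
    _ ≤ star X * X - (2 * δ * ‖X‖) • 1 - ε • 1 := by gcongr
    _ ≤ star K * (X * star X) * K - ε • 1 :=
        sub_le_sub_right (star_mul_self_sub_le_conjugate_approxPhase X hδ) _
    _ ≤ star K * softThreshold (X * star X) ε * K :=
        conjugate_sub_smul_one_le (.mul_star_self X) hK1 hε.le

theorem toFun_softThreshold_realPart_mul_mul_le_of_nonneg (hP : P ∈ N) (hP0 : 0 ≤ P) (hX : X ∈ N)
    (hX1 : ‖X‖ ≤ 1) (hY : Y ∈ N) (hY1 : ‖Y‖ ≤ 1) {ε : ℝ} (hε : 0 ≤ ε) :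
    τ.toFun (softThreshold (ℜ (X * P * Y) : H →L[ℂ] H) ε) ≤ τ.toFun (softThreshold P ε) := by
  set R := softThreshold P ε
  have hR : R ∈ N := softThreshold_mem hP ε
  have hR0 : 0 ≤ R := softThreshold_nonneg P ε
  have hXRN : X * R * star X ∈ N := mul_mem (mul_mem hX hR) (star_mem hX)
  have hYRN : star Y * R * Y ∈ N := mul_mem (mul_mem (star_mem hY) hR) hY
  have hXR0 : 0 ≤ X * R * star X := star_right_conjugate_nonneg hR0 X
  have hYR0 : 0 ≤ star Y * R * Y := star_left_conjugate_nonneg hR0 Y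
  have hXR : τ.toFun (X * R * star X) ≤ τ.toFun R := by
    simpa using τ.toFun_conjugate_le hR hR0 (star_mem hX) (by simpa using hX1)
  have hYR : τ.toFun (star Y * R * Y) ≤ τ.toFun R := τ.toFun_conjugate_le hR hR0 hY hY1
  calc τ.toFun (softThreshold (ℜ (X * P * Y) : H →L[ℂ] H) ε)
      ≤ τ.toFun ((2⁻¹ : ℝ) • (X * R * star X + star Y * R * Y)) :=
        τ.toFun_softThreshold_le_of_sub_le (realPart_mem (mul_mem (mul_mem hX hP) hY)) (ℜ _).2
          (real_smul_mem _ (add_mem hXRN hYRN))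
          (smul_nonneg (by norm_num) (add_nonneg hXR0 hYR0))
          (realPart_mul_mul_sub_le hP0 hX1 hY1 hε)
    _ = ENNReal.ofReal 2⁻¹ * (τ.toFun (X * R * star X) + τ.toFun (star Y * R * Y)) := by
        rw [τ.map_smul _ (by norm_num) _ (add_mem hXRN hYRN) (add_nonneg hXR0 hYR0),
          τ.map_add _ hXRN _ hYRN hXR0 hYR0]
    _ ≤ ENNReal.ofReal 2⁻¹ * (τ.toFun R + τ.toFun R) := by gcongr
    _ = τ.toFun R := by
        rw [ENNReal.ofReal_inv_of_pos two_pos, ENNReal.ofReal_ofNat, mul_comm, ← div_eq_mul_inv,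
          ENNReal.add_div, ENNReal.add_halves]

theorem toFun_softThreshold_realPart_mul_mul_le (hA : A ∈ N) (hX : X ∈ N) (hX1 : ‖X‖ ≤ 1)
    (hY : Y ∈ N) (hY1 : ‖Y‖ ≤ 1) {ε : ℝ} (hε : 0 < ε) :
    τ.toFun (softThreshold (ℜ (X * A * Y) : H →L[ℂ] H) (2 * ε)) ≤
      τ.toFun (softThreshold (CFC.abs A) ε) := by
  set K := approxPhase A ε
  have hXK : X * K ∈ N := mul_mem hX (approxPhase_mem hA ε)
  have hXK1 : ‖X * K‖ ≤ 1 :=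
    (norm_mul_le _ _).trans (mul_le_one₀ hX1 (norm_nonneg _) (norm_approxPhase_le_one A hε))
  have hXKY1 : ‖X * K * Y‖ ≤ 1 := (norm_mul_le _ _).trans (mul_le_one₀ hXK1 (norm_nonneg _) hY1)
  have hXAY : X * A * Y = X * K * CFC.abs A * Y + ε • (X * K * Y) := by
    conv_lhs => rw [← approxPhase_mul_abs_add A hε]
    simp only [mul_add, add_mul, mul_smul_comm, smul_mul_assoc, mul_assoc, K]
  refine le_trans ?_ (τ.toFun_softThreshold_realPart_mul_mul_le_of_nonneg (abs_mem hA)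
    (CFC.abs_nonneg A) hXK hXK1 hY hY1 hε.le)
  refine τ.toFun_softThreshold_le_of_sub_le (realPart_mem (mul_mem (mul_mem hX hA) hY)) (ℜ _).2
    (softThreshold_mem (realPart_mem (mul_mem (mul_mem hXK (abs_mem hA)) hY)) ε)
    (softThreshold_nonneg _ _) ?_
  calc (ℜ (X * A * Y) : H →L[ℂ] H) - (2 * ε) • 1
      = ℜ (X * K * CFC.abs A * Y) + ε • (ℜ (X * K * Y) : H →L[ℂ] H) - (2 * ε) • 1 := by
        rw [hXAY, _root_.map_add, AddSubgroup.coe_add, _root_.map_smul, selfAdjoint.val_smul]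
    _ ≤ ℜ (X * K * CFC.abs A * Y) + ε • 1 - (2 * ε) • 1 := by
        gcongr
        exact realPart_le_one hXKY1
    _ = ℜ (X * K * CFC.abs A * Y) - ε • 1 := by module
    _ ≤ softThreshold (ℜ (X * K * CFC.abs A * Y) : H →L[ℂ] H) ε :=
        sub_smul_one_le_softThreshold (ℜ _).2 ε

theorem toFun_softThreshold_abs_mul_le (hA : A ∈ N) (hB : B ∈ N) (hB1 : ‖B‖ ≤ 1) {ε : ℝ}
    (hε : 0 < ε) :
    τ.toFun (softThreshold (CFC.abs (A * B)) (3 * ε)) ≤ τ.toFun (softThreshold (CFC.abs A) ε) := by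
  have hAB : A * B ∈ N := mul_mem hA hB
  set K := approxPhase (A * B) ε
  have hK : star K ∈ N := star_mem (approxPhase_mem hAB ε)
  have hKAB : IsSelfAdjoint (star K * (A * B)) := isSelfAdjoint_star_approxPhase_mul _ hε
  have hre : (ℜ (star K * A * B) : H →L[ℂ] H) = star K * (A * B) := by
    rw [mul_assoc, hKAB.coe_realPart]
  refine le_trans ?_ (τ.toFun_softThreshold_realPart_mul_mul_le hA hK
    (by simpa using norm_approxPhase_le_one (A * B) hε) hB hB1 hε)
  rw [hre]
  refine τ.toFun_softThreshold_le_of_sub_le (abs_mem hAB) (.of_nonneg (CFC.abs_nonneg _))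
    (softThreshold_mem (mul_mem hK hAB) _) (softThreshold_nonneg _ _) ?_
  calc CFC.abs (A * B) - (3 * ε) • (1 : H →L[ℂ] H)
      = CFC.abs (A * B) - ε • (1 : H →L[ℂ] H) - (2 * ε) • 1 := by module
    _ ≤ star K * (A * B) - (2 * ε) • 1 :=
        sub_le_sub_right (abs_sub_le_star_approxPhase_mul _ hε) _
    _ ≤ softThreshold (star K * (A * B)) (2 * ε) := sub_smul_one_le_softThreshold hKAB _

theorem toFun_abs_star_mul_lt_top (hX : X ∈ N) (hY : Y ∈ N) (hX2 : τ.toFun (star X * X) < ∞)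
    (hY2 : τ.toFun (star Y * Y) < ∞) : τ.toFun (CFC.abs (star X * Y)) < ∞ := by
  have hXY : star X * Y ∈ N := mul_mem (star_mem hX) hY
  refine lt_of_le_of_lt (τ.toFun_le_of_forall_softThreshold_le (abs_mem hXY) (CFC.abs_nonneg _)
    (c := τ.toFun (star X * X) + τ.toFun (star Y * Y)) fun ε hε => ?_)
    (ENNReal.add_lt_top.2 ⟨hX2, hY2⟩)
  set K := approxPhase (star X * Y) ε
  have hKN : K ∈ N := approxPhase_mem hXY ε
  have hXX : star X * X ∈ N := mul_mem (star_mem hX) hX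
  have hYY : star Y * Y ∈ N := mul_mem (star_mem hY) hY
  have hKXXK : star K * (star X * X) * K ∈ N := mul_mem (mul_mem (star_mem hKN) hXX) hKN
  have hKXXK0 : 0 ≤ star K * (star X * X) * K :=
    star_left_conjugate_nonneg (star_mul_self_nonneg X) K
  have hsum0 : 0 ≤ star K * (star X * X) * K + star Y * Y :=
    add_nonneg hKXXK0 (star_mul_self_nonneg Y)
  have hle : CFC.abs (star X * Y) - ε • 1 ≤ star K * (star X * X) * K + star Y * Y :=
    calc CFC.abs (star X * Y) - ε • 1 ≤ star K * (star X * Y) :=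
          abs_sub_le_star_approxPhase_mul _ hε
      _ = ℜ (star K * star X * 1 * Y) := by
          rw [mul_one, mul_assoc, (isSelfAdjoint_star_approxPhase_mul _ hε).coe_realPart]
      _ ≤ (2⁻¹ : ℝ) • (star K * star X * 1 * star (star K * star X) + star Y * 1 * Y) :=
          realPart_mul_mul_le zero_le_one _ _
      _ = (2⁻¹ : ℝ) • (star K * (star X * X) * K + star Y * Y) := by
          simp only [mul_one, star_mul, star_star, mul_assoc]
      _ ≤ star K * (star X * X) * K + star Y * Y :=
          smul_le_of_le_one_left hsum0 (by norm_num)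
  calc τ.toFun (softThreshold (CFC.abs (star X * Y)) ε)
      ≤ τ.toFun (star K * (star X * X) * K + star Y * Y) :=
        τ.toFun_softThreshold_le_of_sub_le (abs_mem hXY) (.of_nonneg (CFC.abs_nonneg _))
          (add_mem hKXXK hYY) hsum0 hle
    _ = τ.toFun (star K * (star X * X) * K) + τ.toFun (star Y * Y) :=
        τ.map_add _ hKXXK _ hYY hKXXK0 (star_mul_self_nonneg Y)
    _ ≤ τ.toFun (star X * X) + τ.toFun (star Y * Y) := by
        gcongr
        exact τ.toFun_conjugate_le hXX (star_mul_self_nonneg X) hKN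
          (norm_approxPhase_le_one _ hε)

end FNSTrace

/-! ### Dyadic decompositions and generalised singular values -/

/-- The continuous function equal to `0` on `(-∞, l/2]`, to `1` on `[l, ∞)`, and affine between,
for `l > 0`. It replaces the indicator of `[l, ∞)`, which is not available in the continuous
functional calculus. -/
def ramp (l x : ℝ) : ℝ := min 1 (max 0 (2 * x / l - 1))

section Dyadic

variable {l x ε m a t : ℝ}

theorem continuous_ramp (l : ℝ) : Continuous (ramp l) := by
  unfold ramp
  fun_prop

theorem ramp_nonneg (l x : ℝ) : 0 ≤ ramp l x := le_min zero_le_one (le_max_left _ _)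

theorem ramp_le_one (l x : ℝ) : ramp l x ≤ 1 := min_le_left _ _

theorem ramp_of_le (hl : 0 < l) (h : l ≤ x) : ramp l x = 1 := by
  have : 1 ≤ 2 * x / l - 1 := by
    rw [le_sub_iff_add_le, le_div_iff₀ hl]
    linarith
  exact min_eq_left (this.trans (le_max_right _ _))

theorem ramp_of_le_half (hl : 0 < l) (h : x ≤ l / 2) : ramp l x = 0 := by
  have : 2 * x / l - 1 ≤ 0 := by
    rw [sub_nonpos, div_le_iff₀ hl]
    linarith
  rw [ramp, max_eq_left this, min_eq_right zero_le_one]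

theorem sum_two_pow_mul (ε : ℝ) (K : ℕ) : ∑ k ∈ Finset.range K, 2 ^ k * ε = 2 ^ K * ε - ε := by
  rw [← Finset.sum_mul, geom_sum_eq (by norm_num)]
  ring

theorem sum_dyadic_le_two_mul (hε : 0 < ε) (hm : 0 ≤ m) (K : ℕ) :
    ∑ k ∈ Finset.range K, (if 2 ^ k * ε ≤ m then 2 ^ k * ε else 0) ≤ 2 * m := by
  induction K with
  | zero => simpa using hm
  | succ K ih =>
    by_cases hK : 2 ^ K * ε ≤ m
    · have hsum : ∑ k ∈ Finset.range (K + 1), (if 2 ^ k * ε ≤ m then 2 ^ k * ε else 0)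
          ≤ ∑ k ∈ Finset.range (K + 1), 2 ^ k * ε := by
        refine Finset.sum_le_sum fun k _ => ?_
        split_ifs
        exacts [le_rfl, by positivity]
      rw [sum_two_pow_mul, pow_succ] at hsum
      linarith
    · rwa [Finset.sum_range_succ, if_neg hK, add_zero]

theorem le_add_two_mul_sum_dyadic (hε : 0 < ε) (K : ℕ) (hm : m ≤ 2 ^ K * ε) :
    m ≤ ε + 2 * ∑ k ∈ Finset.range K, (if 2 ^ k * ε < m then 2 ^ k * ε else 0) := by
  induction K with
  | zero => simpa using hm
  | succ K ih =>
    rw [Finset.sum_range_succ]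
    have hsum : 0 ≤ ∑ k ∈ Finset.range K, (if 2 ^ k * ε < m then 2 ^ k * ε else 0) :=
      Finset.sum_nonneg fun k _ => by split_ifs <;> positivity
    split_ifs with hK
    · rw [pow_succ] at hm
      linarith
    · simpa using ih (not_lt.1 hK)

theorem max_sub_le_two_mul_dyadic_ramp_sum (hε : 0 < ε) (K : ℕ) (hx : x ≤ 2 ^ K * ε) :
    max (x - ε) 0 ≤ 2 * ∑ k ∈ Finset.range K, 2 ^ k * ε * ramp (2 ^ k * ε) x := by
  have hsum : ∑ k ∈ Finset.range K, (if 2 ^ k * ε < x then 2 ^ k * ε else 0) ≤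
      ∑ k ∈ Finset.range K, 2 ^ k * ε * ramp (2 ^ k * ε) x := by
    refine Finset.sum_le_sum fun k _ => ?_
    split_ifs with hk
    · rw [ramp_of_le (by positivity) hk.le, mul_one]
    · exact mul_nonneg (by positivity) (ramp_nonneg _ _)
  have hramp : 0 ≤ ∑ k ∈ Finset.range K, 2 ^ k * ε * ramp (2 ^ k * ε) x :=
    Finset.sum_nonneg fun k _ => mul_nonneg (by positivity) (ramp_nonneg _ _)
  exact max_le (by linarith [le_add_two_mul_sum_dyadic hε K hx]) (by positivity)

theorem dyadic_ramp_sum_le (hε : 0 < ε) (K : ℕ) :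
    ∑ k ∈ Finset.range K, 2 ^ k * ε * ramp (2 ^ k * ε) x ≤ 8 * max (x - ε / 4) 0 := by
  rcases le_total x (ε / 2) with h | h
  · refine (Finset.sum_eq_zero fun k _ => ?_).trans_le (by positivity)
    have : (1 : ℝ) ≤ 2 ^ k := one_le_pow₀ (by norm_num)
    rw [ramp_of_le_half (by positivity) (by nlinarith), mul_zero]
  · have hramp : ∑ k ∈ Finset.range K, 2 ^ k * ε * ramp (2 ^ k * ε) x ≤
        ∑ k ∈ Finset.range K, (if 2 ^ k * ε ≤ 2 * x then 2 ^ k * ε else 0) := by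
      refine Finset.sum_le_sum fun k _ => ?_
      split_ifs with hk
      · exact mul_le_of_le_one_right (by positivity) (ramp_le_one _ _)
      · rw [ramp_of_le_half (by positivity) (by linarith), mul_zero]
    have hind := sum_dyadic_le_two_mul (m := 2 * x) hε (by linarith) K
    linarith [le_max_left (x - ε / 4) 0]

theorem sum_dyadic_mul_measure_le {α : Type*} [MeasurableSpace α] (ν : Measure α) {u : α → ℝ}
    (hu : Measurable u) (hu0 : ∀ a, 0 ≤ u a) (hε : 0 < ε) (K : ℕ) :
    ∑ k ∈ Finset.range K, ENNReal.ofReal (2 ^ k * ε) * ν {a | 2 ^ k * ε ≤ u a} ≤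
      2 * ∫⁻ a, ENNReal.ofReal (u a) ∂ν := by
  have hmeas (k : ℕ) : MeasurableSet {a | 2 ^ k * ε ≤ u a} := measurableSet_le (by fun_prop) hu
  calc ∑ k ∈ Finset.range K, ENNReal.ofReal (2 ^ k * ε) * ν {a | 2 ^ k * ε ≤ u a}
      = ∫⁻ a, ∑ k ∈ Finset.range K,
          {a | 2 ^ k * ε ≤ u a}.indicator (fun _ => ENNReal.ofReal (2 ^ k * ε)) a ∂ν := by
        rw [lintegral_finsetSum _ fun k _ => measurable_const.indicator (hmeas k)]
        exact Finset.sum_congr rfl fun k _ => (lintegral_indicator_const (hmeas k) _).symm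
    _ ≤ ∫⁻ a, ENNReal.ofReal (2 * u a) ∂ν := by
        refine lintegral_mono fun a => ?_
        refine le_trans ?_ (ENNReal.ofReal_le_ofReal (sum_dyadic_le_two_mul hε (hu0 a) K))
        rw [ENNReal.ofReal_sum_of_nonneg fun k _ => by split_ifs <;> positivity]
        refine Finset.sum_le_sum fun k _ => ?_
        by_cases h : 2 ^ k * ε ≤ u a <;> simp [h]
    _ = 2 * ∫⁻ a, ENNReal.ofReal (u a) ∂ν := by
        simp only [ENNReal.ofReal_mul zero_le_two, ENNReal.ofReal_ofNat]
        exact lintegral_const_mul _ hu.ennreal_ofReal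

theorem lintegral_le_add_two_mul_sum_dyadic {α : Type*} [MeasurableSpace α] (ν : Measure α)
    {u : α → ℝ} (hu : Measurable u) (hε : 0 < ε) {K : ℕ} (hK : ∀ a, u a ≤ 2 ^ K * ε) :
    ∫⁻ a, ENNReal.ofReal (u a) ∂ν ≤ ENNReal.ofReal ε * ν univ +
      2 * ∑ k ∈ Finset.range K, ENNReal.ofReal (2 ^ k * ε) * ν {a | 2 ^ k * ε < u a} := by
  have hmeas (k : ℕ) : MeasurableSet {a | 2 ^ k * ε < u a} := measurableSet_lt (by fun_prop) hu
  have hind (k : ℕ) : Measurable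
      ({a | 2 ^ k * ε < u a}.indicator fun _ => ENNReal.ofReal (2 ^ k * ε)) :=
    measurable_const.indicator (hmeas k)
  calc ∫⁻ a, ENNReal.ofReal (u a) ∂ν
      ≤ ∫⁻ a, (ENNReal.ofReal ε + 2 * ∑ k ∈ Finset.range K,
          {a | 2 ^ k * ε < u a}.indicator (fun _ => ENNReal.ofReal (2 ^ k * ε)) a) ∂ν := by
        refine lintegral_mono fun a =>
          (ENNReal.ofReal_le_ofReal (le_add_two_mul_sum_dyadic hε K (hK a))).trans ?_
        have hnonneg : ∀ k ∈ Finset.range K, 0 ≤ if 2 ^ k * ε < u a then 2 ^ k * ε else 0 :=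
          fun k _ => by split_ifs <;> positivity
        rw [ENNReal.ofReal_add hε.le (mul_nonneg zero_le_two (Finset.sum_nonneg hnonneg)),
          ENNReal.ofReal_mul zero_le_two, ENNReal.ofReal_ofNat,
          ENNReal.ofReal_sum_of_nonneg hnonneg]
        gcongr with k
        by_cases h : 2 ^ k * ε < u a <;> simp [h]
    _ = _ := by
        rw [lintegral_add_left measurable_const, lintegral_const,
          lintegral_const_mul _ (Finset.measurable_fun_sum _ fun k _ => hind k),
          lintegral_finsetSum _ fun k _ => hind k]
        simp only [lintegral_indicator_const (hmeas _)]

theorem volume_pos_and_ofReal_lt (n : ℝ≥0∞) :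
    volume {s : ℝ | 0 < s ∧ ENNReal.ofReal s < n} = n := by
  rcases eq_or_ne n ∞ with rfl | hn
  · simp only [ENNReal.ofReal_lt_top, and_true]
    exact Real.volume_Ioi
  · have : {s : ℝ | 0 < s ∧ ENNReal.ofReal s < n} = Ioo 0 n.toReal := by
      ext s
      exact and_congr_right fun hs => ENNReal.ofReal_lt_iff_lt_toReal hs.le hn
    rw [this, Real.volume_Ioo, sub_zero, ENNReal.ofReal_toReal hn]

end Dyadic

section CStarAlgebra

variable {𝒜 : Type*} [CStarAlgebra 𝒜] {a b p : 𝒜} {l : ℝ}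

theorem softThreshold_mul_cfc_ramp (ha : IsSelfAdjoint a) (hl : 0 < l) :
    softThreshold a l * cfc (ramp l) a = softThreshold a l := by
  have hcont : Continuous fun x : ℝ => max (x - l) 0 := by fun_prop
  rw [softThreshold_eq_cfc ha, ← cfc_mul _ _ a hcont.continuousOn (continuous_ramp l).continuousOn]
  refine cfc_congr fun x _ => ?_
  rcases le_total x l with hx | hx
  · simp only [max_eq_right (sub_nonpos.2 hx), zero_mul]
  · rw [ramp_of_le hl hx, mul_one]

variable [PartialOrder 𝒜] [StarOrderedRing 𝒜]

theorem norm_abs_mul (a b : 𝒜) : ‖CFC.abs a * b‖ = ‖a * b‖ := by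
  have h : star (CFC.abs a * b) * (CFC.abs a * b) = star (a * b) * (a * b) := by
    rw [star_mul, star_mul, (IsSelfAdjoint.of_nonneg (CFC.abs_nonneg a)).star_eq, mul_assoc,
      ← mul_assoc (CFC.abs a), CFC.abs_mul_abs]
    simp only [mul_assoc]
  rw [← mul_self_inj (norm_nonneg _) (norm_nonneg _), ← CStarRing.norm_star_mul_self, h,
    CStarRing.norm_star_mul_self]

theorem continuous_div_max_half (hl : 0 < l) : Continuous fun x : ℝ => x / max x (l / 2) :=
  continuous_id.div₀ (by fun_prop) fun _ => (lt_max_of_lt_right (half_pos hl)).ne'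

theorem norm_cfc_div_max_mul_le (ha : 0 ≤ a) (hl : 0 < l) (h : ‖a * b‖ ≤ l / 4) :
    ‖cfc (fun x : ℝ => x / max x (l / 2)) a * b‖ ≤ 1 / 2 := by
  have hmax (x : ℝ) : l / 2 ≤ max x (l / 2) := le_max_right _ _
  have hcont : Continuous fun x : ℝ => (max x (l / 2))⁻¹ :=
    Continuous.inv₀ (by fun_prop) fun x => by linarith [hmax x]
  have hmul : cfc (fun x : ℝ => x / max x (l / 2)) a =
      cfc (fun x : ℝ => (max x (l / 2))⁻¹) a * a := by
    nth_rw 3 [← cfc_id' ℝ a]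
    rw [← cfc_mul _ (fun x : ℝ => x) a hcont.continuousOn continuousOn_id]
    exact cfc_congr fun x _ => div_eq_inv_mul _ _
  have hnorm : ‖cfc (fun x : ℝ => (max x (l / 2))⁻¹) a‖ ≤ 2 / l :=
    norm_cfc_le (by positivity) fun x _ => by
      rw [norm_inv, Real.norm_of_nonneg (by linarith [hmax x]), ← inv_div l 2]
      exact inv_anti₀ (by positivity) (hmax x)
  calc _ = ‖cfc (fun x : ℝ => (max x (l / 2))⁻¹) a * (a * b)‖ := by rw [hmul, mul_assoc]
    _ ≤ 2 / l * (l / 4) := (norm_mul_le _ _).trans (by gcongr)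
    _ = 1 / 2 := by field_simp; norm_num

theorem half_smul_cfc_ramp_le_softThreshold (ha : 0 ≤ a) (hl : 0 < l) :
    (2⁻¹ : ℝ) • cfc (ramp l) a ≤ softThreshold (cfc (fun x : ℝ => x / max x (l / 2)) a *
      cfc (fun x : ℝ => x / max x (l / 2)) a) 4⁻¹ := by
  have hcont := continuous_div_max_half hl
  rw [← cfc_mul _ _ a hcont.continuousOn hcont.continuousOn, softThreshold_eq_cfc .cfc,
    ← cfc_comp' (fun x => max (x - 4⁻¹) 0) (fun x => x / max x (l / 2) * (x / max x (l / 2))) a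
      (by fun_prop) (hcont.mul hcont).continuousOn,
    ← cfc_smul _ _ a (continuous_ramp l).continuousOn]
  refine cfc_mono (fun x _ => ?_) ((continuous_ramp l).const_mul _).continuousOn
    (((hcont.mul hcont).sub continuous_const).max continuous_const).continuousOn
  rcases le_total x (l / 2) with hx | hx
  · simp [ramp_of_le_half hl hx]
  · have hx0 : x ≠ 0 := by linarith
    rw [max_eq_left hx, div_self hx0, smul_eq_mul]
    exact le_max_of_le_left (by linarith [ramp_le_one l x])

theorem mul_self_sub_le_conjugate_one_sub (ha : 0 ≤ a) (hl : 0 < l) (hp : IsStarProjection p)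
    (h : ‖a * p‖ ≤ l / 4) :
    cfc (fun x : ℝ => x / max x (l / 2)) a * cfc (fun x : ℝ => x / max x (l / 2)) a
        - (4⁻¹ : ℝ) • (1 : 𝒜) ≤
      cfc (fun x : ℝ => x / max x (l / 2)) a * (1 - p) *
        cfc (fun x : ℝ => x / max x (l / 2)) a := by
  set v := cfc (fun x : ℝ => x / max x (l / 2)) a
  have hv : star v = v := (IsSelfAdjoint.cfc : IsSelfAdjoint v).star_eq
  have hvp : v * p * v ≤ (4⁻¹ : ℝ) • (1 : 𝒜) := by
    calc v * p * v = v * p * star (v * p) := by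
          rw [star_mul, hv, hp.isSelfAdjoint.star_eq, mul_assoc v p (p * v), ← mul_assoc p p,
            hp.isIdempotentElem, mul_assoc]
      _ ≤ algebraMap ℝ 𝒜 (‖v * p‖ ^ 2) := CStarAlgebra.mul_star_le_algebraMap_norm_sq
      _ ≤ algebraMap ℝ 𝒜 ((1 / 2) ^ 2) :=
          algebraMap_mono _ (pow_le_pow_left₀ (norm_nonneg _) (norm_cfc_div_max_mul_le ha hl h) 2)
      _ = (4⁻¹ : ℝ) • (1 : 𝒜) := by rw [Algebra.algebraMap_eq_smul_one]; norm_num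
  rw [mul_sub, mul_one, sub_mul]
  exact sub_le_sub_left hvp _

theorem norm_sub_softThreshold_le (ha : 0 ≤ a) (hl : 0 ≤ l) : ‖a - softThreshold a l‖ ≤ l := by
  have hcont : Continuous fun x : ℝ => max (x - l) 0 := by fun_prop
  rw [softThreshold_eq_cfc (.of_nonneg ha)]
  nth_rw 1 [← cfc_id' ℝ a]
  rw [← cfc_sub (fun x : ℝ => x) _ a continuousOn_id hcont.continuousOn]
  refine norm_cfc_le hl fun x hx => ?_
  have hx0 : 0 ≤ x := spectrum_nonneg_of_nonneg ha hx
  rw [Real.norm_eq_abs, abs_le]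
  rcases max_cases (x - l) 0 with ⟨h, _⟩ | ⟨h, _⟩ <;> constructor <;> linarith

end CStarAlgebra

theorem one_sub_kerProj_softThreshold_le {P : H →L[ℂ] H} (hP : IsSelfAdjoint P) {l : ℝ}
    (hl : 0 < l) : 1 - kerProj (softThreshold P l) ≤ cfc (ramp l) P := by
  set r := cfc (ramp l) P
  set p := kerProj (softThreshold P l)
  have hp : IsStarProjection p := isStarProjection_kerProj _
  have hr : IsSelfAdjoint r := .cfc
  have hpr : p * (1 - r) = 1 - r :=
    kerProj_mul (by rw [mul_sub, mul_one, softThreshold_mul_cfc_ramp hP hl, sub_self])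
  have hrp : (1 - r) * p = 1 - r := by
    simpa [hp.isSelfAdjoint.star_eq, hr.star_eq] using congrArg star hpr
  have hcompress : star p * r * p = r - (1 - p) := by
    calc star p * r * p = p * p - p * (1 - r) * p := by
          rw [hp.isSelfAdjoint.star_eq, mul_sub, mul_one, sub_mul, sub_sub_cancel]
      _ = r - (1 - p) := by rw [hpr, hrp, hp.isIdempotentElem]; abel
  rw [← sub_nonneg, ← hcompress]
  exact star_left_conjugate_nonneg (cfc_nonneg fun x _ => ramp_nonneg l x) p

namespace FNSTrace

variable {N : VonNeumannAlgebra H} (τ : FNSTrace N) {A : H →L[ℂ] H} {l s ε : ℝ}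

theorem singularValue_le {t : ℝ} {p : H →L[ℂ] H} (hp : p ∈ N) (hpp : IsStarProjection p)
    (ht : τ.toFun (1 - p) ≤ ENNReal.ofReal t) (A : H →L[ℂ] H) :
    τ.singularValue t A ≤ ‖A * p‖ :=
  csInf_le ⟨0, by rintro _ ⟨p, -, -, -, rfl⟩; exact norm_nonneg _⟩ ⟨p, hp, hpp, ht, rfl⟩

theorem toFun_one_sub_one_le (t : ℝ) : τ.toFun (1 - 1) ≤ ENNReal.ofReal t := by
  simp [τ.toFun_zero]

theorem le_singularValue {t r : ℝ} (A : H →L[ℂ] H)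
    (h : ∀ p ∈ N, IsStarProjection p → τ.toFun (1 - p) ≤ ENNReal.ofReal t → r ≤ ‖A * p‖) :
    r ≤ τ.singularValue t A := by
  refine le_csInf ⟨_, 1, one_mem N, .one _, τ.toFun_one_sub_one_le t, rfl⟩ ?_
  rintro _ ⟨p, hp, hpp, ht, rfl⟩
  exact h p hp hpp ht

theorem singularValue_nonneg (t : ℝ) (A : H →L[ℂ] H) : 0 ≤ τ.singularValue t A :=
  τ.le_singularValue A fun _ _ _ _ => norm_nonneg _

theorem singularValue_le_norm (t : ℝ) (A : H →L[ℂ] H) : τ.singularValue t A ≤ ‖A‖ := by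
  simpa only [mul_one] using
    τ.singularValue_le (one_mem N) (.one _) (τ.toFun_one_sub_one_le t) A

theorem antitone_singularValue (A : H →L[ℂ] H) : Antitone fun t => τ.singularValue t A :=
  fun _ _ hst => τ.le_singularValue A fun _ hp hpp h =>
    τ.singularValue_le hp hpp (h.trans (ENNReal.ofReal_le_ofReal hst)) A

theorem intervalIntegrable_singularValue (A : H →L[ℂ] H) (s t : ℝ) :
    IntervalIntegrable (fun t => τ.singularValue t A) volume s t :=
  (τ.antitone_singularValue A).intervalIntegrable

theorem toFun_ramp_abs_le (hA : A ∈ N) {p : H →L[ℂ] H} (hp : p ∈ N) (hpp : IsStarProjection p)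
    (hl : 0 < l) (h : ‖A * p‖ ≤ l / 4) :
    τ.toFun (cfc (ramp l) (CFC.abs A)) ≤ 2 * τ.toFun (1 - p) := by
  have hP0 : 0 ≤ CFC.abs A := CFC.abs_nonneg A
  have hrN : cfc (ramp l) (CFC.abs A) ∈ N := cfc_mem (abs_mem hA) _
  have hr0 : 0 ≤ cfc (ramp l) (CFC.abs A) := cfc_nonneg fun x _ => ramp_nonneg l x
  have hsub := mul_self_sub_le_conjugate_one_sub hP0 hl hpp (by rwa [norm_abs_mul])
  have hhalf := half_smul_cfc_ramp_le_softThreshold hP0 hl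
  set v := cfc (fun x : ℝ => x / max x (l / 2)) (CFC.abs A)
  have hvN : v ∈ N := cfc_mem (abs_mem hA) _
  have hvs : IsSelfAdjoint v := .cfc
  have hv1 : ‖v‖ ≤ 1 := norm_cfc_le zero_le_one fun x hx => by
    have hx0 : 0 ≤ x := spectrum_nonneg_of_nonneg hP0 hx
    have hmax : 0 < max x (l / 2) := lt_max_of_lt_right (half_pos hl)
    rw [Real.norm_of_nonneg (by positivity)]
    exact div_le_one_of_le₀ (le_max_left _ _) hmax.le
  have hpN : 1 - p ∈ N := sub_mem (one_mem N) hp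
  have hvv : 0 ≤ v * (1 - p) * v := hvs.conjugate_nonneg hpp.one_sub.nonneg
  have key : 2⁻¹ * τ.toFun (cfc (ramp l) (CFC.abs A)) ≤ τ.toFun (1 - p) :=
    calc 2⁻¹ * τ.toFun (cfc (ramp l) (CFC.abs A))
        = τ.toFun ((2⁻¹ : ℝ) • cfc (ramp l) (CFC.abs A)) := by
          rw [τ.map_smul _ (by norm_num) _ hrN hr0, ENNReal.ofReal_inv_of_pos (by norm_num),
            ENNReal.ofReal_ofNat]
      _ ≤ τ.toFun (softThreshold (v * v) 4⁻¹) :=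
          τ.toFun_mono (real_smul_mem _ hrN) (softThreshold_mem (mul_mem hvN hvN) _)
            (smul_nonneg (by norm_num) hr0) hhalf
      _ ≤ τ.toFun (v * (1 - p) * v) :=
          τ.toFun_softThreshold_le_of_sub_le (mul_mem hvN hvN)
            ((IsSelfAdjoint.commute_iff hvs hvs).1 (.refl v))
            (mul_mem (mul_mem hvN hpN) hvN) hvv hsub
      _ ≤ τ.toFun (1 - p) := by
          simpa only [hvs.star_eq] using τ.toFun_conjugate_le hpN hpp.one_sub.nonneg hvN hv1
  rwa [mul_comm, ← div_eq_mul_inv, ENNReal.div_le_iff' (by norm_num) (by norm_num)] at key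

theorem toFun_ramp_abs_le_volume (hA : A ∈ N) (hl : 0 < l) :
    τ.toFun (cfc (ramp l) (CFC.abs A)) ≤
      2 * volume {s : ℝ | 0 < s ∧ l ≤ 4 * τ.singularValue s A} := by
  rw [mul_comm, ← ENNReal.div_le_iff (by norm_num) (by norm_num),
    ← volume_pos_and_ofReal_lt (τ.toFun _ / 2)]
  refine measure_mono fun s ⟨hs, hlt⟩ => ⟨hs, ?_⟩
  suffices l / 4 ≤ τ.singularValue s A by linarith
  refine τ.le_singularValue A fun p hp hpp hps => ?_
  by_contra! hlt'
  rw [ENNReal.lt_div_iff_mul_lt (by simp) (by simp), mul_comm] at hlt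
  exact (hlt.trans_le (τ.toFun_ramp_abs_le hA hp hpp hl hlt'.le)).not_ge (by gcongr)

theorem singularValue_le_of_toFun_ramp_abs_le (hA : A ∈ N) (hl : 0 < l)
    (h : τ.toFun (cfc (ramp l) (CFC.abs A)) ≤ ENNReal.ofReal s) :
    τ.singularValue s A ≤ l := by
  have hP0 : 0 ≤ CFC.abs A := CFC.abs_nonneg A
  set R := softThreshold (CFC.abs A) l
  have hpp : IsStarProjection (kerProj R) := isStarProjection_kerProj R
  have hpN : kerProj R ∈ N := kerProj_mem (softThreshold_mem (abs_mem hA) l)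
  have htrace : τ.toFun (1 - kerProj R) ≤ ENNReal.ofReal s :=
    (τ.toFun_mono (sub_mem (one_mem N) hpN) (cfc_mem (abs_mem hA) _) hpp.one_sub.nonneg
      (one_sub_kerProj_softThreshold_le (.of_nonneg hP0) hl)).trans h
  calc τ.singularValue s A ≤ ‖A * kerProj R‖ := τ.singularValue_le hpN hpp htrace A
    _ = ‖(CFC.abs A - R) * kerProj R‖ := by
        rw [← norm_abs_mul, sub_mul, mul_kerProj R, sub_zero]
    _ ≤ ‖CFC.abs A - R‖ := (norm_mul_le _ _).trans
        (mul_le_of_le_one_right (norm_nonneg _) hpp.norm_le)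
    _ ≤ l := norm_sub_softThreshold_le hP0 hl.le

theorem volume_lt_singularValue_le (hA : A ∈ N) (hl : 0 < l) :
    volume {s : ℝ | 0 < s ∧ l < τ.singularValue s A} ≤ τ.toFun (cfc (ramp l) (CFC.abs A)) := by
  rw [← volume_pos_and_ofReal_lt (τ.toFun _)]
  refine measure_mono fun s ⟨hs, hls⟩ => ?_
  exact ⟨hs, not_le.1 fun h => hls.not_ge (τ.singularValue_le_of_toFun_ramp_abs_le hA hl h)⟩

end FNSTrace

/-! ### The Dixmier ideal -/

theorem log_two_le {T : ℝ} (hT : 0 ≤ T) : Real.log 2 ≤ Real.log (2 + T) :=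
  Real.log_le_log (by norm_num) (by linarith)

theorem log_two_add_pos {T : ℝ} (hT : 0 ≤ T) : 0 < Real.log (2 + T) :=
  (Real.log_pos (by norm_num)).trans_le (log_two_le hT)

theorem exists_log_two_add_mul_le {a : ℝ} (ha : 0 ≤ a) :
    ∃ c : ℝ, 0 ≤ c ∧ ∀ T : ℝ, 0 ≤ T → Real.log (2 + a * T) ≤ c * Real.log (2 + T) := by
  have hlog : 0 ≤ Real.log (1 + a) := Real.log_nonneg (by linarith)
  refine ⟨Real.log (1 + a) / Real.log 2 + 1, by positivity, fun T hT => ?_⟩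
  calc Real.log (2 + a * T)
      ≤ Real.log ((1 + a) * (2 + T)) := Real.log_le_log (by positivity) (by nlinarith)
    _ = Real.log (1 + a) / Real.log 2 * Real.log 2 + Real.log (2 + T) := by
      rw [Real.log_mul (by positivity) (by positivity),
        div_mul_cancel₀ _ (Real.log_pos one_lt_two).ne']
    _ ≤ (Real.log (1 + a) / Real.log 2 + 1) * Real.log (2 + T) := by
      rw [add_mul, one_mul]
      gcongr ?_ * ?_ + _
      exact log_two_le hT

theorem log_one_add_le_two_sqrt {t : ℝ} (ht : 0 ≤ t) : Real.log (1 + t) ≤ 2 * √t := by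
  calc Real.log (1 + t)
      ≤ Real.log ((1 + √t) ^ 2) :=
        Real.log_le_log (by positivity) (by nlinarith [Real.sq_sqrt ht, Real.sqrt_nonneg t])
    _ = 2 * Real.log (1 + √t) := by rw [Real.log_pow, Nat.cast_ofNat]
    _ ≤ 2 * √t := by
      have := Real.log_le_sub_one_of_pos (show 0 < 1 + √t by positivity)
      linarith

theorem exists_norm_le_two_pow_mul {E : Type*} [SeminormedAddGroup E] (x : E) {ε : ℝ}
    (hε : 0 < ε) : ∃ K : ℕ, ‖x‖ ≤ 2 ^ K * ε := by
  obtain ⟨K, hK⟩ := pow_unbounded_of_one_lt (‖x‖ / ε) one_lt_two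
  exact ⟨K, ((div_lt_iff₀ hε).1 hK).le⟩

theorem sum_smul_cfc_ramp (ε : ℝ) (K : ℕ) (P : H →L[ℂ] H) :
    ∑ k ∈ Finset.range K, (2 ^ k * ε) • cfc (ramp (2 ^ k * ε)) P =
      cfc (fun x => ∑ k ∈ Finset.range K, 2 ^ k * ε * ramp (2 ^ k * ε) x) P := by
  have h := cfc_sum (fun k x => 2 ^ k * ε * ramp (2 ^ k * ε) x) P (Finset.range K)
    fun k _ => ((continuous_ramp _).const_mul _).continuousOn
  rw [Finset.sum_fn] at h
  rw [h]
  exact Finset.sum_congr rfl fun k _ => (cfc_smul _ _ P (continuous_ramp _).continuousOn).symm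

theorem continuous_sum_ramp (ε : ℝ) (K : ℕ) :
    Continuous fun x => ∑ k ∈ Finset.range K, 2 ^ k * ε * ramp (2 ^ k * ε) x :=
  continuous_finsetSum _ fun _ _ => (continuous_ramp _).const_mul _

namespace FNSTrace

variable {N : VonNeumannAlgebra H} (τ : FNSTrace N) {A B P Q X Y : H →L[ℂ] H} {ε : ℝ}

theorem toFun_sum_smul {ι : Type*} (s : Finset ι) {c : ι → ℝ} (hc : ∀ i, 0 ≤ c i)
    {Q : ι → H →L[ℂ] H} (hQ : ∀ i, Q i ∈ N) (hQ0 : ∀ i, 0 ≤ Q i) :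
    τ.toFun (∑ i ∈ s, c i • Q i) = ∑ i ∈ s, ENNReal.ofReal (c i) * τ.toFun (Q i) := by
  classical
  induction s using Finset.induction_on with
  | empty => simp only [Finset.sum_empty, τ.toFun_zero]
  | insert i s hi ih =>
    rw [Finset.sum_insert hi, Finset.sum_insert hi,
      τ.map_add _ (real_smul_mem _ (hQ i)) _ (sum_mem fun j _ => real_smul_mem _ (hQ j))
        (smul_nonneg (hc i) (hQ0 i)) (Finset.sum_nonneg fun j _ => smul_nonneg (hc j) (hQ0 j)),
      τ.map_smul _ (hc i) _ (hQ i) (hQ0 i), ih]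

theorem sum_mul_toFun_ramp (hP : P ∈ N) (hε : 0 ≤ ε) (K : ℕ) :
    ∑ k ∈ Finset.range K, ENNReal.ofReal (2 ^ k * ε) * τ.toFun (cfc (ramp (2 ^ k * ε)) P) =
      τ.toFun (cfc (fun x => ∑ k ∈ Finset.range K, 2 ^ k * ε * ramp (2 ^ k * ε) x) P) := by
  rw [← sum_smul_cfc_ramp, τ.toFun_sum_smul _ (fun k => by positivity) (fun k => cfc_mem hP _)
    fun k => cfc_nonneg fun x _ => ramp_nonneg _ _]

theorem toFun_softThreshold_le_sum_ramp (hP : P ∈ N) (hP0 : 0 ≤ P) (hε : 0 < ε) {K : ℕ}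
    (hK : ‖P‖ ≤ 2 ^ K * ε) :
    τ.toFun (softThreshold P ε) ≤ 2 * ∑ k ∈ Finset.range K,
      ENNReal.ofReal (2 ^ k * ε) * τ.toFun (cfc (ramp (2 ^ k * ε)) P) := by
  have hsum0 : 0 ≤ cfc (fun x => ∑ k ∈ Finset.range K, 2 ^ k * ε * ramp (2 ^ k * ε) x) P :=
    cfc_nonneg fun x _ => Finset.sum_nonneg fun k _ => mul_nonneg (by positivity) (ramp_nonneg _ _)
  rw [τ.sum_mul_toFun_ramp hP hε.le, ← ENNReal.ofReal_ofNat 2,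
    ← τ.map_smul 2 zero_le_two _ (cfc_mem hP _) hsum0]
  refine τ.toFun_mono (softThreshold_mem hP ε) (real_smul_mem _ (cfc_mem hP _))
    (softThreshold_nonneg _ _) ?_
  rw [softThreshold_eq_cfc (.of_nonneg hP0),
    ← cfc_smul _ _ P (continuous_sum_ramp ε K).continuousOn]
  exact cfc_mono
    (fun x hx => max_sub_le_two_mul_dyadic_ramp_sum hε K ((le_norm_of_mem_spectrum hx).trans hK))
    (by fun_prop) ((continuous_sum_ramp ε K).const_smul (2 : ℝ)).continuousOn

theorem sum_ramp_le_toFun_softThreshold (hP : P ∈ N) (hP0 : 0 ≤ P) (hε : 0 < ε) (K : ℕ) :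
    ∑ k ∈ Finset.range K, ENNReal.ofReal (2 ^ k * ε) * τ.toFun (cfc (ramp (2 ^ k * ε)) P) ≤
      8 * τ.toFun (softThreshold P (ε / 4)) := by
  rw [τ.sum_mul_toFun_ramp hP hε.le, ← ENNReal.ofReal_ofNat 8,
    ← τ.map_smul 8 (by norm_num) _ (softThreshold_mem hP _) (softThreshold_nonneg _ _)]
  refine τ.toFun_mono (cfc_mem hP _) (real_smul_mem _ (softThreshold_mem hP _))
    (cfc_nonneg fun x _ =>
      Finset.sum_nonneg fun k _ => mul_nonneg (by positivity) (ramp_nonneg _ _)) ?_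
  have hcont : Continuous fun x : ℝ => max (x - ε / 4) 0 := by fun_prop
  rw [softThreshold_eq_cfc (.of_nonneg hP0), ← cfc_smul _ _ P hcont.continuousOn]
  exact cfc_mono (fun x _ => dyadic_ramp_sum_le hε K) (continuous_sum_ramp ε K).continuousOn
    (hcont.const_smul (8 : ℝ)).continuousOn

theorem toFun_softThreshold_abs_le_lintegral (hA : A ∈ N) (hε : 0 < ε) :
    τ.toFun (softThreshold (CFC.abs A) ε) ≤
      32 * ∫⁻ s in {s | 0 < s ∧ ε ≤ 4 * τ.singularValue s A},
        ENNReal.ofReal (τ.singularValue s A) := by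
  set S : Set ℝ := {s | 0 < s ∧ ε ≤ 4 * τ.singularValue s A}
  have hμ : Measurable fun s => 4 * τ.singularValue s A :=
    (τ.antitone_singularValue A).measurable.const_mul 4
  obtain ⟨K, hK⟩ := exists_norm_le_two_pow_mul (CFC.abs A) hε
  have hramp (k : ℕ) : τ.toFun (cfc (ramp (2 ^ k * ε)) (CFC.abs A)) ≤
      2 * volume.restrict S {s | 2 ^ k * ε ≤ 4 * τ.singularValue s A} := by
    refine (τ.toFun_ramp_abs_le_volume hA (by positivity)).trans ?_
    rw [Measure.restrict_apply (measurableSet_le measurable_const hμ)]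
    gcongr
    rintro s ⟨hs, hle⟩
    exact ⟨hle, hs, (le_mul_of_one_le_left hε.le (one_le_pow₀ one_le_two)).trans hle⟩
  calc τ.toFun (softThreshold (CFC.abs A) ε)
      ≤ 2 * ∑ k ∈ Finset.range K, ENNReal.ofReal (2 ^ k * ε) *
          τ.toFun (cfc (ramp (2 ^ k * ε)) (CFC.abs A)) :=
        τ.toFun_softThreshold_le_sum_ramp (abs_mem hA) (CFC.abs_nonneg A) hε hK
    _ ≤ 2 * ∑ k ∈ Finset.range K, ENNReal.ofReal (2 ^ k * ε) *
          (2 * volume.restrict S {s | 2 ^ k * ε ≤ 4 * τ.singularValue s A}) := by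
        gcongr with k
        exact hramp k
    _ = 4 * ∑ k ∈ Finset.range K, ENNReal.ofReal (2 ^ k * ε) *
          volume.restrict S {s | 2 ^ k * ε ≤ 4 * τ.singularValue s A} := by
        rw [Finset.mul_sum, Finset.mul_sum]
        exact Finset.sum_congr rfl fun k _ => by ring
    _ ≤ 4 * (2 * ∫⁻ s in S, ENNReal.ofReal (4 * τ.singularValue s A)) := by
        gcongr
        exact sum_dyadic_mul_measure_le _ hμ
          (fun s => mul_nonneg (by norm_num) (τ.singularValue_nonneg s A)) hε K
    _ = 32 * ∫⁻ s in S, ENNReal.ofReal (τ.singularValue s A) := by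
        simp_rw [ENNReal.ofReal_mul (show (0 : ℝ) ≤ 4 by norm_num), ENNReal.ofReal_ofNat]
        rw [lintegral_const_mul _ (τ.antitone_singularValue A).measurable.ennreal_ofReal,
          ← mul_assoc, ← mul_assoc]
        norm_num

theorem ofReal_integral_singularValue (A : H →L[ℂ] H) {t : ℝ} (ht : 0 ≤ t) :
    ENNReal.ofReal (∫ s in (0 : ℝ)..t, τ.singularValue s A) =
      ∫⁻ s in Ioc 0 t, ENNReal.ofReal (τ.singularValue s A) := by
  rw [intervalIntegral.integral_of_le ht, ofReal_integral_eq_lintegral_ofReal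
    (τ.intervalIntegrable_singularValue A 0 t).1 (ae_of_all _ fun s => τ.singularValue_nonneg s A)]

theorem ofReal_integral_singularValue_le (hA : A ∈ N) {t : ℝ} (ht : 0 ≤ t) (hε : 0 < ε) :
    ENNReal.ofReal (∫ s in (0 : ℝ)..t, τ.singularValue s A) ≤
      ENNReal.ofReal (ε * t) + 16 * τ.toFun (softThreshold (CFC.abs A) (ε / 4)) := by
  have hμ : Measurable fun s => τ.singularValue s A := (τ.antitone_singularValue A).measurable
  obtain ⟨K, hK⟩ := exists_norm_le_two_pow_mul A hε
  have hramp (k : ℕ) : volume.restrict (Ioc 0 t) {s | 2 ^ k * ε < τ.singularValue s A} ≤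
      τ.toFun (cfc (ramp (2 ^ k * ε)) (CFC.abs A)) := by
    refine le_trans ?_ (τ.volume_lt_singularValue_le hA (by positivity))
    rw [Measure.restrict_apply (measurableSet_lt measurable_const hμ)]
    exact measure_mono fun s ⟨hlt, hs⟩ => ⟨hs.1, hlt⟩
  rw [τ.ofReal_integral_singularValue A ht]
  calc ∫⁻ s in Ioc 0 t, ENNReal.ofReal (τ.singularValue s A)
      ≤ ENNReal.ofReal ε * volume.restrict (Ioc 0 t) univ + 2 * ∑ k ∈ Finset.range K,
          ENNReal.ofReal (2 ^ k * ε) *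
            volume.restrict (Ioc 0 t) {s | 2 ^ k * ε < τ.singularValue s A} :=
        lintegral_le_add_two_mul_sum_dyadic _ hμ hε fun s => (τ.singularValue_le_norm s A).trans hK
    _ ≤ ENNReal.ofReal (ε * t) + 2 * ∑ k ∈ Finset.range K,
          ENNReal.ofReal (2 ^ k * ε) * τ.toFun (cfc (ramp (2 ^ k * ε)) (CFC.abs A)) := by
        rw [Measure.restrict_apply_univ, Real.volume_Ioc, sub_zero, ENNReal.ofReal_mul hε.le]
        gcongr with k
        exact hramp k
    _ ≤ ENNReal.ofReal (ε * t) + 2 * (8 * τ.toFun (softThreshold (CFC.abs A) (ε / 4))) := by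
        gcongr
        exact τ.sum_ramp_le_toFun_softThreshold (abs_mem hA) (CFC.abs_nonneg A) hε K
    _ = ENNReal.ofReal (ε * t) + 16 * τ.toFun (softThreshold (CFC.abs A) (ε / 4)) := by
        rw [← mul_assoc]
        norm_num

theorem mul_singularValue_le_integral (A : H →L[ℂ] H) {t : ℝ} (ht : 0 ≤ t) :
    t * τ.singularValue t A ≤ ∫ s in (0 : ℝ)..t, τ.singularValue s A := by
  calc t * τ.singularValue t A = ∫ _ in (0 : ℝ)..t, τ.singularValue t A := by
        rw [intervalIntegral.integral_const, sub_zero, smul_eq_mul]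
    _ ≤ ∫ s in (0 : ℝ)..t, τ.singularValue s A :=
        intervalIntegral.integral_mono_on ht intervalIntegrable_const
          (τ.intervalIntegrable_singularValue A 0 t) fun _ hs => τ.antitone_singularValue A hs.2

theorem integral_singularValue_le_mul_norm (A : H →L[ℂ] H) {t : ℝ} (ht : 0 ≤ t) :
    ∫ s in (0 : ℝ)..t, τ.singularValue s A ≤ t * ‖A‖ := by
  calc ∫ s in (0 : ℝ)..t, τ.singularValue s A ≤ ∫ _ in (0 : ℝ)..t, ‖A‖ :=
        intervalIntegral.integral_mono_on ht (τ.intervalIntegrable_singularValue A 0 t)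
          intervalIntegrable_const fun s _ => τ.singularValue_le_norm s A
    _ = t * ‖A‖ := by rw [intervalIntegral.integral_const, sub_zero, smul_eq_mul]

theorem exists_integral_singularValue_le (hA : A ∈ τ.dixmierIdeal) :
    ∃ D : ℝ, 0 < D ∧ ∀ t : ℝ, 0 < t →
      ∫ s in (0 : ℝ)..t, τ.singularValue s A ≤ D * Real.log (1 + t) := by
  obtain ⟨-, C, hC⟩ := hA
  refine ⟨max C 1, by positivity, fun t ht => ?_⟩
  rw [mul_comm, ← inv_mul_le_iff₀ (Real.log_pos (by linarith))]
  exact (hC t ht).trans (le_max_left C 1)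

theorem le_sq_of_le_singularValue {D l t : ℝ} (hl : 0 < l) (ht : 0 < t) (hD : 0 ≤ D)
    (h : ∫ s in (0 : ℝ)..t, τ.singularValue s A ≤ D * Real.log (1 + t))
    (hlt : l ≤ τ.singularValue t A) : t ≤ (2 * D / l) ^ 2 := by
  have hsqrt : 0 < √t := Real.sqrt_pos.2 ht
  have hsq : √t * √t = t := Real.mul_self_sqrt ht.le
  have hmul : √t * (√t * l) ≤ √t * (2 * D) := by
    calc √t * (√t * l) = t * l := by rw [← mul_assoc, hsq]
      _ ≤ t * τ.singularValue t A := by gcongr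
      _ ≤ D * Real.log (1 + t) := (τ.mul_singularValue_le_integral A ht.le).trans h
      _ ≤ D * (2 * √t) := by gcongr; exact log_one_add_le_two_sqrt ht.le
      _ = √t * (2 * D) := by ring
  calc t = √t ^ 2 := (Real.sq_sqrt ht.le).symm
    _ ≤ (2 * D / l) ^ 2 := by
      gcongr
      exact (le_div_iff₀ hl).2 (le_of_mul_le_mul_left hmul hsqrt)

theorem toFun_softThreshold_abs_le_log {D : ℝ} (hA : A ∈ N) (hD : 0 < D)
    (h : ∀ t : ℝ, 0 < t → ∫ s in (0 : ℝ)..t, τ.singularValue s A ≤ D * Real.log (1 + t))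
    (hε : 0 < ε) :
    τ.toFun (softThreshold (CFC.abs A) ε) ≤
      ENNReal.ofReal (32 * (D * Real.log (1 + (8 * D / ε) ^ 2))) := by
  have hM : 0 < (8 * D / ε) ^ 2 := by positivity
  calc τ.toFun (softThreshold (CFC.abs A) ε)
      ≤ 32 * ∫⁻ s in {s | 0 < s ∧ ε ≤ 4 * τ.singularValue s A},
          ENNReal.ofReal (τ.singularValue s A) := τ.toFun_softThreshold_abs_le_lintegral hA hε
    _ ≤ 32 * ∫⁻ s in Ioc 0 ((8 * D / ε) ^ 2), ENNReal.ofReal (τ.singularValue s A) := by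
        gcongr
        rintro s ⟨hs, hle⟩
        refine ⟨hs, (τ.le_sq_of_le_singularValue (show 0 < ε / 4 by positivity) hs hD.le (h s hs)
          (by linarith)).trans_eq ?_⟩
        field_simp
        norm_num
    _ = 32 * ENNReal.ofReal (∫ s in (0 : ℝ)..(8 * D / ε) ^ 2, τ.singularValue s A) := by
        rw [τ.ofReal_integral_singularValue A hM.le]
    _ ≤ ENNReal.ofReal (32 * (D * Real.log (1 + (8 * D / ε) ^ 2))) := by
        rw [ENNReal.ofReal_mul (by norm_num), ENNReal.ofReal_ofNat]
        gcongr
        exact h _ hM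

/-- A positive operator `P` of `N` with `τ((P - 1/T)₊) = O(log(2 + T))`. These are the positive
elements of `𝓜_{1,∞}`. -/
structure LogBounded (P : H →L[ℂ] H) : Prop where
  mem : P ∈ N
  nonneg : 0 ≤ P
  bound : ∃ C : ℝ, 0 ≤ C ∧ ∀ T : ℝ, 0 < T →
    τ.toFun (softThreshold P T⁻¹) ≤ ENNReal.ofReal (C * Real.log (2 + T))

theorem logBounded_abs (hA : A ∈ τ.dixmierIdeal) : τ.LogBounded (CFC.abs A) := by
  obtain ⟨D, hD, h_int⟩ := τ.exists_integral_singularValue_le hA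
  obtain ⟨c, hc0, hc⟩ := exists_log_two_add_mul_le (show 0 ≤ 8 * D by positivity)
  refine ⟨abs_mem hA.1, CFC.abs_nonneg A, 64 * D * c, by positivity, fun T hT => ?_⟩
  refine (τ.toFun_softThreshold_abs_le_log hA.1 hD h_int (inv_pos.2 hT)).trans
    (ENNReal.ofReal_le_ofReal ?_)
  have hDT : 0 < 8 * D * T := by positivity
  calc 32 * (D * Real.log (1 + (8 * D / T⁻¹) ^ 2))
      ≤ 32 * (D * Real.log ((2 + 8 * D * T) ^ 2)) := by
        rw [div_inv_eq_mul]
        gcongr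
        nlinarith
    _ = 64 * D * Real.log (2 + 8 * D * T) := by rw [Real.log_pow, Nat.cast_ofNat]; ring
    _ ≤ 64 * D * (c * Real.log (2 + T)) := by gcongr; exact hc T hT.le
    _ = 64 * D * c * Real.log (2 + T) := by ring

theorem integral_singularValue_le_of_toFun_softThreshold_le (hA : A ∈ N) {b t : ℝ} (hb : 0 ≤ b)
    (ht : 0 < t) (h : τ.toFun (softThreshold (CFC.abs A) t⁻¹) ≤ ENNReal.ofReal b) :
    ∫ s in (0 : ℝ)..t, τ.singularValue s A ≤ 4 + 16 * b := by
  rw [← ENNReal.ofReal_le_ofReal_iff (by positivity)]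
  refine (τ.ofReal_integral_singularValue_le hA ht.le (ε := 4 / t) (by positivity)).trans ?_
  rw [div_mul_cancel₀ _ ht.ne', div_div_cancel_left' four_ne_zero,
    ENNReal.ofReal_add (by norm_num) (by positivity), ENNReal.ofReal_mul (by norm_num),
    ENNReal.ofReal_ofNat]
  gcongr
  norm_num

theorem mem_dixmierIdeal_of_logBounded_abs (hA : A ∈ N) (h : τ.LogBounded (CFC.abs A)) :
    A ∈ τ.dixmierIdeal := by
  obtain ⟨-, -, C, hC0, hC⟩ := h
  have hlog2 : 0 < Real.log 2 := Real.log_pos one_lt_two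
  refine ⟨hA, max (2 * ‖A‖) (4 / Real.log 2 + 32 * C), fun t ht => ?_⟩
  have hlog : 0 < Real.log (1 + t) := Real.log_pos (by linarith)
  rw [inv_mul_le_iff₀ hlog]
  rcases le_total t 1 with ht1 | ht1
  · have htlog : t / 2 ≤ Real.log (1 + t) := by
      refine le_trans ?_ (Real.le_log_one_add_of_nonneg ht.le)
      rw [div_le_div_iff₀ two_pos (by positivity)]
      nlinarith
    calc ∫ s in (0 : ℝ)..t, τ.singularValue s A ≤ t * ‖A‖ :=
          τ.integral_singularValue_le_mul_norm A ht.le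
      _ = t / 2 * (2 * ‖A‖) := by ring
      _ ≤ _ := by gcongr; exact le_max_left _ _
  · have hlog_mono : Real.log 2 ≤ Real.log (1 + t) := Real.log_le_log two_pos (by linarith)
    have hlog_two_add : Real.log (2 + t) ≤ 2 * Real.log (1 + t) := by
      have : Real.log (2 + t) ≤ Real.log ((1 + t) ^ 2) :=
        Real.log_le_log (by positivity) (by nlinarith)
      rwa [Real.log_pow, Nat.cast_ofNat] at this
    calc ∫ s in (0 : ℝ)..t, τ.singularValue s A
        ≤ 4 + 16 * (C * Real.log (2 + t)) :=
          τ.integral_singularValue_le_of_toFun_softThreshold_le hA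
            (mul_nonneg hC0 (log_two_add_pos ht.le).le) ht (hC t ht)
      _ ≤ Real.log (1 + t) / Real.log 2 * 4 + 16 * (C * (2 * Real.log (1 + t))) := by
          gcongr
          exact le_mul_of_one_le_left (by norm_num) ((one_le_div hlog2).2 hlog_mono)
      _ = Real.log (1 + t) * (4 / Real.log 2 + 32 * C) := by ring
      _ ≤ _ := by gcongr; exact le_max_right _ _

variable {τ}

namespace LogBounded

theorem isSelfAdjoint (h : τ.LogBounded P) : IsSelfAdjoint P := .of_nonneg h.nonneg

theorem softThreshold_lt_top (h : τ.LogBounded P) (hε : 0 < ε) :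
    τ.toFun (softThreshold P ε) < ∞ := by
  obtain ⟨C, -, hC⟩ := h.bound
  simpa only [inv_inv] using (hC ε⁻¹ (by positivity)).trans_lt ENNReal.ofReal_lt_top

theorem exists_bound_mul (h : τ.LogBounded P) {a : ℝ} (ha : 0 < a) :
    ∃ C : ℝ, 0 ≤ C ∧ ∀ T : ℝ, 0 < T →
      τ.toFun (softThreshold P (a * T)⁻¹) ≤ ENNReal.ofReal (C * Real.log (2 + T)) := by
  obtain ⟨C, hC0, hC⟩ := h.bound
  obtain ⟨c, hc0, hc⟩ := exists_log_two_add_mul_le ha.le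
  refine ⟨C * c, by positivity, fun T hT => (hC (a * T) (by positivity)).trans ?_⟩
  rw [mul_assoc]
  gcongr
  exact hc T hT.le

theorem of_le (h : τ.LogBounded Q) (hP : P ∈ N) (hP0 : 0 ≤ P) {a b : ℝ} (ha : 0 < a) (hb : 0 ≤ b)
    (hle : ∀ ε : ℝ, 0 < ε →
      τ.toFun (softThreshold P (a * ε)) ≤ ENNReal.ofReal b * τ.toFun (softThreshold Q ε)) :
    τ.LogBounded P := by
  obtain ⟨C, hC0, hC⟩ := h.exists_bound_mul ha
  refine ⟨hP, hP0, b * C, by positivity, fun T hT => ?_⟩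
  have hPT := hle (a * T)⁻¹ (by positivity)
  rw [mul_inv, mul_inv_cancel_left₀ ha.ne', ← mul_inv] at hPT
  rw [mul_assoc, ENNReal.ofReal_mul hb]
  exact hPT.trans (by gcongr; exact hC T hT)

theorem add (hP : τ.LogBounded P) (hQ : τ.LogBounded Q) : τ.LogBounded (P + Q) := by
  obtain ⟨C, hC0, hC⟩ := hP.exists_bound_mul two_pos
  obtain ⟨D, hD0, hD⟩ := hQ.exists_bound_mul two_pos
  refine ⟨add_mem hP.mem hQ.mem, add_nonneg hP.nonneg hQ.nonneg, C + D, by positivity,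
    fun T hT => ?_⟩
  have hlog := (log_two_add_pos hT.le).le
  rw [show T⁻¹ = (2 * T)⁻¹ + (2 * T)⁻¹ by field_simp; norm_num, add_mul,
    ENNReal.ofReal_add (by positivity) (by positivity)]
  exact (τ.toFun_softThreshold_add_le hP.mem hP.isSelfAdjoint hQ.mem hQ.isSelfAdjoint _ _).trans
    (add_le_add (hC T hT) (hD T hT))

theorem zero : τ.LogBounded (0 : H →L[ℂ] H) := by
  refine ⟨zero_mem N, le_rfl, 0, le_rfl, fun T hT => ?_⟩
  have : softThreshold (0 : H →L[ℂ] H) T⁻¹ = 0 :=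
    le_antisymm (softThreshold_le_self le_rfl (by positivity)) (softThreshold_nonneg _ _)
  rw [this, τ.toFun_zero]
  exact zero_le

theorem smul (hP : τ.LogBounded P) {c : ℝ} (hc : 0 ≤ c) : τ.LogBounded (c • P) := by
  rcases hc.eq_or_lt with rfl | hc'
  · rw [zero_smul]
    exact zero
  · refine hP.of_le (real_smul_mem _ hP.mem) (smul_nonneg hc hP.nonneg) hc' hc fun ε _ => ?_
    rw [softThreshold_smul P hc,
      τ.map_smul _ hc _ (softThreshold_mem hP.mem _) (softThreshold_nonneg _ _)]

theorem posPart_of_le (hY : τ.LogBounded Y) (hX : X ∈ N) (hXs : IsSelfAdjoint X) (h : X ≤ Y) :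
    τ.LogBounded X⁺ := by
  refine hY.of_le (posPart_mem hX) (CFC.posPart_nonneg X) one_pos zero_le_one fun ε hε => ?_
  rw [one_mul, ENNReal.ofReal_one, one_mul, softThreshold_posPart hXs hε.le]
  exact τ.toFun_softThreshold_mono hX hXs hY.mem hY.isSelfAdjoint h ε

end LogBounded

theorem exists_eq_smul_norm_le_one {K : H →L[ℂ] H} (hK : K ∈ N) :
    ∃ r : ℝ, 0 < r ∧ ∃ K' ∈ N, ‖K'‖ ≤ 1 ∧ K = r • K' := by
  have hr : 0 < ‖K‖ + 1 := by positivity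
  refine ⟨‖K‖ + 1, hr, (‖K‖ + 1)⁻¹ • K, real_smul_mem _ hK, ?_, (smul_inv_smul₀ hr.ne' K).symm⟩
  rw [norm_smul, norm_inv, Real.norm_of_nonneg hr.le, inv_mul_le_iff₀ hr]
  linarith

namespace LogBounded

theorem conjugate (hP : τ.LogBounded P) {K : H →L[ℂ] H} (hK : K ∈ N) :
    τ.LogBounded (star K * P * K) := by
  obtain ⟨r, hr, K', hK', hK'1, rfl⟩ := exists_eq_smul_norm_le_one hK
  have hP' : τ.LogBounded (star K' * P * K') := by
    refine hP.of_le (mul_mem (mul_mem (star_mem hK') hP.mem) hK')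
      (star_left_conjugate_nonneg hP.nonneg _) one_pos zero_le_one fun ε hε => ?_
    rw [one_mul, ENNReal.ofReal_one, one_mul]
    exact (τ.toFun_softThreshold_conjugate_le hP.mem hP.isSelfAdjoint hK' hK'1 hε.le).trans
      (τ.toFun_conjugate_le (softThreshold_mem hP.mem _) (softThreshold_nonneg _ _) hK' hK'1)
  have : star (r • K') * P * (r • K') = (r * r) • (star K' * P * K') := by
    rw [star_smul, star_trivial r, smul_mul_assoc, smul_mul_assoc, mul_smul_comm, smul_smul]
  rw [this]
  exact hP'.smul (by positivity)

theorem mem_dixmierIdeal (hP : τ.LogBounded P) : P ∈ τ.dixmierIdeal :=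
  τ.mem_dixmierIdeal_of_logBounded_abs hP.mem ((CFC.abs_of_nonneg P hP.nonneg).symm ▸ hP)

theorem posPart_realPart_mul (hA : A ∈ N) (h : τ.LogBounded (CFC.abs A)) {V : H →L[ℂ] H}
    (hV : V ∈ N) (hV1 : ‖V‖ ≤ 1) : τ.LogBounded (ℜ (V * A) : H →L[ℂ] H)⁺ := by
  have hm := realPart_mem (mul_mem hV hA)
  refine h.of_le (posPart_mem hm) (CFC.posPart_nonneg _) two_pos zero_le_one fun ε hε => ?_
  rw [ENNReal.ofReal_one, one_mul, softThreshold_posPart (ℜ (V * A)).2 (by positivity)]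
  simpa only [mul_one] using τ.toFun_softThreshold_realPart_mul_mul_le hA hV hV1 (one_mem N)
    ContinuousLinearMap.norm_id_le hε

end LogBounded

theorem logBounded_of_mem_jordanParts (hA : A ∈ τ.dixmierIdeal) (hP : P ∈ jordanParts A) :
    τ.LogBounded P := by
  have hphase (c : ℂ) (hc : ‖c‖ ≤ 1) : τ.LogBounded (ℜ (c • A) : H →L[ℂ] H)⁺ := by
    have hc1 : ‖c • (1 : H →L[ℂ] H)‖ ≤ 1 :=
      (norm_smul_le _ _).trans (mul_le_one₀ hc (norm_nonneg _) ContinuousLinearMap.norm_id_le)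
    simpa only [smul_mul_assoc, one_mul] using LogBounded.posPart_realPart_mul hA.1
      (τ.logBounded_abs hA) (complex_smul_mem c (one_mem N)) hc1
  rcases hP with rfl | rfl | rfl | rfl
  · simpa only [one_smul] using hphase 1 norm_one.le
  · simpa only [neg_smul, one_smul, _root_.map_neg, NegMemClass.coe_neg, CFC.posPart_neg] using
      hphase (-1) (by simp)
  · simpa only [neg_smul, _root_.map_neg, realPart_I_smul, neg_neg] using
      hphase (-Complex.I) (by simp)
  · simpa only [realPart_I_smul, NegMemClass.coe_neg, CFC.posPart_neg] using
      hphase Complex.I (by simp)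

theorem mul_mem_dixmierIdeal (hA : A ∈ τ.dixmierIdeal) (hB : B ∈ N) :
    A * B ∈ τ.dixmierIdeal := by
  obtain ⟨r, hr, B', hB', hB'1, rfl⟩ := exists_eq_smul_norm_le_one hB
  have hrA : τ.LogBounded (CFC.abs (r • A)) := by
    rw [CFC.abs_smul, Real.norm_of_nonneg hr.le]
    exact (τ.logBounded_abs hA).smul hr.le
  rw [mul_smul_comm, ← smul_mul_assoc]
  have hrAN := real_smul_mem r hA.1
  refine τ.mem_dixmierIdeal_of_logBounded_abs (mul_mem hrAN hB') <|
    hrA.of_le (abs_mem (mul_mem hrAN hB')) (CFC.abs_nonneg _) three_pos zero_le_one fun ε hε => ?_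
  rw [ENNReal.ofReal_one, one_mul]
  exact τ.toFun_softThreshold_abs_mul_le hrAN hB' hB'1 hε

end FNSTrace

/-! ### Spectral measures -/

/-- The function `x² / max(x, 1/T)`, equal to `min(T x², x)` for `x ≥ 0`. -/
def quadCut (T x : ℝ) : ℝ := x ^ 2 * (max x T⁻¹)⁻¹

section QuadCut

variable {T : ℝ}

theorem max_inv_pos (hT : 0 < T) (x : ℝ) : 0 < max x T⁻¹ := lt_max_of_lt_right (inv_pos.2 hT)

theorem continuous_inv_max (hT : 0 < T) : Continuous fun x : ℝ => (max x T⁻¹)⁻¹ :=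
  Continuous.inv₀ (by fun_prop) fun x => (max_inv_pos hT x).ne'

theorem continuous_quadCut (hT : 0 < T) : Continuous (quadCut T) :=
  (continuous_pow 2).mul (continuous_inv_max hT)

theorem quadCut_nonneg (hT : 0 < T) (x : ℝ) : 0 ≤ quadCut T x :=
  mul_nonneg (sq_nonneg x) (inv_nonneg.2 (max_inv_pos hT x).le)

theorem quadCut_le_mul_sq (hT : 0 < T) (x : ℝ) : quadCut T x ≤ T * x ^ 2 := by
  rw [quadCut, mul_comm]
  gcongr
  exact inv_le_of_inv_le₀ hT (le_max_right _ _)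

theorem quadCut_le_self (hT : 0 < T) {x : ℝ} (hx : 0 ≤ x) : quadCut T x ≤ x := by
  rw [quadCut, ← div_eq_mul_inv, div_le_iff₀ (max_inv_pos hT x), sq]
  gcongr
  exact le_max_left _ _

theorem quadCut_le_of_le_of_le (hT : 0 < T) {a x : ℝ} (ha : 0 < a) (hax : a * T⁻¹ ≤ x)
    (hxa : x ≤ 2 * a * T⁻¹) : quadCut T x ≤ 4 * a * max (x - 2⁻¹ * a * T⁻¹) 0 := by
  have hx : 0 ≤ x := le_trans (by positivity) hax
  have hTx : T * x ≤ 2 * a := by rwa [← le_div_iff₀' hT, div_eq_mul_inv]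
  calc quadCut T x ≤ T * x * x := (quadCut_le_mul_sq hT x).trans_eq (by ring)
    _ ≤ 2 * a * x := by gcongr
    _ ≤ 4 * a * (x - 2⁻¹ * a * T⁻¹) := by nlinarith
    _ ≤ 4 * a * max (x - 2⁻¹ * a * T⁻¹) 0 := by gcongr; exact le_max_left _ _

theorem quadCut_le_sum (hT : 0 < T) {x : ℝ} (J : ℕ) (hx : (2 ^ J * T)⁻¹ ≤ x) :
    quadCut T x ≤ ∑ j ∈ Finset.range (J + 1),
      4 * (2 ^ j)⁻¹ * max (x - (2 ^ (j + 1) * T)⁻¹) 0 := by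
  induction J with
  | zero =>
    have hT' : 0 < T⁻¹ := inv_pos.2 hT
    simp only [pow_zero, one_mul] at hx
    simp only [zero_add, Finset.sum_range_one, pow_zero, inv_one, mul_one, pow_one, mul_inv]
    linarith [quadCut_le_self hT (hT'.le.trans hx), le_max_left (x - 2⁻¹ * T⁻¹) 0]
  | succ J ih =>
    rw [Finset.sum_range_succ]
    rcases le_total (2 ^ J * T)⁻¹ x with h | h
    · exact (ih h).trans (le_add_of_nonneg_right (by positivity))
    · refine le_add_of_nonneg_of_le (Finset.sum_nonneg fun j _ => by positivity) ?_
      have hlow : 2⁻¹ * (2 ^ (J + 1))⁻¹ * T⁻¹ = (2 ^ (J + 1 + 1) * T)⁻¹ := by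
        rw [pow_succ _ (J + 1), mul_inv, mul_inv, mul_comm (2⁻¹ : ℝ)]
      have hhigh : (2 ^ J * T)⁻¹ = 2 * (2 ^ (J + 1))⁻¹ * T⁻¹ := by
        rw [pow_succ, mul_inv, mul_inv]
        ring
      rw [← hlow]
      exact quadCut_le_of_le_of_le hT (by positivity) (by rwa [← mul_inv]) (hhigh ▸ h)

end QuadCut

theorem sum_add_two_mul_inv_two_pow (J : ℕ) :
    ∑ j ∈ Finset.range J, ((j : ℝ) + 2) * (2 ^ j)⁻¹ = 6 - 2 * (J + 3) * (2 ^ J)⁻¹ := by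
  induction J with
  | zero => norm_num
  | succ J ih =>
    rw [Finset.sum_range_succ, ih, pow_succ, mul_inv]
    push_cast
    ring

theorem log_two_add_two_pow_mul_le {T : ℝ} (hT : 0 ≤ T) (n : ℕ) :
    Real.log (2 + 2 ^ n * T) ≤ (n + 1) * Real.log (2 + T) := by
  have hpow : (1 : ℝ) ≤ 2 ^ n := one_le_pow₀ one_le_two
  calc Real.log (2 + 2 ^ n * T)
      ≤ Real.log (2 ^ n * (2 + T)) := Real.log_le_log (by positivity) (by nlinarith)
    _ = n * Real.log 2 + Real.log (2 + T) := by
      rw [Real.log_mul (by positivity) (by positivity), Real.log_pow]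
    _ ≤ n * Real.log (2 + T) + Real.log (2 + T) := by gcongr ?_ * ?_ + _; exact log_two_le hT
    _ = (n + 1) * Real.log (2 + T) := by ring

theorem sum_smul_softThreshold {P : H →L[ℂ] H} (hP : IsSelfAdjoint P) (s : Finset ℕ)
    (c a : ℕ → ℝ) : ∑ j ∈ s, c j • softThreshold P (a j) =
      cfc (fun x => ∑ j ∈ s, c j * max (x - a j) 0) P := by
  have h := cfc_sum (fun (j : ℕ) (x : ℝ) => c j * max (x - a j) 0) P s fun j _ => by fun_prop
  rw [Finset.sum_fn] at h
  rw [h]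
  refine Finset.sum_congr rfl fun j _ => ?_
  rw [softThreshold_eq_cfc hP]
  exact (cfc_smul _ _ P (by fun_prop)).symm

theorem softThreshold_cfc_quadCut_le {P : H →L[ℂ] H} (hP0 : 0 ≤ P) {T : ℝ} (hT : 0 < T) {J : ℕ}
    {δ : ℝ} (hδ : (2 ^ J * T)⁻¹ ≤ δ) :
    softThreshold (cfc (quadCut T) P) δ ≤ ∑ j ∈ Finset.range (J + 1),
      (4 * (2 ^ j)⁻¹ : ℝ) • softThreshold P (2 ^ (j + 1) * T)⁻¹ := by
  have hcont := continuous_quadCut hT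
  have hPs : IsSelfAdjoint P := .of_nonneg hP0
  rw [sum_smul_softThreshold hPs, softThreshold_eq_cfc IsSelfAdjoint.cfc,
    ← cfc_comp (fun x : ℝ => max (x - δ) 0) (quadCut T) P hPs (by fun_prop) hcont.continuousOn]
  refine cfc_mono (fun x hx => ?_) (by fun_prop) (by fun_prop)
  have hsum : 0 ≤ ∑ j ∈ Finset.range (J + 1),
      4 * (2 ^ j : ℝ)⁻¹ * max (x - (2 ^ (j + 1) * T)⁻¹) 0 :=
    Finset.sum_nonneg fun j _ => by positivity
  refine max_le ?_ hsum
  rcases le_total (2 ^ J * T)⁻¹ x with hJx | hJx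
  · exact (sub_le_self _ (le_trans (by positivity) hδ)).trans (quadCut_le_sum hT J hJx)
  · refine le_trans ?_ hsum
    linarith [quadCut_le_self hT (spectrum_nonneg_of_nonneg hP0 hx)]

namespace FNSTrace

variable {N : VonNeumannAlgebra H} {τ : FNSTrace N} {P S : H →L[ℂ] H}

variable (τ) in
theorem toFun_softThreshold_cfc_quadCut_le (hP : P ∈ N) (hP0 : 0 ≤ P) {T : ℝ} (hT : 0 < T) {J : ℕ}
    {δ : ℝ} (hδ : (2 ^ J * T)⁻¹ ≤ δ) :
    τ.toFun (softThreshold (cfc (quadCut T) P) δ) ≤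
      ∑ j ∈ Finset.range (J + 1), ENNReal.ofReal (4 * (2 ^ j)⁻¹) *
        τ.toFun (softThreshold P (2 ^ (j + 1) * T)⁻¹) :=
  (τ.toFun_mono (softThreshold_mem (cfc_mem hP _) _)
    (sum_mem fun j _ => real_smul_mem _ (softThreshold_mem hP _)) (softThreshold_nonneg _ _)
    (softThreshold_cfc_quadCut_le hP0 hT hδ)).trans_eq <|
    τ.toFun_sum_smul _ (fun j => by positivity) (fun j => softThreshold_mem hP _)
      fun j => softThreshold_nonneg _ _

theorem LogBounded.exists_toFun_quadCut_le (h : τ.LogBounded P) :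
    ∃ C : ℝ, 0 ≤ C ∧ ∀ T : ℝ, 0 < T →
      τ.toFun (cfc (quadCut T) P) ≤ ENNReal.ofReal (C * Real.log (2 + T)) := by
  obtain ⟨C, hC0, hC⟩ := h.bound
  refine ⟨24 * C, by positivity, fun T hT => ?_⟩
  have hlog := log_two_add_pos hT.le
  refine τ.toFun_le_of_forall_softThreshold_le (cfc_mem h.mem _)
    (cfc_nonneg fun x _ => quadCut_nonneg hT x) fun δ hδ => ?_
  obtain ⟨J, hJ⟩ := exists_norm_le_two_pow_mul (1 : ℝ) (mul_pos hT hδ)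
  have hJδ : (2 ^ J * T)⁻¹ ≤ δ := by
    rw [inv_le_iff_one_le_mul₀' (by positivity), mul_assoc]
    simpa only [norm_one] using hJ
  have hterm (j : ℕ) : ENNReal.ofReal (4 * (2 ^ j)⁻¹) *
      τ.toFun (softThreshold P (2 ^ (j + 1) * T)⁻¹) ≤
        ENNReal.ofReal (4 * C * Real.log (2 + T) * ((j + 2) * (2 ^ j)⁻¹)) := by
    calc ENNReal.ofReal (4 * (2 ^ j)⁻¹) * τ.toFun (softThreshold P (2 ^ (j + 1) * T)⁻¹)
        ≤ ENNReal.ofReal (4 * (2 ^ j)⁻¹) *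
            ENNReal.ofReal (C * (((j + 1 : ℕ) + 1) * Real.log (2 + T))) := by
          gcongr
          refine (hC _ (by positivity)).trans (ENNReal.ofReal_le_ofReal ?_)
          gcongr
          exact log_two_add_two_pow_mul_le hT.le (j + 1)
      _ = ENNReal.ofReal (4 * C * Real.log (2 + T) * ((j + 2) * (2 ^ j)⁻¹)) := by
          rw [← ENNReal.ofReal_mul (by positivity)]
          push_cast
          ring_nf
  calc τ.toFun (softThreshold (cfc (quadCut T) P) δ)
      ≤ ∑ j ∈ Finset.range (J + 1), ENNReal.ofReal (4 * (2 ^ j)⁻¹) *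
          τ.toFun (softThreshold P (2 ^ (j + 1) * T)⁻¹) :=
        τ.toFun_softThreshold_cfc_quadCut_le h.mem h.nonneg hT hJδ
    _ ≤ ∑ j ∈ Finset.range (J + 1),
          ENNReal.ofReal (4 * C * Real.log (2 + T) * ((j + 2) * (2 ^ j)⁻¹)) :=
        Finset.sum_le_sum fun j _ => hterm j
    _ = ENNReal.ofReal (4 * C * Real.log (2 + T) *
          (6 - 2 * ((J + 1 : ℕ) + 3) * (2 ^ (J + 1))⁻¹)) := by
        rw [← ENNReal.ofReal_sum_of_nonneg (fun j _ => by positivity), ← Finset.mul_sum,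
          sum_add_two_mul_inv_two_pow]
    _ ≤ ENNReal.ofReal (4 * C * Real.log (2 + T) * 6) := by
        gcongr
        exact sub_le_self _ (by positivity)
    _ = ENNReal.ofReal (24 * C * Real.log (2 + T)) := by ring_nf

variable (τ)

theorem toFun_conjugate_cfcHom_lt_top (hP : P ∈ N) (hPs : IsSelfAdjoint P) (hS : S ∈ N)
    (hS2 : τ.toFun (star S * S) < ∞) {g : C(spectrum ℝ P, ℝ)} (hg : 0 ≤ g) :
    τ.toFun (star S * cfcHom hPs g * S) < ∞ := by
  have hSS := mul_mem (star_mem hS) hS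
  have hle : star S * cfcHom hPs g * S ≤ ‖g‖ • (star S * S) := by
    have hg_le : cfcHom hPs g ≤ ‖g‖ • (1 : H →L[ℂ] H) := by
      have hg_norm : g ≤ ‖g‖ • (1 : C(spectrum ℝ P, ℝ)) := fun x => by
        simpa using (le_abs_self _).trans (g.norm_coe_le_norm x)
      simpa only [_root_.map_smul, map_one] using cfcHom_mono hPs hg_norm
    simpa only [mul_smul_comm, mul_one, smul_mul_assoc] using
      star_left_conjugate_le_conjugate hg_le S
  refine (τ.toFun_mono (mul_mem (mul_mem (star_mem hS) ?_) hS) (real_smul_mem _ hSS)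
    (star_left_conjugate_nonneg ((cfcHom_nonneg_iff hPs).2 hg) S) hle).trans_lt ?_
  · rw [cfcHom_eq_cfc_extend (R := ℝ) 0]
    exact cfc_mem hP _
  · rw [τ.map_smul _ (norm_nonneg _) _ hSS (star_mul_self_nonneg S)]
    exact ENNReal.mul_lt_top ENNReal.ofReal_lt_top hS2

open scoped CompactlySupported in
/-- The functional `h ↦ τ(S* h(P) S)` on the nonnegative continuous functions on the spectrum of
`P`, to which the Riesz representation theorem is applied. -/
def spectralFunctional (hP : P ∈ N) (hPs : IsSelfAdjoint P) (hS : S ∈ N)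
    (hS2 : τ.toFun (star S * S) < ∞) : C_c(spectrum ℝ P, NNReal) →ₗ[NNReal] NNReal where
  toFun h := (τ.toFun (star S * cfcHom hPs h.toReal.toContinuousMap * S)).toNNReal
  map_add' g h := by
    have hmem (k : C(spectrum ℝ P, ℝ)) : star S * cfcHom hPs k * S ∈ N := by
      rw [cfcHom_eq_cfc_extend (R := ℝ) 0]
      exact mul_mem (mul_mem (star_mem hS) (cfc_mem hP _)) hS
    have hnn (k : C_c(spectrum ℝ P, NNReal)) : 0 ≤ k.toReal.toContinuousMap :=
      fun x => by simp
    have hconj (k : C_c(spectrum ℝ P, NNReal)) :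
        0 ≤ star S * cfcHom hPs k.toReal.toContinuousMap * S :=
      star_left_conjugate_nonneg ((cfcHom_nonneg_iff hPs).2 (hnn k)) S
    have hadd : (g + h).toReal.toContinuousMap =
        g.toReal.toContinuousMap + h.toReal.toContinuousMap := by ext x; simp
    rw [hadd, _root_.map_add, mul_add, add_mul,
      τ.map_add _ (hmem _) _ (hmem _) (hconj g) (hconj h),
      ENNReal.toNNReal_add (τ.toFun_conjugate_cfcHom_lt_top hP hPs hS hS2 (hnn g)).ne
        (τ.toFun_conjugate_cfcHom_lt_top hP hPs hS hS2 (hnn h)).ne]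
  map_smul' c h := by
    have hsmul : (c • h).toReal.toContinuousMap = (c : ℝ) • h.toReal.toContinuousMap := by
      ext x
      simp [NNReal.smul_def]
    rw [hsmul, _root_.map_smul, mul_smul_comm, smul_mul_assoc,
      τ.map_smul _ c.coe_nonneg _ ?_ (star_left_conjugate_nonneg ((cfcHom_nonneg_iff hPs).2 ?_) S),
      ENNReal.toNNReal_mul, ENNReal.ofReal_coe_nnreal, ENNReal.toNNReal_coe]
    · rfl
    · rw [cfcHom_eq_cfc_extend (R := ℝ) 0]
      exact mul_mem (mul_mem (star_mem hS) (cfc_mem hP _)) hS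
    · exact fun x => by simp

theorem exists_spectralMeasure (hP : P ∈ N) (hP0 : 0 ≤ P) (hS : S ∈ N)
    (hS2 : τ.toFun (star S * S) < ∞) : ∃ m : Measure ℝ, IsFiniteMeasure m ∧ ∀ k : ℝ → ℝ,
      ContinuousOn k (Ici 0) → (∀ x, 0 ≤ x → 0 ≤ k x) →
        τ.toFun (star S * cfc k P * S) = ∫⁻ x, ENNReal.ofReal (k x) ∂m := by
  have hPs : IsSelfAdjoint P := .of_nonneg hP0
  have hsp (x : spectrum ℝ P) : 0 ≤ (x : ℝ) := spectrum_nonneg_of_nonneg hP0 x.2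
  have hmeas : MeasurableSet (spectrum ℝ P) :=
    (isCompact_iff_compactSpace.2 inferInstance : IsCompact (spectrum ℝ P)).measurableSet
  set L := τ.spectralFunctional hP hPs hS hS2
  refine ⟨(NNRealRMK.rieszMeasure L).map Subtype.val, inferInstance, fun k hk hk0 => ?_⟩
  have hkE : ContinuousOn k (spectrum ℝ P) := hk.mono fun x hx => hsp ⟨x, hx⟩
  let h : CompactlySupportedContinuousMap (spectrum ℝ P) NNReal :=
    ⟨⟨fun x => (k x).toNNReal, continuous_real_toNNReal.comp hkE.domRestrict⟩,
      .of_compactSpace _⟩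
  have hreal : h.toReal.toContinuousMap = ⟨_, hkE.domRestrict⟩ :=
    ContinuousMap.ext fun x => by
      simpa [h] using hk0 _ (hsp x)
  have hL : (L h : ℝ≥0∞) = τ.toFun (star S * cfcHom hPs ⟨_, hkE.domRestrict⟩ * S) := by
    rw [← hreal]
    exact ENNReal.coe_toNNReal
      (τ.toFun_conjugate_cfcHom_lt_top hP hPs hS hS2 fun x => by simp).ne
  rw [cfc_apply k P hPs hkE, (MeasurableEmbedding.subtype_coe hmeas).lintegral_map, ← hL,
    ← NNRealRMK.lintegral_rieszMeasure]
  rfl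

end FNSTrace

/-! ### Evaluation of generalised limits -/

theorem memLInfty_iff {u : ℝ → ℝ} : MemLInfty u ↔
    AEMeasurable u (volume.restrict (Ioi 0)) ∧ ∃ C : ℝ, ∀ t : ℝ, 0 < t → |u t| ≤ C := by
  rw [aemeasurable_restrict_iff_comap_subtype measurableSet_Ioi]
  refine and_congr Iff.rfl (exists_congr fun C => ?_)
  exact ⟨fun h t ht => h ⟨t, ht⟩, fun h t => h t t.2⟩

theorem memLInfty_of_measurable {u : ℝ → ℝ} (hu : Measurable u) {C : ℝ}
    (h : ∀ t : ℝ, 0 < t → |u t| ≤ C) : MemLInfty u :=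
  memLInfty_iff.2 ⟨hu.aemeasurable, C, h⟩

theorem memLInfty_const (c : ℝ) : MemLInfty fun _ => c :=
  memLInfty_of_measurable measurable_const fun _ _ => le_rfl

section EvalAt

variable {ω : LInfty →ₗ[ℝ] ℝ} {u v r : ℝ → ℝ}

theorem MemLInfty.add (hu : MemLInfty u) (hv : MemLInfty v) : MemLInfty fun t => u t + v t :=
  LInfty.add_mem hu hv

theorem MemLInfty.const_mul (hu : MemLInfty u) (c : ℝ) : MemLInfty fun t => c * u t :=
  LInfty.smul_mem c hu

theorem MemLInfty.congr (hu : MemLInfty u) (h : ∀ t, 0 < t → v t = u t) : MemLInfty v := by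
  have heq : (fun t : HalfLine => v t) = fun t : HalfLine => u t := funext fun t => h t t.2
  rwa [MemLInfty, heq]

theorem MemLInfty.mul (hu : MemLInfty u) (hv : MemLInfty v) : MemLInfty fun t => u t * v t := by
  obtain ⟨hum, C, hC⟩ := memLInfty_iff.1 hu
  obtain ⟨hvm, D, hD⟩ := memLInfty_iff.1 hv
  refine memLInfty_iff.2 ⟨hum.mul hvm, C * D, fun t ht => ?_⟩
  rw [abs_mul]
  exact mul_le_mul (hC t ht) (hD t ht) (abs_nonneg _) ((abs_nonneg _).trans (hC t ht))

theorem MemLInfty.max_zero (hu : MemLInfty u) : MemLInfty fun t => max (u t) 0 := by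
  obtain ⟨hum, C, hC⟩ := memLInfty_iff.1 hu
  refine memLInfty_iff.2 ⟨hum.max aemeasurable_const, C, fun t ht => ?_⟩
  rw [abs_of_nonneg (le_max_right _ _)]
  exact (max_le (le_abs_self _) (abs_nonneg _)).trans (hC t ht)

theorem MemLInfty.sum {ι : Type*} (s : Finset ι) {u : ι → ℝ → ℝ} (hu : ∀ i ∈ s, MemLInfty (u i)) :
    MemLInfty fun t => ∑ i ∈ s, u i t := by
  have h := LInfty.sum_mem (t := s) (f := fun i (t : HalfLine) => u i t) hu
  rwa [Finset.sum_fn] at h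

theorem MemLInfty.dilate (hu : MemLInfty u) {s : ℝ} (hs : 0 < s) : MemLInfty fun t => u (t / s) :=
  (dilation ⟨s, hs⟩ ⟨_, hu⟩).2

theorem MemLInfty.tendsto_mul_zero (hu : MemLInfty u) (hr : Tendsto r atTop (𝓝 0)) :
    Tendsto (fun t => u t * r t) atTop (𝓝 0) := by
  obtain ⟨-, C, hC⟩ := memLInfty_iff.1 hu
  refine isBoundedUnder_le_mul_tendsto_zero (isBoundedUnder_of_eventually_le (a := C) ?_) hr
  filter_upwards [eventually_gt_atTop 0] with t ht using hC t ht

theorem evalAt_of_mem (hu : MemLInfty u) : evalAt ω u = ω ⟨fun t : HalfLine => u t, hu⟩ := by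
  rw [evalAt, dif_pos hu]

theorem evalAt_congr (h : ∀ t, 0 < t → u t = v t) : evalAt ω u = evalAt ω v := by
  by_cases hu : MemLInfty u
  · rw [evalAt_of_mem hu, evalAt_of_mem (hu.congr fun t ht => (h t ht).symm)]
    congr 2
    exact funext fun t => h t t.2
  · rw [evalAt, evalAt, dif_neg hu, dif_neg fun hv : MemLInfty v => hu (hv.congr h)]

theorem evalAt_add (hu : MemLInfty u) (hv : MemLInfty v) :
    evalAt ω (fun t => u t + v t) = evalAt ω u + evalAt ω v := by
  rw [evalAt_of_mem hu, evalAt_of_mem hv, evalAt_of_mem (hu.add hv), ← map_add]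
  rfl

theorem evalAt_const_mul (hu : MemLInfty u) (c : ℝ) :
    evalAt ω (fun t => c * u t) = c * evalAt ω u := by
  rw [evalAt_of_mem hu, evalAt_of_mem (hu.const_mul c), ← smul_eq_mul c (ω _), ← map_smul]
  rfl

theorem evalAt_zero : evalAt ω (fun _ => 0) = 0 := by
  rw [evalAt_of_mem (memLInfty_const 0)]
  exact map_zero ω

theorem evalAt_sum {ι : Type*} (s : Finset ι) {u : ι → ℝ → ℝ} (hu : ∀ i ∈ s, MemLInfty (u i)) :
    evalAt ω (fun t => ∑ i ∈ s, u i t) = ∑ i ∈ s, evalAt ω (u i) := by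
  classical
  induction s using Finset.induction_on with
  | empty => simpa only [Finset.sum_empty] using evalAt_zero
  | insert i s hi ih =>
    have hs : ∀ j ∈ s, MemLInfty (u j) := fun j hj => hu j (Finset.mem_insert_of_mem hj)
    simp only [Finset.sum_insert hi]
    rw [evalAt_add (hu i (Finset.mem_insert_self i s)) (MemLInfty.sum s hs), ih hs]

theorem evalAt_dilate (hωd : IsDilationInvariant ω) (hu : MemLInfty u) {s : ℝ} (hs : 0 < s) :
    evalAt ω (fun t => u (t / s)) = evalAt ω u := by
  rw [evalAt_of_mem hu, evalAt_of_mem (hu.dilate hs)]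
  exact hωd ⟨s, hs⟩ ⟨_, hu⟩

variable (hω : IsGeneralisedLimit ω)
include hω

theorem evalAt_const (c : ℝ) : evalAt ω (fun _ => c) = c := by
  have hone : evalAt ω (fun _ => 1) = 1 := (evalAt_of_mem (memLInfty_const 1)).trans hω.one
  simpa only [mul_one, hone] using evalAt_const_mul (ω := ω) (memLInfty_const 1) c

theorem evalAt_eq_zero_of_tendsto (hu : MemLInfty u) (h : Tendsto u atTop (𝓝 0)) :
    evalAt ω u = 0 := by
  rw [evalAt_of_mem hu]
  exact hω.vanish _ (tendsto_comp_val_Ioi_atTop.2 h)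

theorem evalAt_eq_of_tendsto_sub (hu : MemLInfty u) (hv : MemLInfty v)
    (h : Tendsto (fun t => u t - v t) atTop (𝓝 0)) : evalAt ω u = evalAt ω v := by
  have h0 := evalAt_eq_zero_of_tendsto hω (hu.add (hv.const_mul (-1)))
    (h.congr fun t => by ring)
  rw [evalAt_add hu (hv.const_mul (-1)), evalAt_const_mul hv] at h0
  linarith

theorem evalAt_nonneg (hu : MemLInfty u) (h : ∀ᶠ t in atTop, 0 ≤ u t) : 0 ≤ evalAt ω u := by
  have hsub : Tendsto (fun t => u t - max (u t) 0) atTop (𝓝 0) := by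
    refine tendsto_const_nhds.congr' ?_
    filter_upwards [h] with t ht
    rw [max_eq_left ht, sub_self]
  rw [evalAt_eq_of_tendsto_sub hω hu hu.max_zero hsub, evalAt_of_mem hu.max_zero]
  exact hω.nonneg _ fun t => le_max_right _ _

theorem evalAt_mono (hu : MemLInfty u) (hv : MemLInfty v) (h : ∀ᶠ t in atTop, u t ≤ v t) :
    evalAt ω u ≤ evalAt ω v := by
  have h0 := evalAt_nonneg hω (hv.add (hu.const_mul (-1))) (h.mono fun t ht => by linarith)
  rw [evalAt_add hv (hu.const_mul (-1)), evalAt_const_mul hu] at h0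
  linarith

end EvalAt

/-! ### Limits normalised by the logarithm -/

/-- `Θ` is measurable on the half-line and `O(log (2 + T))`; the shift by `2` keeps the logarithm
bounded away from `0` on the whole half-line. -/
def LogGrowth (Θ : ℝ → ℝ) : Prop := MemLInfty fun T => Θ T / Real.log (2 + T)

/-- The generalised limit of `Θ(T) / log (2 + T)`. -/
def logLim (ω : LInfty →ₗ[ℝ] ℝ) (Θ : ℝ → ℝ) : ℝ := evalAt ω fun T => Θ T / Real.log (2 + T)

section LogLim

variable {ω : LInfty →ₗ[ℝ] ℝ} {Θ Ξ : ℝ → ℝ}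

theorem abs_div_log_two_add_le_iff {C T : ℝ} (hT : 0 < T) :
    |Θ T / Real.log (2 + T)| ≤ C ↔ |Θ T| ≤ C * Real.log (2 + T) := by
  have hlog := log_two_add_pos hT.le
  rw [abs_div, abs_of_pos hlog, div_le_iff₀ hlog]

theorem logGrowth_of_aemeasurable (h : AEMeasurable Θ (volume.restrict (Ioi 0))) {C : ℝ}
    (hC : ∀ T : ℝ, 0 < T → |Θ T| ≤ C * Real.log (2 + T)) : LogGrowth Θ :=
  memLInfty_iff.2 ⟨h.div (by fun_prop), C, fun T hT => (abs_div_log_two_add_le_iff hT).2 (hC T hT)⟩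

theorem LogGrowth.exists_bound (h : LogGrowth Θ) :
    ∃ C : ℝ, 0 ≤ C ∧ ∀ T : ℝ, 0 < T → |Θ T| ≤ C * Real.log (2 + T) := by
  obtain ⟨-, C, hC⟩ := memLInfty_iff.1 h
  exact ⟨C, (abs_nonneg _).trans (hC 1 one_pos), fun T hT =>
    (abs_div_log_two_add_le_iff hT).1 (hC T hT)⟩

theorem LogGrowth.aemeasurable (h : LogGrowth Θ) :
    AEMeasurable Θ (volume.restrict (Ioi 0)) := by
  have hlog : AEMeasurable (fun T => Real.log (2 + T)) (volume.restrict (Ioi 0)) := by fun_prop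
  refine ((memLInfty_iff.1 h).1.mul hlog).congr ?_
  filter_upwards [ae_restrict_mem measurableSet_Ioi] with T (hT : 0 < T)
  exact div_mul_cancel₀ _ (log_two_add_pos hT.le).ne'

theorem LogGrowth.add (hΘ : LogGrowth Θ) (hΞ : LogGrowth Ξ) : LogGrowth fun T => Θ T + Ξ T :=
  (MemLInfty.add hΘ hΞ).congr fun _ _ => add_div _ _ _

theorem LogGrowth.const_mul (hΘ : LogGrowth Θ) (c : ℝ) : LogGrowth fun T => c * Θ T :=
  (MemLInfty.const_mul hΘ c).congr fun _ _ => mul_div_assoc _ _ _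

theorem LogGrowth.sum {ι : Type*} (s : Finset ι) {Θ : ι → ℝ → ℝ} (h : ∀ i ∈ s, LogGrowth (Θ i)) :
    LogGrowth fun t => ∑ i ∈ s, Θ i t :=
  (MemLInfty.sum s h).congr fun _ _ => Finset.sum_div _ _ _

theorem LogGrowth.congr (hΘ : LogGrowth Θ) (h : ∀ T, 0 < T → Ξ T = Θ T) : LogGrowth Ξ :=
  MemLInfty.congr hΘ fun T hT => by rw [h T hT]

theorem logLim_congr (h : ∀ T, 0 < T → Θ T = Ξ T) : logLim ω Θ = logLim ω Ξ :=
  evalAt_congr fun T hT => by rw [h T hT]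

theorem logLim_add (hΘ : LogGrowth Θ) (hΞ : LogGrowth Ξ) :
    logLim ω (fun T => Θ T + Ξ T) = logLim ω Θ + logLim ω Ξ := by
  rw [logLim, logLim, logLim, ← evalAt_add hΘ hΞ]
  exact evalAt_congr fun _ _ => add_div _ _ _

theorem logLim_const_mul (hΘ : LogGrowth Θ) (c : ℝ) :
    logLim ω (fun T => c * Θ T) = c * logLim ω Θ := by
  rw [logLim, logLim, ← evalAt_const_mul hΘ]
  exact evalAt_congr fun _ _ => mul_div_assoc _ _ _

theorem logLim_sum {ι : Type*} (s : Finset ι) {Θ : ι → ℝ → ℝ} (h : ∀ i ∈ s, LogGrowth (Θ i)) :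
    logLim ω (fun t => ∑ i ∈ s, Θ i t) = ∑ i ∈ s, logLim ω (Θ i) := by
  simp only [logLim]
  rw [← evalAt_sum s h]
  exact evalAt_congr fun _ _ => Finset.sum_div _ _ _

theorem logLim_mono (hω : IsGeneralisedLimit ω) (hΘ : LogGrowth Θ) (hΞ : LogGrowth Ξ)
    (h : ∀ T, 0 < T → Θ T ≤ Ξ T) : logLim ω Θ ≤ logLim ω Ξ := by
  refine evalAt_mono hω hΘ hΞ ?_
  filter_upwards [eventually_gt_atTop 0] with T hT
  exact div_le_div_of_nonneg_right (h T hT) (log_two_add_pos hT.le).le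

theorem abs_logLim_le (hω : IsGeneralisedLimit ω) (hΘ : LogGrowth Θ) {C : ℝ}
    (h : ∀ T, 0 < T → |Θ T| ≤ C * Real.log (2 + T)) : |logLim ω Θ| ≤ C := by
  have hbound : ∀ᶠ T in atTop, |Θ T / Real.log (2 + T)| ≤ C := by
    filter_upwards [eventually_gt_atTop 0] with T hT
    exact (abs_div_log_two_add_le_iff hT).2 (h T hT)
  rw [abs_le]
  constructor
  · rw [← evalAt_const hω (-C)]
    exact evalAt_mono hω (memLInfty_const _) hΘ (hbound.mono fun T hT => (abs_le.1 hT).1)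
  · conv_rhs => rw [← evalAt_const hω C]
    exact evalAt_mono hω hΘ (memLInfty_const _) (hbound.mono fun T hT => (abs_le.1 hT).2)

theorem log_two_add_div_le {s T : ℝ} (hs : 0 < s) (hT : 0 ≤ T) :
    Real.log (2 + T / s) ≤ Real.log (1 + s⁻¹) + Real.log (2 + T) := by
  rw [← Real.log_mul (by positivity) (by positivity)]
  refine Real.log_le_log (by positivity) ?_
  have hs' := inv_pos.2 hs
  rw [div_eq_mul_inv]
  nlinarith

theorem abs_log_two_add_div_sub_le {s T : ℝ} (hs : 0 < s) (hT : 0 ≤ T) :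
    |Real.log (2 + T / s) - Real.log (2 + T)| ≤ Real.log (1 + s) + Real.log (1 + s⁻¹) := by
  have hle := log_two_add_div_le hs hT
  have hge := log_two_add_div_le (inv_pos.2 hs) (div_nonneg hT hs.le)
  rw [inv_inv, div_inv_eq_mul, div_mul_cancel₀ T hs.ne'] at hge
  have hs0 : 0 ≤ Real.log (1 + s) := Real.log_nonneg (by linarith)
  have hs1 : 0 ≤ Real.log (1 + s⁻¹) := Real.log_nonneg (by linarith [inv_pos.2 hs])
  exact abs_le.2 ⟨by linarith, by linarith⟩

theorem tendsto_log_two_add : Tendsto (fun T : ℝ => Real.log (2 + T)) atTop atTop :=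
  Real.tendsto_log_atTop.comp (tendsto_atTop_add_const_left _ _ tendsto_id)

theorem logGrowth_log_two_add_div {s : ℝ} (hs : 0 < s) :
    LogGrowth fun T => Real.log (2 + T / s) := by
  refine logGrowth_of_aemeasurable (C := Real.log (1 + s⁻¹) / Real.log 2 + 1) (by fun_prop)
    fun T hT => ?_
  have hs1 : 0 ≤ Real.log (1 + s⁻¹) := Real.log_nonneg (by linarith [inv_pos.2 hs])
  rw [abs_of_pos (log_two_add_pos (by positivity)), add_mul, one_mul]
  refine (log_two_add_div_le hs hT.le).trans ?_
  gcongr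
  calc Real.log (1 + s⁻¹) = Real.log (1 + s⁻¹) / Real.log 2 * Real.log 2 := by field_simp
    _ ≤ Real.log (1 + s⁻¹) / Real.log 2 * Real.log (2 + T) := by
      gcongr
      linarith

theorem tendsto_log_two_add_div_div_log {s : ℝ} (hs : 0 < s) :
    Tendsto (fun T => Real.log (2 + T / s) / Real.log (2 + T) - 1) atTop (𝓝 0) := by
  refine squeeze_zero_norm' ?_ (tendsto_const_nhds.div_atTop tendsto_log_two_add :
    Tendsto (fun T => (Real.log (1 + s) + Real.log (1 + s⁻¹)) / Real.log (2 + T)) atTop (𝓝 0))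
  filter_upwards [eventually_gt_atTop 0] with T hT
  have hlog := log_two_add_pos hT.le
  rw [div_sub_one hlog.ne', Real.norm_eq_abs, abs_div, abs_of_pos hlog]
  exact div_le_div_of_nonneg_right (abs_log_two_add_div_sub_le hs hT.le) hlog.le

theorem div_log_dilate_eq {s T : ℝ} (hs : 0 < s) (hT : 0 < T) :
    Θ (T / s) / Real.log (2 + T) =
      Θ (T / s) / Real.log (2 + T / s) * (Real.log (2 + T / s) / Real.log (2 + T)) := by
  rw [div_mul_div_cancel₀ (log_two_add_pos (by positivity)).ne']

theorem LogGrowth.dilate (hΘ : LogGrowth Θ) {s : ℝ} (hs : 0 < s) : LogGrowth fun T => Θ (T / s) :=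
  ((MemLInfty.dilate hΘ hs).mul (logGrowth_log_two_add_div hs)).congr fun _ hT =>
    div_log_dilate_eq hs hT

theorem logLim_dilate (hω : IsGeneralisedLimit ω) (hωd : IsDilationInvariant ω) (hΘ : LogGrowth Θ)
    {s : ℝ} (hs : 0 < s) : logLim ω (fun T => Θ (T / s)) = logLim ω Θ := by
  have hdil := MemLInfty.dilate hΘ hs
  calc logLim ω (fun T => Θ (T / s))
      = evalAt ω fun T => Θ (T / s) / Real.log (2 + T / s) := by
        refine evalAt_eq_of_tendsto_sub hω (hΘ.dilate hs) hdil ?_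
        refine (hdil.tendsto_mul_zero (tendsto_log_two_add_div_div_log hs)).congr' ?_
        filter_upwards [eventually_gt_atTop 0] with T hT
        rw [div_log_dilate_eq hs hT, mul_sub, mul_one]
    _ = logLim ω Θ := evalAt_dilate hωd hΘ hs

theorem tendsto_log_two_add_sub_log_div_log :
    Tendsto (fun T => (Real.log (2 + T) - Real.log T) / Real.log T) atTop (𝓝 0) := by
  refine squeeze_zero' ?_ ?_ (tendsto_const_nhds.div_atTop Real.tendsto_log_atTop :
    Tendsto (fun T => Real.log 3 / Real.log T) atTop (𝓝 0))
  · filter_upwards [eventually_gt_atTop 1] with T hT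
    exact div_nonneg (sub_nonneg.2 (Real.log_le_log (by positivity) (by linarith)))
      (Real.log_pos hT).le
  · filter_upwards [eventually_gt_atTop 1] with T hT
    have hlog : Real.log (2 + T) ≤ Real.log 3 + Real.log T := by
      rw [← Real.log_mul (by norm_num) (by positivity)]
      exact Real.log_le_log (by positivity) (by linarith)
    exact div_le_div_of_nonneg_right (sub_le_iff_le_add.2 hlog) (Real.log_pos hT).le

theorem evalAt_eq_logLim (hω : IsGeneralisedLimit ω) {u : ℝ → ℝ} (hu : MemLInfty u)
    (hΘ : LogGrowth Θ) {c : ℝ} (h : ∀ T : ℝ, 1 < T → u T = (Real.log T)⁻¹ * (Θ T + c)) :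
    evalAt ω u = logLim ω Θ := by
  refine evalAt_eq_of_tendsto_sub hω hu hΘ ?_
  have hlim := (MemLInfty.tendsto_mul_zero hΘ tendsto_log_two_add_sub_log_div_log).add
    (tendsto_const_nhds.div_atTop Real.tendsto_log_atTop :
      Tendsto (fun T => c / Real.log T) atTop (𝓝 0))
  rw [add_zero] at hlim
  refine hlim.congr' ?_
  filter_upwards [eventually_gt_atTop 1] with T hT
  have hlogT : Real.log T ≠ 0 := (Real.log_pos hT).ne'
  have hlog_ne : Real.log (2 + T) ≠ 0 := (log_two_add_pos (by linarith)).ne'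
  rw [h T hT]
  field_simp
  ring

end LogLim

/-! ### Dilated integrals against a measure of logarithmic growth -/

/-- The integral `∫ T η(T x) dm(x)`, through which the heat traces and the Dixmier functional are
expressed by spectral measures. -/
def dilIntegral (m : Measure ℝ) (η : ℝ → ℝ) (T : ℝ) : ℝ := ∫ x, T * η (T * x) ∂m

/-- The measure `m` satisfies `∫ min(T, 1/x) dm(x) = O(log (2 + T))`. This is what membership of an
operator in `𝓜_{1,∞}` says about its spectral measures. -/
def IsLogMeasure (m : Measure ℝ) : Prop :=
  ∃ D : ℝ, 0 ≤ D ∧ ∀ T : ℝ, 0 < T → ∫ x, (max x T⁻¹)⁻¹ ∂m ≤ D * Real.log (2 + T)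

/-- The profile `(y - 1)₊ / y²`, whose dilated integrals represent `τ(S* (P - 1/T)₊ S)`. -/
def refProfile (y : ℝ) : ℝ := max (y - 1) 0 * ((max y 1) ^ 2)⁻¹

/-- The mean `∫₀¹ k(u y) du` of the dilates of `k`, which the Cesàro operator produces. -/
def meanProfile (k : ℝ → ℝ) (y : ℝ) : ℝ := ∫ u in (0 : ℝ)..1, k (u * y)

/-- The Cesàro operator `M` on real functions. -/
def realCesaro (z : ℝ → ℝ) (T : ℝ) : ℝ := (Real.log T)⁻¹ * ∫ s in (1 : ℝ)..T, z s / s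

section Decay

variable {η : ℝ → ℝ} {C : ℝ}

theorem inv_max_one_le_one (y : ℝ) : (max y 1)⁻¹ ≤ 1 :=
  inv_le_one_of_one_le₀ (le_max_right _ _)

theorem inv_max_one_sq_le (y : ℝ) : ((max y 1) ^ 2)⁻¹ ≤ (max y 1)⁻¹ :=
  inv_anti₀ (by positivity) (le_self_pow₀ (le_max_right _ _) two_ne_zero)

theorem nonneg_of_abs_le_mul_inv (h : ∀ y, |η y| ≤ C * (max y 1)⁻¹) : 0 ≤ C := by
  simpa using (abs_nonneg _).trans (h 0)

theorem abs_le_of_abs_le_mul_inv (h : ∀ y, |η y| ≤ C * (max y 1)⁻¹) (y : ℝ) : |η y| ≤ C :=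
  (h y).trans (mul_le_of_le_one_right (nonneg_of_abs_le_mul_inv h) (inv_max_one_le_one y))

theorem abs_le_mul_inv_of_sq (h : ∀ y, |η y| ≤ C * ((max y 1) ^ 2)⁻¹) (y : ℝ) :
    |η y| ≤ C * (max y 1)⁻¹ := by
  have hC : 0 ≤ C := by simpa using (abs_nonneg _).trans (h 0)
  exact (h y).trans (mul_le_mul_of_nonneg_left (inv_max_one_sq_le y) hC)

theorem mul_inv_max_one {T : ℝ} (hT : 0 < T) (x : ℝ) :
    T * (max (T * x) 1)⁻¹ = (max x T⁻¹)⁻¹ := by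
  have hmax : max (T * x) 1 = T * max x T⁻¹ := by
    rw [mul_max_of_nonneg _ _ hT.le, mul_inv_cancel₀ hT.ne']
  rw [hmax, mul_inv, mul_inv_cancel_left₀ hT.ne']

theorem inv_mul_inv_max_sq_le {a : ℝ} (ha : 0 < a) (y : ℝ) :
    a⁻¹ * ((max (y / a) 1) ^ 2)⁻¹ ≤ 6 * ((max y 0 + a)⁻¹ - (max y 0 + 2 * a)⁻¹) := by
  set z := max y 0
  have hz : 0 ≤ z := le_max_right _ _
  set M := max z a with hM
  have hmax : max (y / a) 1 = M / a := by
    rw [hM, max_assoc, max_eq_right ha.le, ← max_div_div_right ha.le, div_self ha.ne']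
  have hza : (z + a) * (z + 2 * a) ≤ (2 * M) * (3 * M) := by
    gcongr <;> linarith [le_max_left z a, le_max_right z a]
  calc a⁻¹ * ((max (y / a) 1) ^ 2)⁻¹ = a / M ^ 2 := by
        rw [hmax]
        field_simp
    _ ≤ 6 * (a / ((z + a) * (z + 2 * a))) := by
        rw [mul_div_assoc', div_le_div_iff₀ (by positivity) (by positivity)]
        nlinarith
    _ = 6 * ((z + a)⁻¹ - (z + 2 * a)⁻¹) := by
        field_simp
        ring

theorem sum_dyadic_inv_max_sq_le (y : ℝ) (n : ℕ) :
    ∑ k ∈ Finset.range n, (2 ^ k : ℝ)⁻¹ * ((max (y / 2 ^ k) 1) ^ 2)⁻¹ ≤ 6 * (max y 1)⁻¹ := by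
  calc ∑ k ∈ Finset.range n, (2 ^ k : ℝ)⁻¹ * ((max (y / 2 ^ k) 1) ^ 2)⁻¹
      ≤ ∑ k ∈ Finset.range n, 6 * ((max y 0 + 2 ^ k)⁻¹ - (max y 0 + 2 ^ (k + 1))⁻¹) := by
        refine Finset.sum_le_sum fun k _ => ?_
        rw [pow_succ', ← pow_succ']
        simpa only [pow_succ'] using inv_mul_inv_max_sq_le (a := 2 ^ k) (by positivity) y
    _ = 6 * ((max y 0 + 2 ^ 0)⁻¹ - (max y 0 + 2 ^ n)⁻¹) := by
        rw [← Finset.mul_sum, Finset.sum_range_sub']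
    _ ≤ 6 * (max y 0 + 1)⁻¹ := by
        rw [pow_zero]
        gcongr
        exact sub_le_self _ (by positivity)
    _ ≤ 6 * (max y 1)⁻¹ := by
        gcongr
        exact max_le (by linarith [le_max_left y 0]) (by linarith [le_max_right y 0])

end Decay

section DilIntegral

variable {m : Measure ℝ} [IsFiniteMeasure m] {η : ℝ → ℝ} {C : ℝ}

theorem integrable_dil (hη : Continuous η) (hC : ∀ y, |η y| ≤ C) (T : ℝ) :
    Integrable (fun x => T * η (T * x)) m := by
  refine Integrable.of_bound (by fun_prop) (|T| * C) (Eventually.of_forall fun x => ?_)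
  rw [Real.norm_eq_abs, abs_mul]
  exact mul_le_mul_of_nonneg_left (hC _) (abs_nonneg _)

theorem measurable_dilIntegral (hη : Continuous η) : Measurable (dilIntegral m η) := by
  have h : StronglyMeasurable fun p : ℝ × ℝ => p.1 * η (p.1 * p.2) :=
    Continuous.stronglyMeasurable (by fun_prop)
  exact h.integral_prod_right'.measurable

theorem dilIntegral_add_const_mul {θ : ℝ → ℝ} {D : ℝ} (hη : Continuous η) (hθ : Continuous θ)
    (hC : ∀ y, |η y| ≤ C) (hD : ∀ y, |θ y| ≤ D) (c T : ℝ) :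
    dilIntegral m (fun y => η y + c * θ y) T = dilIntegral m η T + c * dilIntegral m θ T := by
  rw [dilIntegral, dilIntegral, dilIntegral, ← integral_const_mul,
    ← integral_add (integrable_dil hη hC T) ((integrable_dil hθ hD T).const_mul c)]
  simp only [mul_add, mul_left_comm T c]

theorem integrable_inv_max {T : ℝ} (hT : 0 < T) : Integrable (fun x => (max x T⁻¹)⁻¹) m := by
  refine Integrable.of_bound (continuous_inv_max hT).aestronglyMeasurable T
    (Eventually.of_forall fun x => ?_)
  rw [Real.norm_eq_abs, abs_of_pos (inv_pos.2 (max_inv_pos hT x))]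
  exact inv_le_of_inv_le₀ hT (le_max_right _ _)

theorem abs_integral_le_of_abs_le_inv_max {g : ℝ → ℝ} {T : ℝ} (hT : 0 < T)
    (hg : ∀ x, |g x| ≤ C * (max x T⁻¹)⁻¹) : |∫ x, g x ∂m| ≤ C * ∫ x, (max x T⁻¹)⁻¹ ∂m := by
  rw [← integral_const_mul, ← Real.norm_eq_abs]
  exact norm_integral_le_of_norm_le ((integrable_inv_max hT).const_mul C) (Eventually.of_forall hg)

theorem logGrowth_dilIntegral (hm : IsLogMeasure m) (hη : Continuous η)
    (hC : ∀ y, |η y| ≤ C * (max y 1)⁻¹) : LogGrowth (dilIntegral m η) := by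
  obtain ⟨D, -, hD⟩ := hm
  have hC0 := nonneg_of_abs_le_mul_inv hC
  refine logGrowth_of_aemeasurable (measurable_dilIntegral hη).aemeasurable (C := C * D)
    fun T hT => ?_
  calc |dilIntegral m η T| ≤ C * ∫ x, (max x T⁻¹)⁻¹ ∂m := by
        refine abs_integral_le_of_abs_le_inv_max hT fun x => ?_
        rw [abs_mul, abs_of_pos hT, ← mul_inv_max_one hT, mul_left_comm C]
        exact mul_le_mul_of_nonneg_left (hC _) hT.le
    _ ≤ C * D * Real.log (2 + T) := by
        rw [mul_assoc]
        gcongr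
        exact hD T hT

theorem abs_sum_dyadic_dil_le (hC : ∀ y, |η y| ≤ C * ((max y 1) ^ 2)⁻¹) {T : ℝ} (hT : 0 < T)
    (n : ℕ) (x : ℝ) : |∑ k ∈ Finset.range n, T / 2 ^ k * η (T / 2 ^ k * x)| ≤
      6 * C * (max x T⁻¹)⁻¹ := by
  have hC0 := nonneg_of_abs_le_mul_inv (abs_le_mul_inv_of_sq hC)
  calc |∑ k ∈ Finset.range n, T / 2 ^ k * η (T / 2 ^ k * x)|
      ≤ ∑ k ∈ Finset.range n, |T / 2 ^ k * η (T / 2 ^ k * x)| := Finset.abs_sum_le_sum_abs _ _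
    _ ≤ ∑ k ∈ Finset.range n, T * C * ((2 ^ k : ℝ)⁻¹ * ((max (T * x / 2 ^ k) 1) ^ 2)⁻¹) := by
        refine Finset.sum_le_sum fun k _ => ?_
        rw [abs_mul, abs_of_pos (by positivity), div_mul_eq_mul_div T _ x]
        refine (mul_le_mul_of_nonneg_left (hC _) (by positivity)).trans_eq ?_
        ring
    _ ≤ T * C * (6 * (max (T * x) 1)⁻¹) := by
        rw [← Finset.mul_sum]
        gcongr
        exact sum_dyadic_inv_max_sq_le _ n
    _ = 6 * C * (max x T⁻¹)⁻¹ := by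
        rw [← mul_inv_max_one hT]
        ring

variable {ω : LInfty →ₗ[ℝ] ℝ}

theorem abs_nat_mul_logLim_dilIntegral_le (hω : IsGeneralisedLimit ω)
    (hωd : IsDilationInvariant ω) (hη : Continuous η) (hC : ∀ y, |η y| ≤ C * ((max y 1) ^ 2)⁻¹)
    {D : ℝ} (hD0 : 0 ≤ D) (hD : ∀ T : ℝ, 0 < T → ∫ x, (max x T⁻¹)⁻¹ ∂m ≤ D * Real.log (2 + T))
    (n : ℕ) : |n * logLim ω (dilIntegral m η)| ≤ 6 * C * D := by
  have hC1 := abs_le_mul_inv_of_sq hC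
  have hC0 := nonneg_of_abs_le_mul_inv hC1
  have hgrowth := logGrowth_dilIntegral ⟨D, hD0, hD⟩ hη hC1
  have hdil (k : ℕ) (_ : k ∈ Finset.range n) : LogGrowth fun T => dilIntegral m η (T / 2 ^ k) :=
    hgrowth.dilate (by positivity)
  have hsum : n * logLim ω (dilIntegral m η) =
      logLim ω fun T => ∑ k ∈ Finset.range n, dilIntegral m η (T / 2 ^ k) := by
    rw [logLim_sum _ hdil, Finset.sum_congr rfl fun k _ =>
      logLim_dilate hω hωd hgrowth (by positivity : (0 : ℝ) < 2 ^ k)]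
    simp only [Finset.sum_const, Finset.card_range, nsmul_eq_mul]
  rw [hsum]
  refine abs_logLim_le hω (LogGrowth.sum _ hdil) fun T hT => ?_
  calc |∑ k ∈ Finset.range n, dilIntegral m η (T / 2 ^ k)|
      = |∫ x, ∑ k ∈ Finset.range n, T / 2 ^ k * η (T / 2 ^ k * x) ∂m| := by
        rw [integral_finsetSum _ fun k _ => integrable_dil hη (abs_le_of_abs_le_mul_inv hC1) _]
        rfl
    _ ≤ 6 * C * ∫ x, (max x T⁻¹)⁻¹ ∂m :=
        abs_integral_le_of_abs_le_inv_max hT (abs_sum_dyadic_dil_le hC hT n)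
    _ ≤ 6 * C * D * Real.log (2 + T) := by
        rw [mul_assoc _ D]
        gcongr
        exact hD T hT

theorem logLim_dilIntegral_eq_zero (hω : IsGeneralisedLimit ω) (hωd : IsDilationInvariant ω)
    (hm : IsLogMeasure m) (hη : Continuous η) (hC : ∀ y, |η y| ≤ C * ((max y 1) ^ 2)⁻¹) :
    logLim ω (dilIntegral m η) = 0 := by
  obtain ⟨D, hD0, hD⟩ := hm
  by_contra hne
  have hpos := abs_pos.2 hne
  obtain ⟨n, hn⟩ := exists_nat_gt (6 * C * D / |logLim ω (dilIntegral m η)|)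
  have hle := abs_nat_mul_logLim_dilIntegral_le hω hωd hη hC hD0 hD n
  rw [div_lt_iff₀ hpos] at hn
  rw [abs_mul, Nat.abs_cast] at hle
  linarith

end DilIntegral

section RefProfile

theorem continuous_refProfile : Continuous refProfile :=
  Continuous.mul (by fun_prop) (Continuous.inv₀ (by fun_prop) fun y => by positivity)

theorem refProfile_nonneg (y : ℝ) : 0 ≤ refProfile y := by
  rw [refProfile]
  positivity

theorem refProfile_of_le {y : ℝ} (h : y ≤ 1) : refProfile y = 0 := by
  rw [refProfile, max_eq_right (by linarith), zero_mul]

theorem refProfile_of_ge {y : ℝ} (h : 1 ≤ y) : refProfile y = (y - 1) / y ^ 2 := by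
  rw [refProfile, max_eq_left (by linarith), max_eq_left h, div_eq_mul_inv]

theorem abs_refProfile_le (y : ℝ) : |refProfile y| ≤ 1 * (max y 1)⁻¹ := by
  rw [abs_of_nonneg (refProfile_nonneg y), refProfile, sq, mul_inv, ← mul_assoc]
  gcongr
  rw [← div_eq_mul_inv, div_le_one (by positivity)]
  exact max_le (by linarith [le_max_left y 1]) (by positivity)

end RefProfile

section MeanProfile

variable {k : ℝ → ℝ} {C : ℝ}

theorem continuous_meanProfile (hk : Continuous k) : Continuous (meanProfile k) :=
  intervalIntegral.continuous_parametric_intervalIntegral_of_continuous'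
    (f := fun y u => k (u * y)) (by fun_prop) 0 1

theorem mul_meanProfile (k : ℝ → ℝ) (y : ℝ) : y * meanProfile k y = ∫ u in (0 : ℝ)..y, k u := by
  rw [meanProfile, intervalIntegral.mul_integral_comp_mul_right, zero_mul, one_mul]

theorem mul_meanProfile_mul (k : ℝ → ℝ) (T x : ℝ) :
    T * meanProfile k (T * x) = ∫ s in (0 : ℝ)..T, k (s * x) := by
  have h := mul_meanProfile (fun s => k (s * x)) T
  simpa only [meanProfile, mul_assoc] using h

theorem abs_meanProfile_le (hC : ∀ y, |k y| ≤ C) (y : ℝ) : |meanProfile k y| ≤ C := by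
  simpa [meanProfile] using intervalIntegral.norm_integral_le_of_norm_le_const (a := 0) (b := 1)
    (f := fun u => k (u * y)) fun u _ => hC _

section SquareDecay

variable (hk : Continuous k) (hC : ∀ y, |k y| ≤ C * ((max y 1) ^ 2)⁻¹)
include hC

theorem ae_norm_le_mul_rpow {y : ℝ} (hy : 1 ≤ y) :
    ∀ᵐ u ∂volume.restrict (Ioi y), ‖k u‖ ≤ C * u ^ (-2 : ℝ) := by
  filter_upwards [ae_restrict_mem measurableSet_Ioi] with u (hu : y < u)
  have hu1 : 1 ≤ u := hy.trans hu.le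
  simpa [max_eq_left hu1, Real.rpow_neg (zero_le_one.trans hu1)] using hC u

theorem abs_integral_Ioi_le_div {y : ℝ} (hy : 1 ≤ y) : |∫ u in Ioi y, k u| ≤ C / y := by
  have hy0 : 0 < y := one_pos.trans_le hy
  have h_int := (integrableOn_Ioi_rpow_of_lt (by norm_num : (-2 : ℝ) < -1) hy0).const_mul C
  refine (norm_integral_le_of_norm_le h_int (ae_norm_le_mul_rpow hC hy)).trans_eq ?_
  rw [integral_const_mul, integral_Ioi_rpow_of_lt (by norm_num) hy0,
    show (-2 + 1 : ℝ) = -1 by norm_num, Real.rpow_neg_one]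
  ring

include hk

theorem integrableOn_Ioi_of_one_le {y : ℝ} (hy : 1 ≤ y) : IntegrableOn k (Ioi y) :=
  ((integrableOn_Ioi_rpow_of_lt (by norm_num : (-2 : ℝ) < -1) (one_pos.trans_le hy)).const_mul
    C).mono' hk.aestronglyMeasurable (ae_norm_le_mul_rpow hC hy)

theorem integrableOn_Ioi_zero : IntegrableOn k (Ioi 0) := by
  rw [← Ioc_union_Ioi_eq_Ioi zero_le_one]
  exact hk.integrableOn_Ioc.union (integrableOn_Ioi_of_one_le hk hC le_rfl)

theorem abs_mul_meanProfile_sub_le {y : ℝ} (hy : 1 ≤ y) :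
    |y * meanProfile k y - ∫ u in Ioi (0 : ℝ), k u| ≤ C / y := by
  rw [mul_meanProfile, ← intervalIntegral.integral_interval_add_Ioi
    (integrableOn_Ioi_zero hk hC) (integrableOn_Ioi_of_one_le hk hC hy), sub_add_cancel_left,
    abs_neg]
  exact abs_integral_Ioi_le_div hC hy

theorem abs_integral_Ioi_zero_le : |∫ u in Ioi (0 : ℝ), k u| ≤ 2 * C := by
  have hsub := abs_mul_meanProfile_sub_le hk hC le_rfl
  have hmean := abs_meanProfile_le (abs_le_of_abs_le_mul_inv (abs_le_mul_inv_of_sq hC)) 1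
  rw [one_mul, div_one] at hsub
  rw [abs_le] at *
  constructor <;> linarith

theorem abs_meanProfile_le_mul_inv (y : ℝ) : |meanProfile k y| ≤ 3 * C * (max y 1)⁻¹ := by
  have hC1 := abs_le_mul_inv_of_sq hC
  have hC0 := nonneg_of_abs_le_mul_inv hC1
  rcases le_total y 1 with hy | hy
  · rw [max_eq_right hy, inv_one, mul_one]
    linarith [abs_meanProfile_le (abs_le_of_abs_le_mul_inv hC1) y]
  · have hy0 : 0 < y := one_pos.trans_le hy
    rw [max_eq_left hy, ← div_eq_mul_inv, le_div_iff₀' hy0]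
    calc y * |meanProfile k y| = |y * meanProfile k y| := by rw [abs_mul, abs_of_pos hy0]
      _ ≤ |y * meanProfile k y - ∫ u in Ioi (0 : ℝ), k u| + |∫ u in Ioi (0 : ℝ), k u| := by
        simpa only [sub_add_cancel] using
          abs_add_le (y * meanProfile k y - ∫ u in Ioi (0 : ℝ), k u) (∫ u in Ioi (0 : ℝ), k u)
      _ ≤ C / y + 2 * C :=
        add_le_add (abs_mul_meanProfile_sub_le hk hC hy) (abs_integral_Ioi_zero_le hk hC)
      _ ≤ 3 * C := by linarith [div_le_self hC0 hy]

theorem abs_meanProfile_sub_refProfile_le (y : ℝ) :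
    |meanProfile k y + -(∫ u in Ioi (0 : ℝ), k u) * refProfile y| ≤
      3 * C * ((max y 1) ^ 2)⁻¹ := by
  have hC1 := abs_le_mul_inv_of_sq hC
  have hC0 := nonneg_of_abs_le_mul_inv hC1
  rcases le_total y 1 with hy | hy
  · rw [refProfile_of_le hy, mul_zero, add_zero, max_eq_right hy, one_pow, inv_one, mul_one]
    linarith [abs_meanProfile_le (abs_le_of_abs_le_mul_inv hC1) y]
  · have hy0 : 0 < y := one_pos.trans_le hy
    set c := ∫ u in Ioi (0 : ℝ), k u
    have hsub := abs_mul_meanProfile_sub_le hk hC hy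
    rw [le_div_iff₀ hy0] at hsub
    calc |meanProfile k y + -c * refProfile y|
        = |(y * meanProfile k y - c) * y + c| / y ^ 2 := by
          rw [refProfile_of_ge hy, ← abs_of_pos (sq_pos_of_pos hy0), ← abs_div,
            abs_of_pos (sq_pos_of_pos hy0)]
          congr 1
          field_simp
          ring
      _ ≤ 3 * C / y ^ 2 := by
          gcongr
          refine (abs_add_le _ _).trans ?_
          rw [abs_mul, abs_of_pos hy0]
          linarith [abs_integral_Ioi_zero_le hk hC]
      _ = 3 * C * ((max y 1) ^ 2)⁻¹ := by rw [max_eq_left hy, div_eq_mul_inv]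

theorem logLim_dilIntegral_meanProfile {m : Measure ℝ} [IsFiniteMeasure m]
    {ω : LInfty →ₗ[ℝ] ℝ} (hω : IsGeneralisedLimit ω) (hωd : IsDilationInvariant ω)
    (hm : IsLogMeasure m) : logLim ω (dilIntegral m (meanProfile k)) =
      (∫ u in Ioi (0 : ℝ), k u) * logLim ω (dilIntegral m refProfile) := by
  have hmean := abs_meanProfile_le_mul_inv hk hC
  have hcm := continuous_meanProfile hk
  have hgrowth := logGrowth_dilIntegral hm hcm hmean
  have hgrowth_ref := logGrowth_dilIntegral hm continuous_refProfile abs_refProfile_le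
  have hzero : logLim ω (dilIntegral m fun y =>
      meanProfile k y + -(∫ u in Ioi (0 : ℝ), k u) * refProfile y) = 0 :=
    logLim_dilIntegral_eq_zero hω hωd hm (hcm.add (continuous_const.mul continuous_refProfile))
      (abs_meanProfile_sub_refProfile_le hk hC)
  rw [logLim_congr fun T _ => dilIntegral_add_const_mul hcm continuous_refProfile
    (abs_le_of_abs_le_mul_inv hmean) (abs_le_of_abs_le_mul_inv abs_refProfile_le) _ T,
    logLim_add hgrowth (hgrowth_ref.const_mul _), logLim_const_mul hgrowth_ref] at hzero
  linarith

end SquareDecay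

end MeanProfile

/-! ### Cesàro means of dilated integrals -/

section RealCesaro

variable {z Θ : ℝ → ℝ} {c K : ℝ}

theorem abs_sub_one_le_two_mul_abs_log {T : ℝ} (hT : 0 < T) (hT2 : T ≤ 2) :
    |T - 1| ≤ 2 * |Real.log T| := by
  rcases le_total T 1 with h | h
  · have hlog := Real.log_le_sub_one_of_pos hT
    rw [abs_of_nonpos (by linarith), abs_of_nonpos (by linarith)]
    linarith
  · have hlog : (T - 1) / 2 ≤ Real.log T :=
      calc (T - 1) / 2 ≤ (T - 1) / T := div_le_div_of_nonneg_left (by linarith) hT hT2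
        _ = 1 - T⁻¹ := by rw [sub_div, div_self hT.ne', one_div]
        _ ≤ Real.log T := Real.one_sub_inv_le_log_of_pos hT
    rw [abs_of_nonneg (by linarith), abs_of_nonneg (by linarith)]
    linarith

theorem abs_realCesaro_le_of_le_two (hz : ∀ s : ℝ, 0 < s → |z s| ≤ K * s) {T : ℝ} (hT : 0 < T)
    (hT2 : T ≤ 2) : |realCesaro z T| ≤ 2 * K := by
  have hK : 0 ≤ K := by simpa using (abs_nonneg _).trans (hz 1 one_pos)
  have h_int : |∫ s in (1 : ℝ)..T, z s / s| ≤ K * |T - 1| := by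
    rw [← Real.norm_eq_abs]
    refine intervalIntegral.norm_integral_le_of_norm_le_const fun s hs => ?_
    have hs0 : 0 < s := (le_min zero_le_one hT.le).trans_lt hs.1
    rw [Real.norm_eq_abs, abs_div, abs_of_pos hs0, div_le_iff₀ hs0]
    exact hz s hs0
  rw [realCesaro, abs_mul, abs_inv]
  refine inv_mul_le_of_le_mul₀ (abs_nonneg _) (by positivity) (h_int.trans ?_)
  calc K * |T - 1| ≤ K * (2 * |Real.log T|) := by
        gcongr
        exact abs_sub_one_le_two_mul_abs_log hT hT2
    _ = |Real.log T| * (2 * K) := by ring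

theorem abs_inv_log_mul_le {E T : ℝ} (hT : 2 ≤ T) (hE : 0 ≤ E)
    (hΘ : |Θ T| ≤ E * Real.log (2 + T)) :
    |(Real.log T)⁻¹ * (Θ T + c)| ≤ 2 * E + |c| / Real.log 2 := by
  have hlog2 : 0 < Real.log 2 := Real.log_pos one_lt_two
  have hlogT : Real.log 2 ≤ Real.log T := Real.log_le_log two_pos hT
  have hlog : Real.log (2 + T) ≤ 2 * Real.log T := by
    have h := Real.log_le_log (by linarith : 0 < 2 + T) (by nlinarith : 2 + T ≤ T ^ 2)
    rwa [Real.log_pow, Nat.cast_two] at h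
  rw [abs_mul, abs_inv, abs_of_pos (hlog2.trans_le hlogT), inv_mul_le_iff₀ (hlog2.trans_le hlogT)]
  calc |Θ T + c| ≤ |Θ T| + |c| := abs_add_le _ _
    _ ≤ E * (2 * Real.log T) + Real.log T * (|c| / Real.log 2) := by
        gcongr
        · exact hΘ.trans (mul_le_mul_of_nonneg_left hlog hE)
        · rw [mul_div_assoc', le_div_iff₀ hlog2, mul_comm]
          gcongr
    _ = Real.log T * (2 * E + |c| / Real.log 2) := by ring

theorem memLInfty_realCesaro (hz : ∀ s : ℝ, 0 < s → |z s| ≤ K * s) (hΘ : LogGrowth Θ)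
    (h : ∀ T : ℝ, 0 < T → ∫ s in (1 : ℝ)..T, z s / s = Θ T + c) : MemLInfty (realCesaro z) := by
  obtain ⟨E, hE0, hE⟩ := hΘ.exists_bound
  have hform (T : ℝ) (hT : 0 < T) : realCesaro z T = (Real.log T)⁻¹ * (Θ T + c) := by
    rw [realCesaro, h T hT]
  refine memLInfty_iff.2 ⟨?_, max (2 * K) (2 * E + |c| / Real.log 2), fun T hT => ?_⟩
  · refine (Real.measurable_log.inv.aemeasurable.mul (hΘ.aemeasurable.add_const c)).congr ?_
    filter_upwards [ae_restrict_mem measurableSet_Ioi] with T hT using (hform T hT).symm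
  · rcases le_total T 2 with hT2 | hT2
    · exact (abs_realCesaro_le_of_le_two hz hT hT2).trans (le_max_left _ _)
    · rw [hform T hT]
      exact (abs_inv_log_mul_le hT2 hE0 (hE T hT)).trans (le_max_right _ _)

variable {m : Measure ℝ} [IsFiniteMeasure m] {k : ℝ → ℝ} {C : ℝ}

theorem abs_dilIntegral_le_mul (hC : ∀ y, |k y| ≤ C) (s : ℝ) :
    |dilIntegral m k s| ≤ C * m.real univ * |s| := by
  rw [dilIntegral, integral_const_mul, abs_mul, mul_comm]
  gcongr
  rw [← Real.norm_eq_abs]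
  exact norm_integral_le_of_norm_le_const (Eventually.of_forall fun x => by
    simpa only [Real.norm_eq_abs] using hC (s * x))

theorem locallyIntegrable_dilIntegral (hk : Continuous k) (hC : ∀ y, |k y| ≤ C) :
    LocallyIntegrable (dilIntegral m k) volume := by
  have hbound : LocallyIntegrable (fun s : ℝ => C * m.real univ * |s|) volume :=
    Continuous.locallyIntegrable (by fun_prop)
  exact hbound.mono (measurable_dilIntegral hk).aestronglyMeasurable
    (Eventually.of_forall fun s => (abs_dilIntegral_le_mul hC s).trans (le_abs_self _))

theorem integral_dilIntegral_div (hk : Continuous k) (hC : ∀ y, |k y| ≤ C) {T : ℝ} (hT : 0 < T) :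
    ∫ s in (1 : ℝ)..T, dilIntegral m k s / s =
      dilIntegral m (meanProfile k) T + -dilIntegral m (meanProfile k) 1 := by
  have hmean := abs_meanProfile_le hC
  have hinner (x : ℝ) : ∫ s in (1 : ℝ)..T, k (s * x) =
      T * meanProfile k (T * x) - 1 * meanProfile k (1 * x) := by
    rw [mul_meanProfile_mul, mul_meanProfile_mul, intervalIntegral.integral_interval_sub_left] <;>
    exact Continuous.intervalIntegrable (by fun_prop) _ _
  have h_int : Integrable (Function.uncurry fun s x => k (s * x))
      ((volume.restrict (uIoc 1 T)).prod m) := by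
    have : IsFiniteMeasure (volume.restrict (uIoc 1 T)) := by
      rw [uIoc]
      infer_instance
    exact Integrable.of_bound (Continuous.aestronglyMeasurable (by fun_prop)) C
      (Eventually.of_forall fun p => hC _)
  calc ∫ s in (1 : ℝ)..T, dilIntegral m k s / s
      = ∫ s in (1 : ℝ)..T, ∫ x, k (s * x) ∂m := by
        refine intervalIntegral.integral_congr fun s hs => ?_
        have hs0 : s ≠ 0 := ((lt_min one_pos hT).trans_le hs.1).ne'
        simp only [dilIntegral, integral_const_mul]
        rw [mul_div_cancel_left₀ _ hs0]
    _ = ∫ x, (∫ s in (1 : ℝ)..T, k (s * x)) ∂m := intervalIntegral_integral_swap h_int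
    _ = dilIntegral m (meanProfile k) T + -dilIntegral m (meanProfile k) 1 := by
        simp only [hinner]
        rw [integral_sub (integrable_dil (continuous_meanProfile hk) hmean T)
          (integrable_dil (continuous_meanProfile hk) hmean 1), sub_eq_add_neg]
        rfl

theorem memLInfty_realCesaro_dilIntegral (hm : IsLogMeasure m) (hk : Continuous k)
    (hC : ∀ y, |k y| ≤ C * ((max y 1) ^ 2)⁻¹) : MemLInfty (realCesaro (dilIntegral m k)) := by
  have hCb := abs_le_of_abs_le_mul_inv (abs_le_mul_inv_of_sq hC)
  refine memLInfty_realCesaro (K := C * m.real univ) (fun s hs => ?_)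
    (logGrowth_dilIntegral hm (continuous_meanProfile hk) (abs_meanProfile_le_mul_inv hk hC))
    fun T hT => integral_dilIntegral_div hk hCb hT
  simpa only [abs_of_pos hs] using abs_dilIntegral_le_mul hCb s

theorem evalAt_realCesaro_dilIntegral {ω : LInfty →ₗ[ℝ] ℝ} (hω : IsGeneralisedLimit ω)
    (hωd : IsDilationInvariant ω) (hm : IsLogMeasure m) (hk : Continuous k)
    (hC : ∀ y, |k y| ≤ C * ((max y 1) ^ 2)⁻¹) : evalAt ω (realCesaro (dilIntegral m k)) =
      (∫ u in Ioi (0 : ℝ), k u) * logLim ω (dilIntegral m refProfile) := by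
  rw [← logLim_dilIntegral_meanProfile hk hC hω hωd hm]
  refine evalAt_eq_logLim hω (memLInfty_realCesaro_dilIntegral hm hk hC)
    (logGrowth_dilIntegral hm (continuous_meanProfile hk) (abs_meanProfile_le_mul_inv hk hC))
    (c := -dilIntegral m (meanProfile k) 1) fun T hT => ?_
  rw [realCesaro, integral_dilIntegral_div hk
    (abs_le_of_abs_le_mul_inv (abs_le_mul_inv_of_sq hC)) (one_pos.trans hT)]

end RealCesaro

/-! ### Linear extension of additive functionals on hereditary cones -/

/-- An additive and positively homogeneous functional on a hereditary cone of positive operators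
of `N`. The trace and the Dixmier functional are both of this kind. -/
structure ConeFunctional (N : VonNeumannAlgebra H) where
  cone : Set (H →L[ℂ] H)
  toFun : (H →L[ℂ] H) → ℝ
  mem : ∀ P ∈ cone, P ∈ N
  nonneg : ∀ P ∈ cone, 0 ≤ P
  zero_mem : 0 ∈ cone
  add_mem : ∀ P ∈ cone, ∀ Q ∈ cone, P + Q ∈ cone
  smul_mem : ∀ c : ℝ, 0 ≤ c → ∀ P ∈ cone, c • P ∈ cone
  posPart_mem : ∀ Y ∈ cone, ∀ X ∈ N, IsSelfAdjoint X → X ≤ Y → X⁺ ∈ cone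
  map_add : ∀ P ∈ cone, ∀ Q ∈ cone, toFun (P + Q) = toFun P + toFun Q
  map_smul : ∀ c : ℝ, 0 ≤ c → ∀ P ∈ cone, toFun (c • P) = c * toFun P

namespace ConeFunctional

variable {N : VonNeumannAlgebra H} (Φ : ConeFunctional N) {X Y P Q : H →L[ℂ] H} {v w : ℂ}

theorem map_zero : Φ.toFun 0 = 0 := by
  simpa using Φ.map_smul 0 le_rfl 0 Φ.zero_mem

theorem isSelfAdjoint_sub (hP : P ∈ Φ.cone) (hQ : Q ∈ Φ.cone) : IsSelfAdjoint (P - Q) :=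
  (IsSelfAdjoint.of_nonneg (Φ.nonneg P hP)).sub (.of_nonneg (Φ.nonneg Q hQ))

theorem posPart_sub_mem (hP : P ∈ Φ.cone) (hQ : Q ∈ Φ.cone) : (P - Q)⁺ ∈ Φ.cone :=
  Φ.posPart_mem P hP _ (sub_mem (Φ.mem P hP) (Φ.mem Q hQ)) (Φ.isSelfAdjoint_sub hP hQ)
    (sub_le_self _ (Φ.nonneg Q hQ))

theorem toFun_posPart_sub_toFun_negPart (hP : P ∈ Φ.cone) (hQ : Q ∈ Φ.cone) :
    Φ.toFun (P - Q)⁺ - Φ.toFun (P - Q)⁻ = Φ.toFun P - Φ.toFun Q := by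
  have hpos := Φ.posPart_sub_mem hP hQ
  have hneg : (P - Q)⁻ ∈ Φ.cone := by
    rw [← CFC.posPart_neg, neg_sub]
    exact Φ.posPart_sub_mem hQ hP
  have hsum : (P - Q)⁺ + Q = P + (P - Q)⁻ := by
    rw [← sub_eq_sub_iff_add_eq_add, CFC.posPart_sub_negPart _ (Φ.isSelfAdjoint_sub hP hQ)]
  have hfun := congrArg Φ.toFun hsum
  rw [Φ.map_add _ hpos _ hQ, Φ.map_add _ hP _ hneg] at hfun
  linarith

/-- `X` is a combination `P - Q + i (R - S)` of elements of the cone on which the linear extension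
of the functional gives `v`. Stated as a relation, because the value is independent of the
combination only by `HasValue.jordanExtend_eq`. -/
def HasValue (X : H →L[ℂ] H) (v : ℂ) : Prop :=
  ∃ P ∈ Φ.cone, ∃ Q ∈ Φ.cone, ∃ R ∈ Φ.cone, ∃ S ∈ Φ.cone,
    X = (P - Q) + Complex.I • (R - S) ∧
    v = (Φ.toFun P - Φ.toFun Q) + Complex.I * (Φ.toFun R - Φ.toFun S)

variable {Φ}

theorem hasValue_of_mem (hP : P ∈ Φ.cone) : Φ.HasValue P (Φ.toFun P) :=
  ⟨P, hP, 0, Φ.zero_mem, 0, Φ.zero_mem, 0, Φ.zero_mem, by simp, by simp [Φ.map_zero]⟩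

namespace HasValue

theorem jordanExtend_eq (h : Φ.HasValue X v) :
    jordanExtend (fun P => (Φ.toFun P : ℂ)) X = v := by
  obtain ⟨P, hP, Q, hQ, R, hR, S, hS, rfl, rfl⟩ := h
  have hPQ := Φ.isSelfAdjoint_sub hP hQ
  have hRS := Φ.isSelfAdjoint_sub hR hS
  have hre : (ℜ (P - Q + Complex.I • (R - S)) : H →L[ℂ] H) = P - Q := by
    rw [_root_.map_add, realPart_I_smul, AddSubgroup.coe_add, hPQ.coe_realPart,
      hRS.imaginaryPart, neg_zero, ZeroMemClass.coe_zero, add_zero]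
  have him : (ℑ (P - Q + Complex.I • (R - S)) : H →L[ℂ] H) = R - S := by
    rw [_root_.map_add, imaginaryPart_I_smul, AddSubgroup.coe_add, hRS.coe_realPart,
      hPQ.imaginaryPart, ZeroMemClass.coe_zero, zero_add]
  simp only [jordanExtend, hre, him, ← Complex.ofReal_sub,
    Φ.toFun_posPart_sub_toFun_negPart hP hQ, Φ.toFun_posPart_sub_toFun_negPart hR hS]

theorem zero : Φ.HasValue 0 0 := by
  simpa only [Φ.map_zero, Complex.ofReal_zero] using hasValue_of_mem Φ.zero_mem

theorem add (hX : Φ.HasValue X v) (hY : Φ.HasValue Y w) : Φ.HasValue (X + Y) (v + w) := by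
  obtain ⟨P, hP, Q, hQ, R, hR, S, hS, rfl, rfl⟩ := hX
  obtain ⟨P', hP', Q', hQ', R', hR', S', hS', rfl, rfl⟩ := hY
  refine ⟨P + P', Φ.add_mem _ hP _ hP', Q + Q', Φ.add_mem _ hQ _ hQ', R + R',
    Φ.add_mem _ hR _ hR', S + S', Φ.add_mem _ hS _ hS', by module, ?_⟩
  rw [Φ.map_add _ hP _ hP', Φ.map_add _ hQ _ hQ', Φ.map_add _ hR _ hR', Φ.map_add _ hS _ hS']
  push_cast
  ring

theorem neg (hX : Φ.HasValue X v) : Φ.HasValue (-X) (-v) := by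
  obtain ⟨P, hP, Q, hQ, R, hR, S, hS, rfl, rfl⟩ := hX
  exact ⟨Q, hQ, P, hP, S, hS, R, hR, by module, by ring⟩

theorem sub (hX : Φ.HasValue X v) (hY : Φ.HasValue Y w) : Φ.HasValue (X - Y) (v - w) := by
  simpa only [sub_eq_add_neg] using hX.add hY.neg

theorem I_smul (hX : Φ.HasValue X v) : Φ.HasValue (Complex.I • X) (Complex.I * v) := by
  obtain ⟨P, hP, Q, hQ, R, hR, S, hS, rfl, rfl⟩ := hX
  refine ⟨S, hS, R, hR, P, hP, Q, hQ, ?_, ?_⟩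
  · rw [smul_add, smul_smul, Complex.I_mul_I]
    module
  · rw [mul_add, ← mul_assoc, Complex.I_mul_I]
    ring

theorem smul_of_nonneg (hX : Φ.HasValue X v) {c : ℝ} (hc : 0 ≤ c) :
    Φ.HasValue (c • X) (c * v) := by
  obtain ⟨P, hP, Q, hQ, R, hR, S, hS, rfl, rfl⟩ := hX
  refine ⟨c • P, Φ.smul_mem c hc _ hP, c • Q, Φ.smul_mem c hc _ hQ, c • R,
    Φ.smul_mem c hc _ hR, c • S, Φ.smul_mem c hc _ hS, ?_, ?_⟩
  · rw [smul_add, smul_sub, smul_comm, smul_sub]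
  · rw [Φ.map_smul c hc _ hP, Φ.map_smul c hc _ hQ, Φ.map_smul c hc _ hR, Φ.map_smul c hc _ hS]
    push_cast
    ring

theorem real_smul (hX : Φ.HasValue X v) (c : ℝ) : Φ.HasValue (c • X) (c * v) := by
  rcases le_total 0 c with hc | hc
  · exact hX.smul_of_nonneg hc
  · simpa using (hX.smul_of_nonneg (neg_nonneg.2 hc)).neg

theorem smul (hX : Φ.HasValue X v) (c : ℂ) : Φ.HasValue (c • X) (c * v) := by
  have hX' : c • X = c.re • X + c.im • Complex.I • X := by
    rw [← Complex.coe_smul, ← Complex.coe_smul c.im, smul_smul, ← add_smul, Complex.re_add_im]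
  have hv : c * v = c.re * v + c.im * (Complex.I * v) := by
    rw [← mul_assoc, ← add_mul, Complex.re_add_im]
  rw [hX', hv]
  exact (hX.real_smul c.re).add (hX.I_smul.real_smul c.im)

theorem sum {ι : Type*} {s : Finset ι} {X : ι → H →L[ℂ] H} {v : ι → ℂ}
    (h : ∀ i ∈ s, Φ.HasValue (X i) (v i)) : Φ.HasValue (∑ i ∈ s, X i) (∑ i ∈ s, v i) := by
  induction s using Finset.cons_induction with
  | empty => simpa only [Finset.sum_empty] using zero
  | cons a s _ ih =>
    rw [Finset.sum_cons, Finset.sum_cons]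
    exact (h a (Finset.mem_cons_self a s)).add
      (ih fun i hi => h i (Finset.mem_cons_of_mem hi))

end HasValue

end ConeFunctional

/-- The trace on the cone of positive operators of finite trace. -/
def FNSTrace.finiteFunctional {N : VonNeumannAlgebra H} (τ : FNSTrace N) : ConeFunctional N where
  cone := {P | P ∈ N ∧ 0 ≤ P ∧ τ.toFun P < ∞}
  toFun P := (τ.toFun P).toReal
  mem _ h := h.1
  nonneg _ h := h.2.1
  zero_mem := ⟨zero_mem N, le_rfl, by rw [τ.toFun_zero]; exact ENNReal.zero_lt_top⟩
  add_mem P h Q h' := ⟨add_mem h.1 h'.1, add_nonneg h.2.1 h'.2.1, by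
    rw [τ.map_add _ h.1 _ h'.1 h.2.1 h'.2.1]
    exact ENNReal.add_lt_top.2 ⟨h.2.2, h'.2.2⟩⟩
  smul_mem c hc P h := ⟨real_smul_mem _ h.1, smul_nonneg hc h.2.1, by
    rw [τ.map_smul c hc _ h.1 h.2.1]
    exact ENNReal.mul_lt_top ENNReal.ofReal_lt_top h.2.2⟩
  posPart_mem _ hY _ hX hXs h := ⟨posPart_mem hX, CFC.posPart_nonneg _,
    (τ.toFun_posPart_le hX hXs hY.1 hY.2.1 h).trans_lt hY.2.2⟩
  map_add P h Q h' := by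
    rw [τ.map_add _ h.1 _ h'.1 h.2.1 h'.2.1, ENNReal.toReal_add h.2.2.ne h'.2.2.ne]
  map_smul c hc P h := by
    rw [τ.map_smul c hc _ h.1 h.2.1, ENNReal.toReal_mul, ENNReal.toReal_ofReal hc]

/-- The operators `B + i^k` of the polarisation identity. -/
def polar (B : H →L[ℂ] H) (k : ℕ) : H →L[ℂ] H := B + (Complex.I ^ k) • 1

theorem polar_mem {N : VonNeumannAlgebra H} {B : H →L[ℂ] H} (hB : B ∈ N) (k : ℕ) :
    polar B k ∈ N := add_mem hB (complex_smul_mem _ (one_mem N))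

theorem mul_eq_sum_polar (Q B : H →L[ℂ] H) :
    Q * B = (4⁻¹ : ℂ) • ∑ k ∈ Finset.range 4,
      (Complex.I ^ k) • (star (polar B k) * Q * polar B k) := by
  have hI3 : Complex.I ^ 3 = -Complex.I := by rw [pow_succ, Complex.I_sq, neg_one_mul]
  simp only [Finset.sum_range_succ, Finset.sum_range_zero, polar, Complex.I_sq, hI3, pow_zero,
    pow_one, star_add, star_smul, star_one, RCLike.star_def, Complex.conj_I, map_neg, map_one,
    add_mul, mul_add, smul_mul_assoc, mul_smul_comm, one_mul, mul_one, smul_add, smul_smul,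
    Complex.I_mul_I, neg_mul, mul_neg, neg_neg]
  module

/-! ### The Dixmier functional -/

theorem continuousOn_spectrum_of_nonneg {P : H →L[ℂ] H} (hP : 0 ≤ P) {k : ℝ → ℝ}
    (hk : ContinuousOn k (Ici 0)) : ContinuousOn k (spectrum ℝ P) :=
  hk.mono fun _ hx => spectrum_nonneg_of_nonneg hP hx

theorem mul_cfc_mul {P : H →L[ℂ] H} (hP : 0 ≤ P) {k : ℝ → ℝ} (hk : ContinuousOn k (Ici 0)) :
    P * cfc k P * P = cfc (fun x => x ^ 2 * k x) P := by
  have hPs : IsSelfAdjoint P := .of_nonneg hP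
  have hkP := continuousOn_spectrum_of_nonneg hP hk
  calc P * cfc k P * P
      = cfc (fun x : ℝ => x) P * cfc k P * cfc (fun x : ℝ => x) P := by rw [cfc_id' ℝ P]
    _ = cfc (fun x => x * k x * x) P := by
      rw [cfc_mul (fun x : ℝ => x * k x) (fun x => x) P, cfc_mul (fun x : ℝ => x) k P]
    _ = cfc (fun x => x ^ 2 * k x) P := cfc_congr fun x _ => by ring

theorem sq_mul_refProfile {T : ℝ} (hT : 0 < T) (x : ℝ) :
    x ^ 2 * (T * refProfile (T * x)) = max (x - T⁻¹) 0 := by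
  rcases le_total (T * x) 1 with h | h
  · have hx : x ≤ T⁻¹ := by rwa [← one_div, le_div_iff₀' hT]
    rw [refProfile_of_le h, mul_zero, mul_zero, max_eq_right (sub_nonpos.2 hx)]
  · have hx : T⁻¹ ≤ x := by rwa [← one_div, div_le_iff₀' hT]
    have hx0 : 0 < x := (inv_pos.2 hT).trans_le hx
    rw [refProfile_of_ge h, max_eq_left (sub_nonneg.2 hx)]
    field_simp

namespace FNSTrace

variable {N : VonNeumannAlgebra H} {τ : FNSTrace N} {B C D P Q X Y : H →L[ℂ] H}

theorem LogBounded.toFun_mul_self_lt_top (hP : τ.LogBounded P) : τ.toFun (P * P) < ∞ := by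
  obtain ⟨D, -, hD⟩ := hP.exists_toFun_quadCut_le
  have hr : 0 < ‖P‖ + 1 := by positivity
  have hPs : IsSelfAdjoint P := hP.isSelfAdjoint
  have hsq : P * P = (‖P‖ + 1) • cfc (quadCut (‖P‖ + 1)⁻¹) P := by
    rw [← cfc_smul _ _ P (continuous_quadCut (inv_pos.2 hr)).continuousOn, ← sq,
      ← cfc_pow_id (R := ℝ) P 2]
    refine cfc_congr fun x hx => ?_
    have hx_le : x ≤ ‖P‖ + 1 := (le_norm_of_mem_spectrum hx).trans (by linarith)
    simp only [quadCut, inv_inv, smul_eq_mul, max_eq_right hx_le]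
    field_simp
  rw [hsq, τ.map_smul _ hr.le _ (cfc_mem hP.mem _)
    (cfc_nonneg fun x _ => quadCut_nonneg (inv_pos.2 hr) x)]
  exact ENNReal.mul_lt_top ENNReal.ofReal_lt_top
    ((hD _ (inv_pos.2 hr)).trans_lt ENNReal.ofReal_lt_top)

theorem LogBounded.toFun_star_mul_mul_lt_top (hP : τ.LogBounded P) (hC : C ∈ N) :
    τ.toFun (star (P * C) * (P * C)) < ∞ := by
  have hPP : star (P * C) * (P * C) = star C * (P * P) * C := by
    rw [star_mul, hP.isSelfAdjoint.star_eq]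
    simp only [mul_assoc]
  rw [hPP]
  exact (τ.toFun_conjugate_le_norm_sq_mul (mul_mem hP.mem hP.mem)
    hP.isSelfAdjoint.mul_self_nonneg hC).trans_lt
    (ENNReal.mul_lt_top ENNReal.ofReal_lt_top hP.toFun_mul_self_lt_top)

/-- The measure `m` represents the functional `k ↦ τ(C* P k(P) P C)`. The outer factors `P` make
`m` finite for every log-bounded `P`. -/
structure Represents (τ : FNSTrace N) (P C : H →L[ℂ] H) (m : Measure ℝ) : Prop where
  isFiniteMeasure : IsFiniteMeasure m
  isLogMeasure : IsLogMeasure m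
  toFun_eq : ∀ k : ℝ → ℝ, ContinuousOn k (Ici 0) → (∀ x, 0 ≤ x → 0 ≤ k x) →
    τ.toFun (star C * cfc (fun x => x ^ 2 * k x) P * C) = ∫⁻ x, ENNReal.ofReal (k x) ∂m

theorem LogBounded.exists_represents (hP : τ.LogBounded P) (hC : C ∈ N) :
    ∃ m : Measure ℝ, τ.Represents P C m := by
  obtain ⟨m, hfin, hm⟩ := τ.exists_spectralMeasure hP.mem hP.nonneg (mul_mem hP.mem hC)
    (hP.toFun_star_mul_mul_lt_top hC)
  have hrep (k : ℝ → ℝ) (hk : ContinuousOn k (Ici 0)) (hk0 : ∀ x, 0 ≤ x → 0 ≤ k x) :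
      τ.toFun (star C * cfc (fun x => x ^ 2 * k x) P * C) = ∫⁻ x, ENNReal.ofReal (k x) ∂m := by
    rw [← hm k hk hk0, ← mul_cfc_mul hP.nonneg hk, star_mul, hP.isSelfAdjoint.star_eq]
    simp only [mul_assoc]
  obtain ⟨D, hD0, hD⟩ := hP.exists_toFun_quadCut_le
  refine ⟨m, hfin, ⟨‖C‖ ^ 2 * D, by positivity, fun T hT => ?_⟩, hrep⟩
  have hlog := log_two_add_pos hT.le
  have hpos (x : ℝ) : 0 ≤ (max x T⁻¹)⁻¹ := (inv_pos.2 (max_inv_pos hT x)).le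
  rw [integral_eq_lintegral_of_nonneg_ae (.of_forall hpos)
    (continuous_inv_max hT).aestronglyMeasurable,
    ← hrep _ (continuous_inv_max hT).continuousOn fun x _ => hpos x]
  refine ENNReal.toReal_le_of_le_ofReal (by positivity) ?_
  refine (τ.toFun_conjugate_le_norm_sq_mul (cfc_mem hP.mem _)
    (cfc_nonneg fun x _ => quadCut_nonneg hT x) hC).trans ?_
  rw [mul_assoc, ENNReal.ofReal_mul (by positivity)]
  gcongr
  exact hD T hT

/-- The function `T ↦ τ(C* (P - 1/T)₊ C)`. -/
def softThresholdTrace (τ : FNSTrace N) (P C : H →L[ℂ] H) (T : ℝ) : ℝ :=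
  (τ.toFun (star C * softThreshold P T⁻¹ * C)).toReal

/-- The generalised limit of `τ(C* (P - 1/T)₊ C) / log(2 + T)`. For `C = 1` this is the Dixmier
trace of `P`; the general case is used to polarise in `C`. -/
def dixmier (τ : FNSTrace N) (ω : LInfty →ₗ[ℝ] ℝ) (P C : H →L[ℂ] H) : ℝ :=
  logLim ω (τ.softThresholdTrace P C)

theorem softThresholdTrace_one (τ : FNSTrace N) (P : H →L[ℂ] H) (T : ℝ) :
    τ.softThresholdTrace P 1 T = (τ.toFun (softThreshold P T⁻¹)).toReal := by
  rw [softThresholdTrace, star_one, one_mul, mul_one]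

theorem Represents.softThresholdTrace_eq {m : Measure ℝ} (hm : τ.Represents P C m)
    (hP : IsSelfAdjoint P) {T : ℝ} (hT : 0 < T) :
    τ.softThresholdTrace P C T = dilIntegral m refProfile T := by
  have hcont : Continuous fun x => T * refProfile (T * x) :=
    (continuous_refProfile.comp (continuous_const_mul T)).const_mul T
  have hpos (x : ℝ) : 0 ≤ T * refProfile (T * x) := mul_nonneg hT.le (refProfile_nonneg _)
  rw [softThresholdTrace, dilIntegral, integral_eq_lintegral_of_nonneg_ae (.of_forall hpos)
    hcont.aestronglyMeasurable, ← hm.toFun_eq _ hcont.continuousOn fun x _ => hpos x,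
    softThreshold_eq_cfc hP]
  simp only [sq_mul_refProfile hT]

theorem LogBounded.logGrowth (hP : τ.LogBounded P) (hC : C ∈ N) :
    LogGrowth (τ.softThresholdTrace P C) := by
  obtain ⟨m, hm⟩ := hP.exists_represents hC
  have := hm.isFiniteMeasure
  exact (logGrowth_dilIntegral hm.isLogMeasure continuous_refProfile abs_refProfile_le).congr
    fun T hT => hm.softThresholdTrace_eq hP.isSelfAdjoint hT

theorem LogBounded.logGrowth_one (hP : τ.LogBounded P) : LogGrowth (τ.softThresholdTrace P 1) :=
  hP.logGrowth (one_mem N)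

theorem LogBounded.toFun_conjugate_softThreshold_lt_top (hP : τ.LogBounded P) (hC : C ∈ N) {ε : ℝ}
    (hε : 0 < ε) : τ.toFun (star C * softThreshold P ε * C) < ∞ :=
  (τ.toFun_conjugate_le_norm_sq_mul (softThreshold_mem hP.mem ε) (softThreshold_nonneg _ _)
    hC).trans_lt (ENNReal.mul_lt_top ENNReal.ofReal_lt_top (hP.softThreshold_lt_top hε))

theorem toFun_conjugate_add_conjugate (τ : FNSTrace N) (hY : Y ∈ N) (hY0 : 0 ≤ Y) (hC : C ∈ N)
    (hD : D ∈ N) (h : C * star C + D * star D = 1) :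
    τ.toFun (star C * Y * C) + τ.toFun (star D * Y * D) = τ.toFun Y := by
  have hsqrt := sqrt_mem hY
  have hmem {K : H →L[ℂ] H} (hK : K ∈ N) : CFC.sqrt Y * (K * star K) * CFC.sqrt Y ∈ N :=
    mul_mem (mul_mem hsqrt (mul_mem hK (star_mem hK))) hsqrt
  have hpos (K : H →L[ℂ] H) : 0 ≤ CFC.sqrt Y * (K * star K) * CFC.sqrt Y :=
    conjugate_nonneg_of_nonneg (mul_star_self_nonneg K) (CFC.sqrt_nonneg Y)
  rw [τ.toFun_conjugate_eq hY hY0 hC, τ.toFun_conjugate_eq hY hY0 hD,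
    ← τ.map_add _ (hmem hC) _ (hmem hD) (hpos C) (hpos D), ← add_mul, ← mul_add, h, mul_one,
    CFC.sqrt_mul_sqrt_self _ hY0]

variable {ω : LInfty →ₗ[ℝ] ℝ} (hω : IsGeneralisedLimit ω) (hωd : IsDilationInvariant ω)

include hω hωd

/- The inequalities `τ((P + Q - 2ε)₊) ≤ τ((P - ε)₊) + τ((Q - ε)₊) ≤ τ((P + Q - ε/2)₊)` change the
threshold by a factor only, which the dilation invariance of `ω` absorbs. -/
theorem LogBounded.dixmier_add (hP : τ.LogBounded P) (hQ : τ.LogBounded Q) :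
    τ.dixmier ω (P + Q) 1 = τ.dixmier ω P 1 + τ.dixmier ω Q 1 := by
  have hPQ := (hP.add hQ).logGrowth_one
  have hsum := hP.logGrowth_one.add hQ.logGrowth_one
  have hfin {T : ℝ} (hT : 0 < T) :
      τ.toFun (softThreshold P T⁻¹) ≠ ∞ ∧ τ.toFun (softThreshold Q T⁻¹) ≠ ∞ :=
    ⟨(hP.softThreshold_lt_top (inv_pos.2 hT)).ne, (hQ.softThreshold_lt_top (inv_pos.2 hT)).ne⟩
  simp only [dixmier]
  rw [← logLim_add hP.logGrowth_one hQ.logGrowth_one]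
  apply le_antisymm
  · rw [← logLim_dilate hω hωd hPQ two_pos]
    refine logLim_mono hω (hPQ.dilate two_pos) hsum fun T hT => ?_
    have hT2 : (T / 2)⁻¹ = T⁻¹ + T⁻¹ := by field_simp; norm_num
    simp only [softThresholdTrace_one]
    rw [← ENNReal.toReal_add (hfin hT).1 (hfin hT).2, hT2]
    exact ENNReal.toReal_mono (ENNReal.add_ne_top.2 (hfin hT))
      (τ.toFun_softThreshold_add_le hP.mem hP.isSelfAdjoint hQ.mem hQ.isSelfAdjoint _ _)
  · rw [← logLim_dilate hω hωd hPQ one_half_pos]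
    refine logLim_mono hω hsum (hPQ.dilate one_half_pos) fun T hT => ?_
    have hT2 : (T / (1 / 2))⁻¹ = T⁻¹ - T⁻¹ / 2 := by field_simp; norm_num
    simp only [softThresholdTrace_one]
    rw [← ENNReal.toReal_add (hfin hT).1 (hfin hT).2]
    refine ENNReal.toReal_mono ((hP.add hQ).softThreshold_lt_top (by positivity)).ne ?_
    rw [hT2]
    exact τ.toFun_softThreshold_add_toFun_softThreshold_le_add hP.mem hP.nonneg hQ.mem hQ.nonneg
      (by positivity) (by positivity)

theorem LogBounded.dixmier_smul (hP : τ.LogBounded P) {c : ℝ} (hc : 0 ≤ c) :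
    τ.dixmier ω (c • P) 1 = c * τ.dixmier ω P 1 := by
  rcases hc.eq_or_lt with rfl | hc0
  · have hzero := (LogBounded.zero (τ := τ)).dixmier_add hω hωd .zero
    rw [add_zero, left_eq_add] at hzero
    rw [zero_smul, zero_mul, hzero]
  · have hdil := hP.logGrowth_one.dilate (inv_pos.2 hc0)
    rw [dixmier, dixmier, ← logLim_dilate hω hωd hP.logGrowth_one (inv_pos.2 hc0),
      ← logLim_const_mul hdil]
    refine logLim_congr fun T hT => ?_
    have hcT : softThreshold (c • P) T⁻¹ = c • softThreshold P (T / c⁻¹)⁻¹ := by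
      rw [← softThreshold_smul P hc]
      congr 1
      field_simp
    rw [softThresholdTrace_one, softThresholdTrace_one, hcT,
      τ.map_smul c hc _ (softThreshold_mem hP.mem _) (softThreshold_nonneg _ _),
      ENNReal.toReal_mul, ENNReal.toReal_ofReal hc]

omit hω hωd in
theorem LogBounded.mul_star_self (hX : X ∈ N) (h : τ.LogBounded (star X * X)) :
    τ.LogBounded (X * star X) := by
  refine h.of_le (mul_mem hX (star_mem hX)) (mul_star_self_nonneg X) two_pos zero_le_one
    fun ε hε => ?_
  simpa only [star_star, ENNReal.ofReal_one, one_mul] using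
    τ.toFun_softThreshold_star_mul_self_le (star_mem hX) hε

theorem LogBounded.dixmier_star_mul_self_le (hX : X ∈ N) (h : τ.LogBounded (star X * X)) :
    τ.dixmier ω (star X * X) 1 ≤ τ.dixmier ω (X * star X) 1 := by
  have h' := LogBounded.mul_star_self hX h
  rw [dixmier, dixmier, ← logLim_dilate hω hωd h.logGrowth_one two_pos]
  refine logLim_mono hω (h.logGrowth_one.dilate two_pos) h'.logGrowth_one fun T hT => ?_
  have hT2 : (T / 2)⁻¹ = 2 * T⁻¹ := by field_simp
  rw [softThresholdTrace_one, softThresholdTrace_one, hT2]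
  exact ENNReal.toReal_mono (h'.softThreshold_lt_top (inv_pos.2 hT)).ne
    (τ.toFun_softThreshold_star_mul_self_le hX (inv_pos.2 hT))

theorem LogBounded.dixmier_star_mul_self (hX : X ∈ N) (h : τ.LogBounded (star X * X)) :
    τ.dixmier ω (star X * X) 1 = τ.dixmier ω (X * star X) 1 := by
  refine le_antisymm (h.dixmier_star_mul_self_le hω hωd hX) ?_
  have h' : τ.LogBounded (star (star X) * star X) := by
    rw [star_star]
    exact LogBounded.mul_star_self hX h
  simpa only [star_star] using h'.dixmier_star_mul_self_le hω hωd (star_mem hX)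

theorem LogBounded.dixmier_conjugate_eq_sqrt (hP : τ.LogBounded P) (hC : C ∈ N) :
    τ.LogBounded (CFC.sqrt P * (C * star C) * CFC.sqrt P) ∧
      τ.dixmier ω (star C * P * C) 1 = τ.dixmier ω (CFC.sqrt P * (C * star C) * CFC.sqrt P) 1 := by
  have hs : star (CFC.sqrt P) = CFC.sqrt P := (IsSelfAdjoint.of_nonneg (CFC.sqrt_nonneg P)).star_eq
  have hsC := mul_mem (sqrt_mem hP.mem) hC
  have hleft : star (CFC.sqrt P * C) * (CFC.sqrt P * C) = star C * P * C := by
    rw [star_mul, hs, mul_assoc, ← mul_assoc (CFC.sqrt P), CFC.sqrt_mul_sqrt_self _ hP.nonneg,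
      mul_assoc]
  have hright : CFC.sqrt P * C * star (CFC.sqrt P * C) =
      CFC.sqrt P * (C * star C) * CFC.sqrt P := by
    rw [star_mul, hs]
    simp only [mul_assoc]
  have hbdd : τ.LogBounded (star (CFC.sqrt P * C) * (CFC.sqrt P * C)) := hleft ▸ hP.conjugate hC
  rw [← hleft, ← hright]
  exact ⟨LogBounded.mul_star_self hsC hbdd, hbdd.dixmier_star_mul_self hω hωd hsC⟩

theorem LogBounded.dixmier_conjugate_add_conjugate (hP : τ.LogBounded P) (hC : C ∈ N) (hD : D ∈ N)
    (h : C * star C + D * star D = 1) :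
    τ.dixmier ω (star C * P * C) 1 + τ.dixmier ω (star D * P * D) 1 = τ.dixmier ω P 1 := by
  obtain ⟨hCb, hCeq⟩ := hP.dixmier_conjugate_eq_sqrt hω hωd hC
  obtain ⟨hDb, hDeq⟩ := hP.dixmier_conjugate_eq_sqrt hω hωd hD
  rw [hCeq, hDeq, ← hCb.dixmier_add hω hωd hDb, ← add_mul, ← mul_add, h, mul_one,
    CFC.sqrt_mul_sqrt_self _ hP.nonneg]

omit hω hωd in
theorem LogBounded.dixmier_add_dixmier_eq (hP : τ.LogBounded P) (hC : C ∈ N) (hD : D ∈ N)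
    (h : C * star C + D * star D = 1) :
    τ.dixmier ω P C + τ.dixmier ω P D = τ.dixmier ω P 1 := by
  rw [dixmier, dixmier, dixmier, ← logLim_add (hP.logGrowth hC) (hP.logGrowth hD)]
  refine logLim_congr fun T hT => ?_
  have hT' := inv_pos.2 hT
  rw [softThresholdTrace, softThresholdTrace, softThresholdTrace_one,
    ← ENNReal.toReal_add (hP.toFun_conjugate_softThreshold_lt_top hC hT').ne
      (hP.toFun_conjugate_softThreshold_lt_top hD hT').ne,
    τ.toFun_conjugate_add_conjugate (softThreshold_mem hP.mem _) (softThreshold_nonneg _ _) hC hD h]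

omit hωd in
theorem LogBounded.dixmier_conjugate_le (hP : τ.LogBounded P) (hC : C ∈ N) (hC1 : ‖C‖ ≤ 1) :
    τ.dixmier ω (star C * P * C) 1 ≤ τ.dixmier ω P C := by
  refine logLim_mono hω (hP.conjugate hC).logGrowth_one (hP.logGrowth hC) fun T hT => ?_
  rw [softThresholdTrace_one, softThresholdTrace]
  exact ENNReal.toReal_mono (hP.toFun_conjugate_softThreshold_lt_top hC (inv_pos.2 hT)).ne
    (τ.toFun_softThreshold_conjugate_le hP.mem hP.isSelfAdjoint hC hC1 (by positivity))

/- Complete `C` to `C C* + D D* = 1`. Both sides then add up to the value at `P`, so the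
inequalities for `C` and for `D` are equalities. -/
theorem LogBounded.dixmier_conjugate_of_norm_le_one (hP : τ.LogBounded P) (hC : C ∈ N)
    (hC1 : ‖C‖ ≤ 1) : τ.dixmier ω (star C * P * C) 1 = τ.dixmier ω P C := by
  have hE0 : 0 ≤ 1 - C * star C := sub_nonneg.2 (mul_star_self_le_one hC1)
  set D := CFC.sqrt (1 - C * star C)
  have hDN : D ∈ N := sqrt_mem (sub_mem (one_mem N) (mul_mem hC (star_mem hC)))
  have hDs : star D = D := (IsSelfAdjoint.of_nonneg (CFC.sqrt_nonneg _)).star_eq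
  have hDD : D * D = 1 - C * star C := CFC.sqrt_mul_sqrt_self _ hE0
  have hD1 : ‖D‖ ≤ 1 := by
    refine norm_le_one_of_star_mul_self_le_one ?_
    rw [hDs, hDD]
    exact sub_le_self _ (mul_star_self_nonneg C)
  have hsum : C * star C + D * star D = 1 := by rw [hDs, hDD, add_sub_cancel]
  linarith [hP.dixmier_conjugate_add_conjugate hω hωd hC hDN hsum,
    hP.dixmier_add_dixmier_eq (ω := ω) hC hDN hsum, hP.dixmier_conjugate_le hω hC hC1,
    hP.dixmier_conjugate_le hω hDN hD1]

theorem LogBounded.dixmier_conjugate (hP : τ.LogBounded P) (hC : C ∈ N) :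
    τ.dixmier ω (star C * P * C) 1 = τ.dixmier ω P C := by
  obtain ⟨r, -, K, hK, hK1, rfl⟩ := exists_eq_smul_norm_le_one hC
  have hconj (Y : H →L[ℂ] H) : star (r • K) * Y * (r • K) = (r ^ 2) • (star K * Y * K) := by
    rw [star_smul, star_trivial, smul_mul_assoc, smul_mul_assoc, mul_smul_comm, smul_smul, sq]
  have htrace (T : ℝ) : τ.softThresholdTrace P (r • K) T = r ^ 2 * τ.softThresholdTrace P K T := by
    rw [softThresholdTrace, softThresholdTrace, hconj, τ.map_smul _ (sq_nonneg r) _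
      (mul_mem (mul_mem (star_mem hK) (softThreshold_mem hP.mem _)) hK)
      (star_left_conjugate_nonneg (softThreshold_nonneg _ _) K), ENNReal.toReal_mul,
      ENNReal.toReal_ofReal (sq_nonneg r)]
  rw [hconj, (hP.conjugate hK).dixmier_smul hω hωd (sq_nonneg r),
    hP.dixmier_conjugate_of_norm_le_one hω hωd hK hK1, dixmier, dixmier,
    ← logLim_const_mul (hP.logGrowth hK)]
  exact logLim_congr fun T _ => (htrace T).symm

omit hω hωd

/-- The Dixmier trace on the cone of log-bounded operators. -/
def dixmierFunctional (τ : FNSTrace N) (hω : IsGeneralisedLimit ω) (hωd : IsDilationInvariant ω) :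
    ConeFunctional N where
  cone := {P | τ.LogBounded P}
  toFun P := τ.dixmier ω P 1
  mem _ h := h.mem
  nonneg _ h := h.nonneg
  zero_mem := LogBounded.zero
  add_mem _ h _ h' := LogBounded.add h h'
  smul_mem _ hc _ h := LogBounded.smul h hc
  posPart_mem _ hY _ hX hXs h := LogBounded.posPart_of_le hY hX hXs h
  map_add _ h _ h' := LogBounded.dixmier_add hω hωd h h'
  map_smul _ hc _ h := LogBounded.dixmier_smul hω hωd h hc

/-- The Dixmier trace of `P B`, expressed through its values on positive operators by polarisation
of `B`. -/
def dixmierMul (τ : FNSTrace N) (ω : LInfty →ₗ[ℝ] ℝ) (P B : H →L[ℂ] H) : ℂ :=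
  4⁻¹ * ∑ k ∈ Finset.range 4, Complex.I ^ k * (τ.dixmier ω P (polar B k) : ℂ)

include hω hωd

theorem LogBounded.hasValue_mul (hP : τ.LogBounded P) (hB : B ∈ N) :
    (τ.dixmierFunctional hω hωd).HasValue (P * B) (τ.dixmierMul ω P B) := by
  rw [mul_eq_sum_polar]
  refine .smul (.sum fun k _ => .smul ?_ _) _
  rw [← hP.dixmier_conjugate hω hωd (polar_mem hB k)]
  exact ConeFunctional.hasValue_of_mem (Φ := τ.dixmierFunctional hω hωd)
    (hP.conjugate (polar_mem hB k))

theorem jordanExtend_dixmier_mul {A : H →L[ℂ] H} (hA : A ∈ τ.dixmierIdeal) (hB : B ∈ N) :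
    jordanExtend (fun P => (τ.dixmier ω P 1 : ℂ)) (A * B) =
      jordanExtend (fun P => τ.dixmierMul ω P B) A := by
  have hparts {P} (hP : P ∈ jordanParts A) :
      (τ.dixmierFunctional hω hωd).HasValue (P * B) (τ.dixmierMul ω P B) :=
    (logBounded_of_mem_jordanParts hA hP).hasValue_mul hω hωd hB
  have h := ((hparts (P := (ℜ A : H →L[ℂ] H)⁺) (by simp [jordanParts])).sub
    (hparts (P := (ℜ A : H →L[ℂ] H)⁻) (by simp [jordanParts]))).add
    ((hparts (P := (ℑ A : H →L[ℂ] H)⁺) (by simp [jordanParts])).sub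
    (hparts (P := (ℑ A : H →L[ℂ] H)⁻) (by simp [jordanParts]))).I_smul
  rw [← sub_mul, ← sub_mul, CFC.posPart_sub_negPart _ (ℜ A).2, CFC.posPart_sub_negPart _ (ℑ A).2,
    ← smul_mul_assoc, ← add_mul, realPart_add_I_smul_imaginaryPart] at h
  exact h.jordanExtend_eq

end FNSTrace

/-! ### Functions vanishing to second order at zero -/

/-- On `[0,∞)` the function `f` is `x² k(x)` with `k` continuous and `O(min(1, x⁻²))`: it is bounded
and vanishes to second order at `0`. The number `C` is a constant for the decay of `k`. -/
structure IsProfile (f k : ℝ → ℝ) (C : ℝ) : Prop where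
  continuous : Continuous k
  bound : ∀ y, |k y| ≤ C * ((max y 1) ^ 2)⁻¹
  eq : ∀ x, 0 ≤ x → f x = x ^ 2 * k x

theorem continuousOn_update_div_sq {f : ℝ → ℝ} (hf : ContinuousOn f (Ioi 0)) {a : ℝ}
    (ha : Tendsto (fun x => f x / x ^ 2) (𝓝[>] 0) (𝓝 a)) :
    ContinuousOn (Function.update (fun x => f x / x ^ 2) 0 a) (Ici 0) := by
  rw [continuousOn_update_iff, Ici_sdiff_left]
  exact ⟨hf.div (by fun_prop) fun x hx => pow_ne_zero 2 (ne_of_gt hx), fun _ => ha⟩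

theorem exists_isProfile {f : ℝ → ℝ} (hf : ContinuousOn f (Ioi 0))
    (hb : ∃ C : ℝ, ∀ s : ℝ, 0 ≤ s → |f s| ≤ C) (h0 : f 0 = 0) {a : ℝ}
    (ha : Tendsto (fun x => f x / x ^ 2) (𝓝[>] 0) (𝓝 a)) : ∃ k C, IsProfile f k C := by
  obtain ⟨D, hD⟩ := hb
  have hcont := continuousOn_update_div_sq hf ha
  set g := Function.update (fun x => f x / x ^ 2) 0 a
  have hg (x : ℝ) (hx : 0 < x) : g x = f x / x ^ 2 := Function.update_of_ne hx.ne' _ _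
  obtain ⟨E, hE⟩ := (isCompact_Icc (a := (0 : ℝ)) (b := 1)).exists_bound_of_continuousOn
    (hcont.mono Icc_subset_Ici_self)
  refine ⟨fun y => g (max y 0), max E D, hcont.comp_continuous (by fun_prop)
    fun y => le_max_right y 0, fun y => ?_, fun x hx => ?_⟩
  · rcases le_total y 1 with hy | hy
    · rw [max_eq_right hy, one_pow, inv_one, mul_one]
      exact (hE _ ⟨le_max_right _ _, max_le hy zero_le_one⟩).trans (le_max_left _ _)
    · have hy0 : 0 < y := one_pos.trans_le hy
      rw [max_eq_left hy0.le, max_eq_left hy, hg y hy0, abs_div, abs_sq, div_eq_mul_inv]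
      gcongr
      exact (hD y hy0.le).trans (le_max_right _ _)
  · rcases hx.eq_or_lt with rfl | hx0
    · rw [h0, sq, zero_mul, zero_mul]
    · rw [max_eq_left hx, hg x hx0, mul_div_cancel₀ _ (pow_ne_zero 2 hx0.ne')]

namespace IsProfile

variable {f k : ℝ → ℝ} {C : ℝ}

theorem continuousOn (h : IsProfile f k C) : ContinuousOn f (Ici 0) :=
  ((continuous_pow 2).mul h.continuous).continuousOn.congr fun x hx => h.eq x hx

theorem abs_le (h : IsProfile f k C) (y : ℝ) : |k y| ≤ C :=
  abs_le_of_abs_le_mul_inv (abs_le_mul_inv_of_sq h.bound) y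

theorem eqOn_div_sq (h : IsProfile f k C) : EqOn (fun s => f s / s ^ 2) k (Ioi 0) := fun s hs => by
  simp only [h.eq s (le_of_lt hs)]
  rw [mul_div_cancel_left₀ _ (pow_ne_zero 2 (ne_of_gt hs))]

theorem integrableOn_div_sq (h : IsProfile f k C) : IntegrableOn (fun s => f s / s ^ 2) (Ioi 0) :=
  (integrableOn_Ioi_zero h.continuous h.bound).congr_fun h.eqOn_div_sq.symm measurableSet_Ioi

theorem integral_div_sq (h : IsProfile f k C) :
    ∫ s in Ioi (0 : ℝ), f s / s ^ 2 = ∫ s in Ioi (0 : ℝ), k s :=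
  setIntegral_congr_fun measurableSet_Ioi h.eqOn_div_sq

end IsProfile

theorem tendsto_div_sq_of_contDiffOn {f : ℝ → ℝ} (hf : ContDiffOn ℝ 2 f (Ici 0)) (h0 : f 0 = 0)
    (h1 : derivWithin f (Ici 0) 0 = 0) :
    Tendsto (fun x => f x / x ^ 2) (𝓝[>] 0) (𝓝 (2⁻¹ * iteratedDerivWithin 2 f (Ici 0) 0)) := by
  set a := 2⁻¹ * iteratedDerivWithin 2 f (Ici 0) 0 with ha
  have htaylor (x : ℝ) : taylorWithinEval f 2 (Ici 0) 0 x = a * x ^ 2 := by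
    rw [taylorWithinEval_succ, taylorWithinEval_succ, taylor_within_zero_eval,
      iteratedDerivWithin_one, h0, h1, ha]
    norm_num
    ring
  have hlim := ((Real.taylor_tendsto (n := 2) (convex_Ici 0) (self_mem_Ici (a := (0 : ℝ)))
    (by exact_mod_cast hf)).mono_left (nhdsWithin_mono 0 Ioi_subset_Ici_self)).add_const a
  rw [zero_add] at hlim
  refine hlim.congr' ?_
  filter_upwards [self_mem_nhdsWithin] with x (hx : 0 < x)
  rw [htaylor, sub_zero]
  field_simp
  ring

/-! ### The function `exp(-x^{-q})` -/

section ExpInv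

variable {q : ℝ}

theorem expInv_of_pos {x : ℝ} (hx : 0 < x) : expInv q x = Real.exp (-(x ^ (-q))) :=
  if_neg hx.not_ge

theorem expInv_zero : expInv q 0 = 0 :=
  if_pos le_rfl

theorem continuousOn_expInv : ContinuousOn (expInv q) (Ioi 0) := by
  have hrpow : ContinuousOn (fun x : ℝ => x ^ (-q)) (Ioi 0) := fun x hx =>
    (Real.continuousAt_rpow_const x (-q) (Or.inl (ne_of_gt hx))).continuousWithinAt
  exact hrpow.neg.rexp.congr fun x hx => expInv_of_pos hx

theorem abs_expInv_le_one (x : ℝ) : |expInv q x| ≤ 1 := by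
  rcases le_or_gt x 0 with hx | hx
  · rw [expInv, if_pos hx, abs_zero]
    exact zero_le_one
  · rw [expInv_of_pos hx, Real.abs_exp, Real.exp_le_one_iff, neg_nonpos]
    positivity

theorem tendsto_expInv_div_sq (hq : 0 < q) :
    Tendsto (fun x => expInv q x / x ^ 2) (𝓝[>] 0) (𝓝 0) := by
  have hinv : Tendsto (fun x : ℝ => x⁻¹ ^ q) (𝓝[>] 0) atTop :=
    (tendsto_rpow_atTop hq).comp tendsto_inv_nhdsGT_zero
  refine ((tendsto_rpow_mul_exp_neg_mul_atTop_nhds_zero (2 / q) 1 one_pos).comp hinv).congr' ?_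
  filter_upwards [self_mem_nhdsWithin] with x (hx : 0 < x)
  rw [Function.comp_apply, expInv_of_pos hx, ← Real.rpow_mul (by positivity),
    mul_div_cancel₀ _ hq.ne', Real.rpow_two, neg_one_mul, inv_pow, Real.rpow_neg hx.le,
    Real.inv_rpow hx.le, div_eq_inv_mul]

theorem exists_isProfile_expInv (hq : 0 < q) : ∃ k C, IsProfile (expInv q) k C :=
  exists_isProfile continuousOn_expInv ⟨1, fun s _ => abs_expInv_le_one s⟩ expInv_zero
    (tendsto_expInv_div_sq hq)

theorem integral_expInv_div_sq (hq : 0 < q) :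
    ∫ s in Ioi (0 : ℝ), expInv q s / s ^ 2 = Real.Gamma (1 + 1 / q) := by
  rw [add_comm, ← integral_exp_neg_rpow hq,
    ← integral_comp_rpow_Ioi (fun x : ℝ => Real.exp (-x ^ q)) (p := -1) (by norm_num)]
  refine setIntegral_congr_fun measurableSet_Ioi fun s (hs : 0 < s) => ?_
  have hderiv : |(-1 : ℝ)| * s ^ (-1 - 1 : ℝ) = (s ^ 2)⁻¹ := by
    rw [abs_neg, abs_one, one_mul, show (-1 - 1 : ℝ) = -(2 : ℝ) by norm_num, Real.rpow_neg hs.le,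
      Real.rpow_two]
  simp only [hderiv, smul_eq_mul]
  rw [expInv_of_pos hs, ← Real.rpow_mul hs.le, neg_one_mul, div_eq_inv_mul]

end ExpInv

/-! ### Complex Cesàro means -/

section Cesaro

variable {ι : Type*} (s : Finset ι) {c : ι → ℂ} {u : ι → ℝ → ℝ} {z : ℝ → ℂ}
  (hu : ∀ i ∈ s, LocallyIntegrable (u i) volume) (hM : ∀ i ∈ s, MemLInfty (realCesaro (u i)))
  (hz : ∀ t, 0 < t → z t = ∑ i ∈ s, c i * (u i t : ℂ))

include hu hz

theorem cesaro_eq_sum {T : ℝ} (hT : 0 < T) :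
    cesaro z T = ∑ i ∈ s, c i * (realCesaro (u i) T : ℂ) := by
  have hpos (x : ℝ) (hx : x ∈ uIcc 1 T) : 0 < x := (lt_min one_pos hT).trans_le hx.1
  have h_int (i : ι) (hi : i ∈ s) :
      IntervalIntegrable (fun x => c i * ((u i x / x : ℝ) : ℂ)) volume 1 T := by
    have hreal : IntervalIntegrable (fun x => u i x / x) volume 1 T := by
      simp only [div_eq_mul_inv]
      exact IntervalIntegrable.mul_continuousOn
        ((hu i hi).integrableOn_isCompact isCompact_uIcc).intervalIntegrable
        (continuousOn_inv₀.mono fun x hx => (hpos x hx).ne')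
    exact IntervalIntegrable.const_mul ⟨hreal.1.ofReal, hreal.2.ofReal⟩ _
  have hsum : ∫ x in (1 : ℝ)..T, z x / (x : ℂ) =
      ∫ x in (1 : ℝ)..T, ∑ i ∈ s, c i * ((u i x / x : ℝ) : ℂ) := by
    refine intervalIntegral.integral_congr fun x hx => ?_
    simp only [hz x (hpos x hx), Finset.sum_div, Complex.ofReal_div, mul_div_assoc]
  rw [cesaro, hsum, intervalIntegral.integral_finsetSum h_int, Finset.mul_sum]
  refine Finset.sum_congr rfl fun i _ => ?_
  rw [intervalIntegral.integral_const_mul, intervalIntegral.integral_ofReal, realCesaro,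
    Complex.ofReal_mul, Complex.ofReal_inv, mul_left_comm]

theorem cesaro_re_eq_sum {T : ℝ} (hT : 0 < T) :
    (cesaro z T).re = ∑ i ∈ s, (c i).re * realCesaro (u i) T := by
  simp only [cesaro_eq_sum s hu hz hT, Complex.re_sum, Complex.re_mul_ofReal]

theorem cesaro_im_eq_sum {T : ℝ} (hT : 0 < T) :
    (cesaro z T).im = ∑ i ∈ s, (c i).im * realCesaro (u i) T := by
  simp only [cesaro_eq_sum s hu hz hT, Complex.im_sum, Complex.im_mul_ofReal]

include hM

theorem cesaroBounded_of_eq_sum : CesaroBounded z := by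
  refine ⟨?_, (MemLInfty.sum s fun i hi => (hM i hi).const_mul _).congr fun T hT =>
    cesaro_re_eq_sum s hu hz hT, (MemLInfty.sum s fun i hi => (hM i hi).const_mul _).congr
    fun T hT => cesaro_im_eq_sum s hu hz hT⟩
  have hsum : LocallyIntegrable (fun t => ∑ i ∈ s, c i * (u i t : ℂ)) volume := by
    refine locallyIntegrable_finsetSum s fun i hi x => ?_
    obtain ⟨U, hU, hiU⟩ := hu i hi x
    exact ⟨U, hU, (Integrable.ofReal hiU).const_mul _⟩
  refine (hsum.locallyIntegrableOn (Ioi 0)).congr ?_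
  filter_upwards [ae_restrict_mem measurableSet_Ioi] with t ht using (hz t ht).symm

theorem evalCesaro_eq_sum (ω : LInfty →ₗ[ℝ] ℝ) :
    evalCesaro ω z = ∑ i ∈ s, c i * (evalAt ω (realCesaro (u i)) : ℂ) := by
  rw [evalCesaro, evalComplex, evalAt_congr fun T hT => cesaro_re_eq_sum s hu hz hT,
    evalAt_congr fun T hT => cesaro_im_eq_sum s hu hz hT,
    evalAt_sum s fun i hi => (hM i hi).const_mul _, evalAt_sum s fun i hi => (hM i hi).const_mul _,
    Complex.ofReal_sum, Complex.ofReal_sum, Finset.mul_sum, ← Finset.sum_add_distrib]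
  refine Finset.sum_congr rfl fun i hi => ?_
  rw [evalAt_const_mul (hM i hi), evalAt_const_mul (hM i hi), Complex.ofReal_mul,
    Complex.ofReal_mul, ← mul_assoc, ← add_mul, mul_comm Complex.I, Complex.re_add_im]

end Cesaro

/-! ### The heat functional of a positive operator -/

namespace FNSTrace

variable {N : VonNeumannAlgebra H} {τ : FNSTrace N} {P B C : H →L[ℂ] H}
  {ω : LInfty →ₗ[ℝ] ℝ} {m : Measure ℝ}

theorem Represents.hasValue_of_nonneg (hm : τ.Represents P C m) (hP : P ∈ N) (hC : C ∈ N)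
    {κ : ℝ → ℝ} (hκ : Continuous κ) (h0 : ∀ x, 0 ≤ κ x) {D : ℝ} (hD : ∀ x, κ x ≤ D) :
    τ.finiteFunctional.HasValue (star C * cfc (fun x => x ^ 2 * κ x) P * C)
      ((∫ x, κ x ∂m : ℝ) : ℂ) := by
  have := hm.isFiniteMeasure
  have htrace := hm.toFun_eq κ hκ.continuousOn fun x _ => h0 x
  have hfin : ∫⁻ x, ENNReal.ofReal (κ x) ∂m < ∞ := by
    refine (lintegral_mono fun x => ENNReal.ofReal_le_ofReal (hD x)).trans_lt ?_
    rw [lintegral_const]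
    exact ENNReal.mul_lt_top ENNReal.ofReal_lt_top (measure_lt_top _ _)
  have hmem : star C * cfc (fun x => x ^ 2 * κ x) P * C ∈ τ.finiteFunctional.cone :=
    ⟨mul_mem (mul_mem (star_mem hC) (cfc_mem hP _)) hC, star_left_conjugate_nonneg
      (cfc_nonneg fun x _ => mul_nonneg (sq_nonneg x) (h0 x)) C, by rwa [htrace]⟩
  rw [integral_eq_lintegral_of_nonneg_ae (.of_forall h0) hκ.aestronglyMeasurable, ← htrace]
  exact ConeFunctional.hasValue_of_mem hmem

theorem Represents.hasValue (hm : τ.Represents P C m) (hP : P ∈ N) (hC : C ∈ N)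
    {κ : ℝ → ℝ} (hκ : Continuous κ) {D : ℝ} (hD : ∀ x, |κ x| ≤ D) :
    τ.finiteFunctional.HasValue (star C * cfc (fun x => x ^ 2 * κ x) P * C)
      ((∫ x, κ x ∂m : ℝ) : ℂ) := by
  have := hm.isFiniteMeasure
  have hpart {g : ℝ → ℝ} (hg : Continuous g) (hgD : ∀ x, |g x| ≤ D) :
      Integrable (fun x => max (g x) 0) m ∧
        τ.finiteFunctional.HasValue (star C * cfc (fun x => x ^ 2 * max (g x) 0) P * C)
          ((∫ x, max (g x) 0 ∂m : ℝ) : ℂ) := by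
    have hle (x : ℝ) : max (g x) 0 ≤ D :=
      max_le ((le_abs_self _).trans (hgD x)) ((abs_nonneg _).trans (hgD x))
    exact ⟨.of_bound (by fun_prop) D (.of_forall fun x => by
        rw [Real.norm_eq_abs, abs_of_nonneg (le_max_right _ _)]
        exact hle x),
      hm.hasValue_of_nonneg hP hC (by fun_prop) (fun x => le_max_right _ _) hle⟩
  obtain ⟨hpint, hpval⟩ := hpart hκ hD
  obtain ⟨hnint, hnval⟩ := hpart (g := fun x => -κ x) hκ.neg fun x =>
    (abs_neg (κ x)).trans_le (hD x)
  have hsub := hpval.sub hnval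
  rw [← Complex.ofReal_sub, ← integral_sub hpint hnint, ← sub_mul, ← mul_sub,
    ← cfc_sub (fun x => x ^ 2 * max (κ x) 0) (fun x => x ^ 2 * max (-κ x) 0) P
      (by fun_prop) (by fun_prop)] at hsub
  simpa only [← mul_sub, max_zero_sub_max_neg_zero_eq_self] using hsub

theorem cfc_smul_eq {f k : ℝ → ℝ} {D : ℝ} (hf : IsProfile f k D) (hP : 0 ≤ P) {t : ℝ}
    (ht : 0 ≤ t) : cfc f (t • P) = cfc (fun x => x ^ 2 * (t ^ 2 * k (t * x))) P := by
  have hPs : IsSelfAdjoint P := .of_nonneg hP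
  have hpos (x : ℝ) (hx : x ∈ spectrum ℝ P) : 0 ≤ t * x :=
    mul_nonneg ht (spectrum_nonneg_of_nonneg hP hx)
  rw [← cfc_comp_const_mul t f P (hf.continuousOn.mono (image_subset_iff.2 hpos))]
  refine cfc_congr fun x hx => ?_
  simp only [hf.eq _ (hpos x hx)]
  ring

theorem LogBounded.isTraceClass_cfc_mul (hP : τ.LogBounded P) (hB : B ∈ N) {f k : ℝ → ℝ} {D : ℝ}
    (hf : IsProfile f k D) {t : ℝ} (ht : 0 ≤ t) : τ.IsTraceClass (cfc f (t • P) * B) := by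
  refine ⟨mul_mem (cfc_mem (real_smul_mem t hP.mem) f) hB, ?_⟩
  have hκ : Continuous fun x => t ^ 2 * k (t * x) :=
    (hf.continuous.comp (continuous_const_mul t)).const_mul _
  set R := cfc (fun x => t ^ 2 * k (t * x)) P with hR
  have hRs : star R = R := (cfc_predicate (p := IsSelfAdjoint) _ P).star_eq
  have hcomm : R * P = P * R := ((Commute.refl P).cfc_real _).eq
  have hfactor : cfc f (t • P) * B = star (P * R) * (P * B) := by
    rw [cfc_smul_eq hf hP.nonneg ht, ← mul_cfc_mul hP.nonneg hκ.continuousOn, ← hR, star_mul, hRs,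
      hP.isSelfAdjoint.star_eq, hcomm]
    simp only [mul_assoc]
  have hRN : R ∈ N := cfc_mem hP.mem _
  rw [hfactor]
  exact τ.toFun_abs_star_mul_lt_top (mul_mem hP.mem hRN) (mul_mem hP.mem hB)
    (hP.toFun_star_mul_mul_lt_top hRN) (hP.toFun_star_mul_mul_lt_top hB)

theorem LogBounded.heat_eq_sum (hP : τ.LogBounded P) (hB : B ∈ N) {f k : ℝ → ℝ} {D : ℝ}
    (hf : IsProfile f k D) {m : ℕ → Measure ℝ} (hm : ∀ j, τ.Represents P (polar B j) (m j)) {t : ℝ}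
    (ht : 0 < t) : τ.heat f B P t
      = ∑ j ∈ Finset.range 4, (4⁻¹ * Complex.I ^ j) * (dilIntegral (m j) k t : ℂ) := by
  have hκ : Continuous fun x => t ^ 2 * k (t * x) :=
    (hf.continuous.comp (continuous_const_mul t)).const_mul _
  have hκb (x : ℝ) : |t ^ 2 * k (t * x)| ≤ t ^ 2 * D := by
    rw [abs_mul, abs_sq]
    exact mul_le_mul_of_nonneg_left (hf.abs_le _) (sq_nonneg t)
  have h_int (j : ℕ) : ∫ x, t ^ 2 * k (t * x) ∂(m j) = t * dilIntegral (m j) k t := by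
    rw [dilIntegral, ← integral_const_mul]
    simp only [sq, mul_assoc]
  have hval : τ.finiteFunctional.HasValue (cfc f (t • P) * B) (4⁻¹ * ∑ j ∈ Finset.range 4,
      Complex.I ^ j * ((t * dilIntegral (m j) k t : ℝ) : ℂ)) := by
    rw [mul_eq_sum_polar, cfc_smul_eq hf hP.nonneg ht.le]
    refine .smul (.sum fun j _ => .smul ?_ _) _
    rw [← h_int j]
    exact (hm j).hasValue hP.mem (polar_mem hB j) hκ hκb
  have htr : τ.tr (cfc f (t • P) * B) = _ := hval.jordanExtend_eq
  have ht0 : (t : ℂ) ≠ 0 := Complex.ofReal_ne_zero.2 ht.ne'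
  rw [heat, htr, Finset.mul_sum, Finset.mul_sum]
  refine Finset.sum_congr rfl fun j _ => ?_
  rw [Complex.ofReal_mul]
  field_simp

section Heat

variable (hP : τ.LogBounded P) (hB : B ∈ N) {f k : ℝ → ℝ} {D : ℝ} (hf : IsProfile f k D)

include hP hB hf

theorem LogBounded.heatAdmissible : τ.HeatAdmissible f B P := by
  choose m hm using fun j => hP.exists_represents (polar_mem hB j)
  have hfin (j : ℕ) := (hm j).isFiniteMeasure
  exact ⟨hP.mem_dixmierIdeal, fun t ht => hP.isTraceClass_cfc_mul hB hf ht.le,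
    cesaroBounded_of_eq_sum (Finset.range 4)
      (fun j _ => locallyIntegrable_dilIntegral (m := m j) hf.continuous hf.abs_le)
      (fun j _ => memLInfty_realCesaro_dilIntegral (hm j).isLogMeasure hf.continuous hf.bound)
      fun t ht => hP.heat_eq_sum hB hf hm ht⟩

theorem LogBounded.evalCesaro_heat (hω : IsGeneralisedLimit ω) (hωd : IsDilationInvariant ω) :
    evalCesaro ω (τ.heat f B P) =
      ((∫ s in Ioi (0 : ℝ), f s / s ^ 2 : ℝ) : ℂ) * τ.dixmierMul ω P B := by
  choose m hm using fun j => hP.exists_represents (polar_mem hB j)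
  have hfin (j : ℕ) := (hm j).isFiniteMeasure
  have hdix (j : ℕ) : τ.dixmier ω P (polar B j) = logLim ω (dilIntegral (m j) refProfile) :=
    logLim_congr fun T hT => (hm j).softThresholdTrace_eq hP.isSelfAdjoint hT
  rw [evalCesaro_eq_sum (Finset.range 4)
    (fun j _ => locallyIntegrable_dilIntegral (m := m j) hf.continuous hf.abs_le)
    (fun j _ => memLInfty_realCesaro_dilIntegral (hm j).isLogMeasure hf.continuous hf.bound)
    fun t ht => hP.heat_eq_sum hB hf hm ht, dixmierMul, Finset.mul_sum, Finset.mul_sum]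
  refine Finset.sum_congr rfl fun j _ => ?_
  rw [evalAt_realCesaro_dilIntegral hω hωd (hm j).isLogMeasure hf.continuous hf.bound, hdix,
    hf.integral_div_sq, Complex.ofReal_mul]
  ring

end Heat

theorem xiGen_eq (hω : IsGeneralisedLimit ω) (hωd : IsDilationInvariant ω) {A : H →L[ℂ] H}
    (hA : A ∈ τ.dixmierIdeal) (hB : B ∈ N) {f k : ℝ → ℝ} {D : ℝ} (hf : IsProfile f k D) :
    τ.xiGen ω B f A = ((∫ s in Ioi (0 : ℝ), f s / s ^ 2 : ℝ) : ℂ) *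
      jordanExtend (fun P => (τ.dixmier ω P 1 : ℂ)) (A * B) := by
  have hpart {P} (hP : P ∈ jordanParts A) : evalCesaro ω (τ.heat f B P) = _ :=
    (logBounded_of_mem_jordanParts hA hP).evalCesaro_heat hB hf hω hωd
  rw [jordanExtend_dixmier_mul hω hωd hA hB, xiGen, jordanExtend, jordanExtend,
    hpart (by simp [jordanParts]), hpart (by simp [jordanParts]), hpart (by simp [jordanParts]),
    hpart (by simp [jordanParts])]
  ring

end FNSTrace

end NCHeat

end

theorem mainTheorem1_general {H : Type*} [NormedAddCommGroup H] [InnerProductSpace ℂ H]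
    [CompleteSpace H] (N : VonNeumannAlgebra H) (τ : FNSTrace N) (q : ℝ) (hq : 0 < q) (f : ℝ → ℝ)
    (hf : ContinuousOn f (Ioi 0)) (hfb : ∃ C : ℝ, ∀ s : ℝ, 0 ≤ s → |f s| ≤ C)
    (hf0 : f 0 = 0) {a : ℝ} (ha : Tendsto (fun x => f x / x ^ 2) (𝓝[>] 0) (𝓝 a))
    (A : H →L[ℂ] H) (hA : A ∈ τ.dixmierIdeal) (B : H →L[ℂ] H) (hB : B ∈ N)
    (ω : LInfty →ₗ[ℝ] ℝ) (hω : IsGeneralisedLimit ω) (hωd : IsDilationInvariant ω) :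
    IntegrableOn (fun s : ℝ => f s / s ^ 2) (Ioi 0) ∧
    A * B ∈ τ.dixmierIdeal ∧
    (∀ P ∈ jordanParts A, τ.HeatAdmissible f B P) ∧
    (∀ P ∈ jordanParts (A * B), τ.HeatAdmissible (expInv q) 1 P) ∧
    τ.xiGen ω B f A =
      (((Real.Gamma (1 + 1 / q))⁻¹ * ∫ s in Ioi (0 : ℝ), f s / s ^ 2 : ℝ) : ℂ) *
        τ.xi q ω (A * B) := by
  obtain ⟨k, C, hk⟩ := exists_isProfile hf hfb hf0 ha
  obtain ⟨l, D, hl⟩ := exists_isProfile_expInv hq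
  have hAB := FNSTrace.mul_mem_dixmierIdeal hA hB
  refine ⟨hk.integrableOn_div_sq, hAB,
    fun P hP => (FNSTrace.logBounded_of_mem_jordanParts hA hP).heatAdmissible hB hk,
    fun P hP => (FNSTrace.logBounded_of_mem_jordanParts hAB hP).heatAdmissible (one_mem N) hl, ?_⟩
  have hΓ : (Real.Gamma (1 + 1 / q) : ℂ) ≠ 0 :=
    Complex.ofReal_ne_zero.2 (Real.Gamma_pos_of_pos (by positivity)).ne'
  rw [FNSTrace.xi, FNSTrace.xiGen_eq hω hωd hA hB hk, FNSTrace.xiGen_eq hω hωd hAB (one_mem N) hl,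
    mul_one, integral_expInv_div_sq hq, Complex.ofReal_mul, Complex.ofReal_inv,
    mul_comm (Real.Gamma (1 + 1 / q) : ℂ)⁻¹, mul_assoc, inv_mul_cancel_left₀ hΓ]

theorem mainTheorem1 {H : Type*} [NormedAddCommGroup H] [InnerProductSpace ℂ H] [CompleteSpace H]
    (N : VonNeumannAlgebra H) (τ : FNSTrace N) (q : ℝ) (hq : 0 < q)
    (f : ℝ → ℝ) (hf : ContDiffOn ℝ 2 f (Set.Ici 0)) (hfb : ∃ C : ℝ, ∀ s : ℝ, 0 ≤ s → |f s| ≤ C)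
    (hf0 : f 0 = 0) (hf0' : derivWithin f (Set.Ici 0) 0 = 0)
    (A : H →L[ℂ] H) (hA : A ∈ τ.dixmierIdeal) (B : H →L[ℂ] H) (hB : B ∈ N)
    (ω : LInfty →ₗ[ℝ] ℝ) (hω : IsGeneralisedLimit ω) (hωd : IsDilationInvariant ω) :
    -- all the expressions in the formula are well defined
    MeasureTheory.IntegrableOn (fun s : ℝ => f s / s ^ 2) (Set.Ioi 0) ∧
    A * B ∈ τ.dixmierIdeal ∧
    (∀ P ∈ jordanParts A, τ.HeatAdmissible f B P) ∧
    (∀ P ∈ jordanParts (A * B), τ.HeatAdmissible (expInv q) 1 P) ∧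
    -- the reduction formula
    τ.xiGen ω B f A =
      (((Real.Gamma (1 + 1 / q))⁻¹ * ∫ s in Set.Ioi (0 : ℝ), f s / s ^ 2 : ℝ) : ℂ) *
        τ.xi q ω (A * B) := by
  exact mainTheorem1_general N τ q hq f (hf.continuousOn.mono Set.Ioi_subset_Ici_self) hfb hf0
    (tendsto_div_sq_of_contDiffOn hf hf0 hf0') A hA B hB ω hω hωd
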